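/- **Setting.** Let $\mathcal V^s$ be a finite set of time series and $\mathcal V^f=\mathcal V^s\times\mathbb Z$, with $S_s:=(S,s)$. A *full-time causal graph* (FTCG) is an acyclic directed graph on $\mathcal V^f$ whose edges $A_{s'}\to B_s$ all satisfy $s'\le s$ (no consistency through time is assumed). A *summary causal graph* (SCG) is a directed graph $\mathcal G^s=(\mathcal V^s,\mathcal E^s)$, cycles and self-loops allowed; an FTCG $\mathcal G^f$ is a *candidate* for $\mathcal G^s$ if, for all $A,B$, $A\to B\in\mathcal E^s$ iff $A_{s-\gamma}\to B_s\in\mathcal G^f$ for some $s\in\mathbb Z$, $\gamma\ge 0$. Descendants of a vertex include the vertex itself; $\mathrm{Pa}$ and $\mathrm{Ch}$ denote parents and children. Let $\mathcal X^f=\{X^i_{t-\gamma_i}\}_{i=1}^n$ be a finite set of interventions and $Y_t\notin\mathcal X^f$ the target, with $\gamma_i\ge 0$ and $Y$ a descendant of $X^i$ in $\mathcal G^s$ for every $i$; put $\mathcal X^s=\{X^i\}_i$. For an FTCG, a path (distinct vertices, consecutive ones adjacent) from $\mathcal X^f$ to $Y_t$ is *proper* if only its first vertex is in $\mathcal X^f$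 and *causal* if all its edges point towards $Y_t$; $\mathrm{Forb}$ is the set of descendants of the vertices $W\notin\mathcal X^f$ lying on proper causal paths from $\mathcal X^f$ to $Y_t$. A set $Z$ *blocks* a path if $Z$ contains a non-collider of the path, or some collider of the path has no descendant in $Z$. The effect $P(y_t\mid \mathrm{do}((x^i_{t-\gamma_i})_i))$ is *identifiable by common adjustment in $\mathcal G^s$* if there is a set $Z\subseteq\mathcal V^f$ disjoint from $\mathcal X^f\cup\{Y_t\}$ such that in every candidate FTCG of $\mathcal G^s$ one has $Z\cap\mathrm{Forb}=\emptyset$ and $Z$ blocks every proper non-causal path from $\mathcal X^f$ to $Y_t$. **Algorithm.** Input: $\mathcal G^s$ (lists of parents and children), the list $\mathcal X^f$, $Y$, $t$. All "first/last time not in $\mathcal X^f$" queries below are answered from tables computed after sorting $\mathcal X^f$ by time. 1. *(Ancestor times.)* Put $A(Y)=t$, mark $Y$ seen, $A(S)=-\infty$ for $S\ne Y$, and let the priority queue be $Q=\{Y_t\}$. While $Q\ne\emptyset$, pop an $S_s$ of maximal time; for every unseen $P\in\mathrm{Pa}(S)$ put $A(P)=\max\{s_1\le s\mid P_{s_1}\notin\mathcal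 X^f\}$, insert $P_{A(P)}$ into $Q$, mark $P$ seen. 2. *(Entrance times.)* For each $C\in\mathrm{Ch}(\mathcal X^s)$ let $t_{\min}=\min\{t-\gamma_i\mid X^i\in\mathrm{Pa}(C)\}$, $t_C=\min\{s\in[t_{\min},A(C)]\mid C_s\notin\mathcal X^f\}$ ($+\infty$ if there is none), and let $d(C)$ be true iff $t-\gamma_i<t_C$ for some $X^i\in\mathrm{Pa}(C)$ or $t-\gamma_i=t_C$ for at least two $i$ with $X^i\in\mathrm{Pa}(C)$. Put $t_{\mathcal{NC}}(S)=+\infty$ for all $S$, all $S$ unseen. Go through the $C$ with $t_C<+\infty$ in increasing lexicographic order of $(t_C,\ \text{not } d(C))$. If $d(C)$, put $t_{\mathcal{NC}}(D)=\min\{s\ge t_C\mid D_s\notin\mathcal X^f\}$ for every unseen descendant $D$ of $C$ in $\mathcal G^s$ and mark $D$ seen. If not $d(C)$, let $X^i$ be the only parent of $C$ intervened on at a time $\le t_C$; do the same for every unseen descendant $D$ of $C$ in $\mathcal G^s\setminus\{X^i\}$, and then put $t_{\mathcal{NC}}(D)=\min\{s\ge t_C+1\mid D_s\notin\mathcal X^f\}$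 for every still unseen descendant $D$ of $C$ in $\mathcal G^s$ and mark $D$ seen. 3. *(Directed paths.)* Let $\mathcal S=\{S\mid t_{\mathcal{NC}}(S)\le t\}\cup\{X^i\mid\gamma_i=0\}$. If some $X^i$ with $\gamma_i=0$ is a descendant of $Y$ in the subgraph of $\mathcal G^s$ induced by $\mathcal S$, return False. 4. *(Accessibility times.)* For each $v\in\{Y_t\}\cup\mathcal X^f$ compute $t^{\mathcal{NC}}_v$: start with $t^{\mathcal{NC}}_v(S)=-\infty$, all $S$ unseen, $Q=\{v\}$; while $Q\neq\emptyset$, pop an $S_s$ of maximal time, and for every unseen $P\in\mathrm{Pa}(S)$ put $t^{\mathcal{NC}}_v(P)=\max\{s_1\le s\mid s_1\ge t_{\mathcal{NC}}(P),\ P_{s_1}\notin\mathcal X^f\cup\{v\}\}$ ($-\infty$ if there is none), insert $P_{t^{\mathcal{NC}}_v(P)}$ into $Q$ if this is finite, and mark $P$ seen. 5. *(Fork paths.)* If $t_{\mathcal{NC}}(F)\le t^{\mathcal{NC}}_{X^i_{t-\gamma_i}}(F)$ and $t_{\mathcal{NC}}(F)\le t^{\mathcal{NC}}_{Y_t}(F)$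 for some $F\in\mathcal V^s$ and some $i$, return False. Otherwise return True. **Theorem.** The effect is identifiable by common adjustment in $\mathcal G^s$ if and only if the algorithm returns True. Moreover, for $n\ge 1$ the algorithm (with the priority queue and the sorting implemented by heaps) runs on a unit-cost random access machine in $$O\bigl(|\mathcal X^f|\,(\log|\mathcal X^f|+(|\mathcal E^s|+|\mathcal V^s|)\log|\mathcal V^s|)\bigr)$$ steps, i.e. there is an absolute constant $K$ such that the number of steps is at most $K\bigl(1+|\mathcal X^f|(\log|\mathcal X^f|+(|\mathcal E^s|+|\mathcal V^s|)\log|\mathcal V^s|)\bigr)$ on every input. -/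

import Mathlib

namespace CommonAdjustment

/-! ### Directed graphs: paths, blocking, the adjustment criterion

A directed graph on `W` is given by its edge relation `E : W → W → Prop`. -/

section Graphs

variable {W : Type*}

/-- `π` is a path: distinct vertices, consecutive ones joined by an edge (in either direction). -/
def IsPath (E : W → W → Prop) (π : List W) : Prop :=
  π.Nodup ∧ π.IsChain (fun a b => E a b ∨ E b a)

/-- `π` is a path from some vertex of `A` to some vertex of `B` and only its first vertex is
in `A`. -/
def IsProperPath (E : W → W → Prop) (A B : Set W) (π : List W) : Prop :=
  IsPath E π ∧ (∃ a ∈ A, π.head? = some a) ∧ (∃ b ∈ B, π.getLast? = some b) ∧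
    ∀ v ∈ π.tail, v ∉ A

/-- All edges of `π` point towards its last vertex. -/
def IsCausal (E : W → W → Prop) (π : List W) : Prop := π.IsChain E

/-- Descendants of `v`, including `v` itself. -/
def Desc (E : W → W → Prop) (v : W) : Set W := {w | Relation.ReflTransGen E v w}

/-- `c` is a collider on `π`: `π` contains `a → c ← b` as a subpath. -/
def IsCollider (E : W → W → Prop) (π : List W) (c : W) : Prop :=
  ∃ a b, [a, c, b] <:+: π ∧ E a c ∧ E b c

/-- `Z` blocks `π`. -/
def Blocks (E : W → W → Prop) (Z : Set W) (π : List W) : Prop :=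
  (∃ v ∈ π, ¬ IsCollider E π v ∧ v ∈ Z) ∨
    ∃ c, IsCollider E π c ∧ ∀ d ∈ Desc E c, d ∉ Z

/-- The forbidden set: all descendants of any `w ∉ A` lying on a proper causal path from `A`
to `B`. -/
def Forb (E : W → W → Prop) (A B : Set W) : Set W :=
  {d | ∃ π, IsProperPath E A B π ∧ IsCausal E π ∧ ∃ w ∈ π, w ∉ A ∧ d ∈ Desc E w}

/-- The adjustment criterion for `Z` relative to `(A, B)`. -/
def AdjustmentCriterion (E : W → W → Prop) (A B Z : Set W) : Prop :=
  Disjoint (Forb E A B) Z ∧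
    ∀ π, IsProperPath E A B π → ¬ IsCausal E π → Blocks E Z π

end Graphs

/-! ### Full-time causal graphs, summary causal graphs, common adjustment -/

section TimeSeries

variable {V : Type*}

/-- A full-time causal graph on the series `V`: an acyclic graph on the vertices `(S, s)`
(series `S` at time `s : ℤ`) whose edges do not go backward in time.  No consistency through
time is required. -/
structure FTCG (V : Type*) where
  Edge : V × ℤ → V × ℤ → Prop
  forward : ∀ a b, Edge a b → a.2 ≤ b.2
  acyclic : ∀ a, ¬ Relation.TransGen Edge a a

/-- `F` is a candidate for the summary graph with edge relation `E`: `E` is reduced from `F`. -/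
def IsCandidate (E : V → V → Prop) (F : FTCG V) : Prop :=
  ∀ A B, E A B ↔ ∃ (s : ℤ) (γ : ℕ), F.Edge (A, s - γ) (B, s)

/-- The common adjustment criterion for `Z` relative to `(A, B)` in the summary graph. -/
def CommonAdjustmentCriterion (E : V → V → Prop) (A B Z : Set (V × ℤ)) : Prop :=
  ∀ F : FTCG V, IsCandidate E F → AdjustmentCriterion F.Edge A B Z

/-- The effect of `A` on `B` is identifiable by common adjustment in the summary graph. -/
def IsIdentifiable (E : V → V → Prop) (A B : Set (V × ℤ)) : Prop :=
  ∃ Z : Set (V × ℤ), Disjoint Z A ∧ Disjoint Z B ∧ CommonAdjustmentCriterion E A B Z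

end TimeSeries

/-- A summary causal graph on `p` time series, given by its adjacency lists (children and
parents of each series).  Cycles and self-loops are allowed. -/
structure SCG (p : ℕ) where
  ch : Fin p → List (Fin p)
  pa : Fin p → List (Fin p)
  ch_nodup : ∀ v, (ch v).Nodup
  pa_nodup : ∀ v, (pa v).Nodup
  mem_pa : ∀ u v, u ∈ pa v ↔ v ∈ ch u

/-- `u → v` in the summary graph. -/
def SCG.Edge {p : ℕ} (G : SCG p) (u v : Fin p) : Prop := v ∈ G.ch u

instance {p : ℕ} (G : SCG p) (u v : Fin p) : Decidable (G.Edge u v) :=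
  inferInstanceAs (Decidable (v ∈ G.ch u))

/-- The number of edges of the summary graph. -/
def SCG.numEdges {p : ℕ} (G : SCG p) : ℕ :=
  (Finset.univ.filter fun e : Fin p × Fin p => G.Edge e.1 e.2).card

/-! ### Step counting

A computation of type `Timed α` is a result together with the number of steps spent on it.
The model is the unit-cost random access machine: every memory access, every iteration of a
loop and every recursive call is charged one step, and between two charges only a bounded number
of register operations (integer arithmetic and comparisons, tests, following a pointer) is
executed.  Arrays are used in a single-threaded way only. -/

structure Timed (α : Type) where
  val : α
  cost : ℕ

instance : Monad Timed where
  pure a := ⟨a, 0⟩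
  bind x f := ⟨(f x.val).val, x.cost + (f x.val).cost⟩

/-- One step. -/
def step : Timed Unit := ⟨(), 1⟩

/-- `for a in l do s ← f s a`, one step per iteration plus the cost of the body. -/
def forEach {α σ : Type} : List α → σ → (σ → α → Timed σ) → Timed σ
  | [], s, _ => pure s
  | a :: l, s, f => do
    step
    let s ← f s a
    forEach l s f

/-- Is `f a` true for some `a` in `l`?  Leaves the loop at the first such `a`. -/
def anyOf {α : Type} : List α → (α → Timed Bool) → Timed Bool
  | [], _ => pure false
  | a :: l, f => do
    step
    let b ← f a
    if b then pure true else anyOf l f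

/-- A block of memory cells indexed by `ι`. -/
def Arr (ι α : Type) : Type := ι → α

/-- Reading a cell. -/
def Arr.get {ι α : Type} (a : Arr ι α) (i : ι) : Timed α := ⟨a i, 1⟩

/-- Writing a cell. -/
def Arr.set {ι α : Type} [DecidableEq ι] (a : Arr ι α) (i : ι) (v : α) : Timed (Arr ι α) :=
  ⟨Function.update a i v, 1⟩

/-- An array with one cell per series, every cell being set to `v`. -/
def newArr {α : Type} (p : ℕ) (v : α) : Timed (Arr (Fin p) α) := ⟨fun _ => v, p + 1⟩

/-- Memory addressed by (series, time), all cells being blank at the start. -/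
abbrev Table (p : ℕ) : Type := Arr (Fin p × ℤ) (Option ℤ)

/-- A blank table. -/
def newTable (p : ℕ) : Timed (Table p) := ⟨fun _ => none, 1⟩

/-! ### Priority queues (leftist heaps) and sorting -/

inductive Heap (α : Type) where
  | leaf : Heap α
  | node (rank : ℕ) (x : α) (l r : Heap α) : Heap α

namespace Heap

variable {α : Type}

def rank : Heap α → ℕ
  | leaf => 0
  | node k _ _ _ => k

def make (x : α) (a b : Heap α) : Heap α :=
  if b.rank ≤ a.rank then node (b.rank + 1) x a b else node (a.rank + 1) x b a

/-- `before x y` means that `x` may leave the queue before `y`. -/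
def merge (before : α → α → Bool) : Heap α → Heap α → Timed (Heap α)
  | leaf, b => do
    step
    pure b
  | node k x l r, leaf => do
    step
    pure (node k x l r)
  | node k x l r, node k' x' l' r' => do
    step
    if before x x' then
      let m ← merge before r (node k' x' l' r')
      pure (make x l m)
    else
      let m ← merge before (node k x l r) r'
      pure (make x' l' m)
termination_by a b => sizeOf a + sizeOf b

def insert (before : α → α → Bool) (x : α) (h : Heap α) : Timed (Heap α) :=
  merge before (node 1 x leaf leaf) h

def pop (before : α → α → Bool) : Heap α → Timed (Option (α × Heap α))
  | leaf => do
    step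
    pure none
  | node _ x l r => do
    step
    let m ← merge before l r
    pure (some (x, m))

/-- Pop the elements one after the other; the numerical argument is the number of elements. -/
def drain (before : α → α → Bool) : ℕ → Heap α → Timed (List α)
  | 0, _ => pure []
  | k + 1, h => do
    step
    match ← h.pop before with
    | none => pure []
    | some (x, h) => do
      let l ← drain before k h
      pure (x :: l)

end Heap

/-- Sorting in the order `before`. -/
def heapSort {α : Type} (before : α → α → Bool) (l : List α) : Timed (List α) := do
  let h ← forEach l Heap.leaf fun h x => h.insert before x
  h.drain before l.length

/-! ### The next and the previous time at which a series is not intervened on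

`X` is the list of interventions. -/

/-- For every intervention `(S, s)` the cell `(S, s)` receives
`min {s₁ ≥ s | (S, s₁) ∉ X}`; the other cells stay blank. -/
def nextTable {p : ℕ} (X : List (Fin p × ℤ)) : Timed (Table p) := do
  let L ← heapSort (fun a b => decide (b.2 ≤ a.2)) X
  let T ← newTable p
  forEach L T fun T x => do
    let r ← T.get (x.1, x.2 + 1)
    T.set x (some (r.getD (x.2 + 1)))

/-- For every intervention `(S, s)` the cell `(S, s)` receives
`max {s₁ ≤ s | (S, s₁) ∉ X}`; the other cells stay blank. -/
def prevTable {p : ℕ} (X : List (Fin p × ℤ)) : Timed (Table p) := do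
  let L ← heapSort (fun a b => decide (a.2 ≤ b.2)) X
  let T ← newTable p
  forEach L T fun T x => do
    let r ← T.get (x.1, x.2 - 1)
    T.set x (some (r.getD (x.2 - 1)))

/-- `min {s₁ ≥ s | (S, s₁) ∉ X}` if `T` is the table of next times and
`max {s₁ ≤ s | (S, s₁) ∉ X}` if it is the table of previous times. -/
def free {p : ℕ} (T : Table p) (S : Fin p) (s : ℤ) : Timed ℤ := do
  let r ← T.get (S, s)
  pure (r.getD s)

/-! ### Backward search with a priority queue ordered by time -/

structure SearchState (p : ℕ) where
  queue : Heap (Fin p × ℤ)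
  seen : Arr (Fin p) Bool
  val : Arr (Fin p) (Option ℤ)

/-- The vertex with the largest time leaves the queue first. -/
def later {p : ℕ} (a b : Fin p × ℤ) : Bool := decide (b.2 ≤ a.2)

/-- `while Q ≠ ∅`: pop the vertex `(S, s)` of `Q` with the largest time; for every unseen parent
`P` of `S` record `best P s` (`none` is `-∞`), insert `P` at that time into `Q` if it is finite,
and mark `P` as seen.  Every series is inserted at most once on top of the initial vertex, so
that the loop ends with an empty queue after at most `p + 1` pops; the numerical argument only
makes the termination visible. -/
def search {p : ℕ} (G : SCG p) (best : Fin p → ℤ → Timed (Option ℤ)) :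
    ℕ → SearchState p → Timed (Arr (Fin p) (Option ℤ))
  | 0, σ => pure σ.val
  | k + 1, σ => do
    step
    match ← σ.queue.pop later with
    | none => pure σ.val
    | some (u, Q) => do
      let σ ← forEach (G.pa u.1) (⟨Q, σ.seen, σ.val⟩ : SearchState p) fun σ P => do
        let b ← σ.seen.get P
        if b then pure σ
        else
          let τ ← best P u.2
          let val ← σ.val.set P τ
          let seen ← σ.seen.set P true
          match τ with
          | none => pure ⟨σ.queue, seen, val⟩
          | some τ => do
            let Q ← σ.queue.insert later (P, τ)
            pure ⟨Q, seen, val⟩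
      search G best k σ

/-- For each series `S` the largest time at which `S` is an ancestor of `Y_t` outside the
interventions. -/
def ancestorTimes {p : ℕ} (G : SCG p) (prv : Table p) (Y : Fin p) (t : ℤ) :
    Timed (Arr (Fin p) (Option ℤ)) := do
  let Q ← Heap.leaf.insert later (Y, t)
  let val ← newArr p none
  let seen ← newArr p false
  let val ← val.set Y (some t)
  let seen ← seen.set Y true
  search G (fun P s => do
    let τ ← free prv P s
    pure (some τ)) (p + 2) ⟨Q, seen, val⟩

/-- The times of accessibility from each series to the vertex `v` inside the non-conditionable
set, the latter being given by the entrance times `tNC` (`none` is `+∞`):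
`best P s = max {s₁ ≤ s | s₁ ≥ tNC P, (P, s₁) ∉ X, (P, s₁) ≠ v}`. -/
def accessTimes {p : ℕ} (G : SCG p) (prv : Table p) (tNC : Arr (Fin p) (Option ℤ))
    (v : Fin p × ℤ) : Timed (Arr (Fin p) (Option ℤ)) := do
  let Q ← Heap.leaf.insert later v
  let val ← newArr p none
  let seen ← newArr p false
  search G (fun P s => do
    let τ₀ ← free prv P s
    let τ ← if (P, τ₀) = v then free prv P (τ₀ - 1) else pure τ₀
    match ← tNC.get P with
    | none => pure none
    | some e => pure (if e ≤ τ then some τ else none)) (p + 2) ⟨Q, seen, val⟩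

/-! ### Forward search -/

/-- Graph search: `stack` holds the vertices that are marked in `vis` but not yet expanded; only
vertices that satisfy `ok` are entered.  Returns the marks and the list of expanded vertices.
Every series enters the stack at most once, so that the stack is empty after at most `p`
rounds; the numerical argument only makes the termination visible. -/
def explore {p : ℕ} (G : SCG p) (ok : Fin p → Timed Bool) :
    ℕ → List (Fin p) → Arr (Fin p) Bool → List (Fin p) →
      Timed (Arr (Fin p) Bool × List (Fin p))
  | 0, _, vis, acc => pure (vis, acc)
  | _ + 1, [], vis, acc => do
    step
    pure (vis, acc)
  | k + 1, v :: stack, vis, acc => do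
    step
    let σ ← forEach (G.ch v) (stack, vis) fun σ w => do
      let b ← σ.2.get w
      let c ← ok w
      if b || !c then pure σ
      else
        let vis ← σ.2.set w true
        pure (w :: σ.1, vis)
    explore G ok k σ.1 σ.2 (v :: acc)

/-- The descendants of `C` in the subgraph induced by `ok` that are reached through vertices not
marked in `vis`; they become marked. -/
def descendants {p : ℕ} (G : SCG p) (ok : Fin p → Timed Bool) (C : Fin p)
    (vis : Arr (Fin p) Bool) : Timed (Arr (Fin p) Bool × List (Fin p)) := do
  let b ← vis.get C
  let c ← ok C
  if b || !c then pure (vis, [])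
  else
    let vis ← vis.set C true
    explore G ok (p + 1) [C] vis []

/-! ### Entrance times of the series into the non-conditionable set -/

/-- Minimum, `none` being `+∞`. -/
def optMin : Option ℤ → Option ℤ → Option ℤ
  | none, b => b
  | some a, none => some a
  | some a, some b => some (min a b)

/-- For each series the time of its first intervention. -/
def firstTimes {p : ℕ} (X : List (Fin p × ℤ)) : Timed (Arr (Fin p) (Option ℤ)) := do
  let A ← newArr p none
  forEach X A fun A x => do
    let r ← A.get x.1
    A.set x.1 (optMin r (some x.2))

/-- A child `C` of an intervened series with its finite time `t_C`.  The field `skip` is `none`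
if `d(C)` holds; otherwise it is the only series `X^i` with `X^i → C` that is intervened on at a
time `≤ t_C`. -/
structure Entry (p : ℕ) where
  C : Fin p
  time : ℤ
  skip : Option (Fin p)

/-- The order by `(t_C, not d(C))`. -/
def Entry.before {p : ℕ} (a b : Entry p) : Bool :=
  decide (a.time < b.time) ||
    (decide (a.time = b.time) && (a.skip.isNone || b.skip.isSome))

/-- The list of the children `C` of intervened series with `t_C < +∞`, where
`t_min = min {t - γ_i | X^i → C}`, `t_C = min {s ∈ [t_min, anc C] | (C, s) ∉ X}` and `d(C)` holds
if some `X^i → C` has `t - γ_i < t_C` or at least two have `t - γ_i = t_C`. -/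
def entries {p : ℕ} (G : SCG p) (nxt : Table p) (first anc : Arr (Fin p) (Option ℤ)) :
    Timed (List (Entry p)) :=
  forEach (List.finRange p) [] fun L C => do
    let tmin ← forEach (G.pa C) none fun m x => do
      let r ← first.get x
      pure (optMin m r)
    let a ← anc.get C
    match tmin, a with
    | some tmin, some a => do
      let tC ← free nxt C tmin
      if a < tC then pure L
      else
        let simul ← forEach (G.pa C) [] fun l x => do
          let r ← nxt.get (x, tC)
          pure (if r.isSome then x :: l else l)
        let d := decide (tmin < tC) || decide (2 ≤ simul.length)
        pure (⟨C, tC, if d then none else simul.head?⟩ :: L)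
    | _, _ => pure L

/-- For each `D` in `ds` whose entrance time is not yet set, set it to
`min {s₁ ≥ s | (D, s₁) ∉ X}`. -/
def assign {p : ℕ} (nxt : Table p) (s : ℤ) (ds : List (Fin p))
    (tNC : Arr (Fin p) (Option ℤ)) : Timed (Arr (Fin p) (Option ℤ)) :=
  forEach ds tNC fun tNC D => do
    match ← tNC.get D with
    | some _ => pure tNC
    | none => do
      let τ ← free nxt D s
      tNC.set D (some τ)

structure EntranceState (p : ℕ) where
  /-- marks of the searches in the graph with a series removed -/
  vis₁ : Arr (Fin p) Bool
  /-- marks of the searches in the whole graph -/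
  vis₂ : Arr (Fin p) Bool
  tNC : Arr (Fin p) (Option ℤ)

/-- Computation of the entrance times (`none` is `+∞`). -/
def entranceTimes {p : ℕ} (G : SCG p) (X : List (Fin p × ℤ)) (Y : Fin p) (t : ℤ)
    (nxt prv : Table p) : Timed (Arr (Fin p) (Option ℤ)) := do
  let anc ← ancestorTimes G prv Y t
  let first ← firstTimes X
  let L ← entries G nxt first anc
  let L ← heapSort Entry.before L
  let vis₁ ← newArr p false
  let vis₂ ← newArr p false
  let tNC ← newArr p none
  let σ ← forEach L (⟨vis₁, vis₂, tNC⟩ : EntranceState p) fun σ e => do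
    match e.skip with
    | none => do
      let r₂ ← descendants G (fun _ => pure true) e.C σ.vis₂
      let tNC ← assign nxt e.time r₂.2 σ.tNC
      pure ⟨σ.vis₁, r₂.1, tNC⟩
    | some x => do
      let r₁ ← descendants G (fun w => pure (decide (w ≠ x))) e.C σ.vis₁
      let tNC ← assign nxt e.time r₁.2 σ.tNC
      let r₂ ← descendants G (fun _ => pure true) e.C σ.vis₂
      let tNC ← assign nxt (e.time + 1) r₂.2 tNC
      pure ⟨r₁.1, r₂.1, tNC⟩
  pure σ.tNC

/-! ### The decision algorithm -/

/-- Comparison of an entrance time (`none` is `+∞`) with a time of accessibility (`none` is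
`-∞`). -/
def leTimes : Option ℤ → Option ℤ → Bool
  | some a, some b => decide (a ≤ b)
  | _, _ => false

/-- The decision algorithm for identifiability by common adjustment of the effect of the
interventions `X` on `Y_t`. -/
def decideIdentifiable {p : ℕ} (G : SCG p) (X : List (Fin p × ℤ)) (Y : Fin p) (t : ℤ) :
    Timed Bool := do
  let nxt ← nextTable X
  let prv ← prevTable X
  let tNC ← entranceTimes G X Y t nxt prv
  -- directed paths: descendants of `Y` in the graph induced by
  -- `{S | tNC S ≤ t} ∪ {X^i | γ_i = 0}`
  let inS ← newArr p false
  let inS ← forEach (List.finRange p) inS fun inS S => do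
    let e ← tNC.get S
    if leTimes e (some t) then inS.set S true else pure inS
  let inS ← forEach X inS fun inS x =>
    if x.2 = t then inS.set x.1 true else pure inS
  let vis ← newArr p false
  let r ← descendants G (fun w => inS.get w) Y vis
  let direct ← anyOf X fun x => do
    let b ← r.1.get x.1
    pure (b && decide (x.2 = t))
  if direct then pure false
  else
    -- fork paths
    let accY ← accessTimes G prv tNC (Y, t)
    let accX ← forEach X [] fun l x => do
      let a ← accessTimes G prv tNC x
      pure (a :: l)
    let fork ← anyOf accX fun a =>
      anyOf (List.finRange p) fun F => do
        let e ← tNC.get F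
        let s₁ ← a.get F
        let s₂ ← accY.get F
        pure (leTimes e s₁ && leTimes e s₂)
    pure (!fork)

end CommonAdjustment

namespace CommonAdjustment

/-! ### Timed computations -/

/-! A set that adjusts in all candidates must avoid every vertex that is forbidden in at least one
of them. Candidates are flexible: all edges of positive lag may be present at once, and the
instantaneous ones only have to increase some rank. Hence a simple walk along possible edges,
together with a simple branch leaving it, always lies in a common candidate (`rankFTCG`,
`exists_candidate_of_branch`).

Necessity. Let `c` be a vertex outside the interventions that an intervention may point to, let `c`
reach `r`, and let `r` reach both an intervention and `Y_t`, all through vertices outside the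
interventions. Then `c` lies on a possible proper causal path, so whatever `c` reaches outside the
interventions is forbidden in some candidate. Another candidate contains a collider-free path from
the intervention back to a vertex `v` and forward to `Y_t`, all of whose inner vertices are of this
kind. No adjustment set survives (`not_isIdentifiable_of_root`). A positive answer of either test
exhibits such an `r`: it is `Y_t` for the directed paths and a series at its entrance time for the
forks.

Sufficiency. Let `N` consist of the vertices outside the interventions at or after the entrance time
of their series, and adjust for everything outside `N`, the interventions and `Y_t`. If `N` is
closed under descendants outside the interventions and contains all entrances to causal paths, it
contains the forbidden sets. On an open path the relevant non-colliders lie in `N`, and an open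
collider has a descendant in the adjustment set, which can be reached from `N` only across an
intervention. So an open proper non-causal path produces a root `r` in `N` as above
(`exists_fork_of_not_blocks`), and the tests find every such root (`tests_of_fork`). If no entrance
to a causal path exists, all interventions are on `Y`, which lies on no cycle, and its ancestors
serve (`commonAdjustment_of_not_transGen`).

The entrance times need not give a closed `N`. When an entry `C` has to avoid a series `x` which is
one of its descendants, the search without `x` may miss something. But then the cycle from `C`
through `x` back to `C` itself yields a fork visible to the tests (`tests_of_cyclic`), so only the
first such entry is analysed, and about the rest of the table only soundness is needed
(`entranceTimes_spec`).

The backward searches are Dijkstra's algorithm with the latest time first (`search_complete`).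
Running times come from potentials: each series carries the cost of being expanded, and this is paid
when it leaves the queue or the stack. -/

@[simp] theorem Timed.pure_val {α : Type} (a : α) : (pure a : Timed α).val = a := rfl

@[simp] theorem Timed.pure_cost {α : Type} (a : α) : (pure a : Timed α).cost = 0 := rfl

@[simp] theorem Timed.bind_val {α β : Type} (x : Timed α) (f : α → Timed β) :
    (x >>= f).val = (f x.val).val := rfl

@[simp] theorem Timed.bind_cost {α β : Type} (x : Timed α) (f : α → Timed β) :
    (x >>= f).cost = x.cost + (f x.val).cost := rfl

@[simp] theorem step_cost : step.cost = 1 := rfl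

@[simp] theorem Arr.get_val {ι α : Type} (a : Arr ι α) (i : ι) : (a.get i).val = a i := rfl

@[simp] theorem Arr.get_cost {ι α : Type} (a : Arr ι α) (i : ι) : (a.get i).cost = 1 := rfl

/-- The array `a` with the cell `i` set to `v`. -/
def Arr.update {ι α : Type} [DecidableEq ι] (a : Arr ι α) (i : ι) (v : α) : Arr ι α :=
  fun j => if j = i then v else a j

@[simp] theorem Arr.update_self {ι α : Type} [DecidableEq ι] (a : Arr ι α) (i : ι) (v : α) :
    a.update i v i = v :=
  if_pos rfl

theorem Arr.update_of_ne {ι α : Type} [DecidableEq ι] {a : Arr ι α} {i j : ι} (h : j ≠ i)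
    (v : α) : a.update i v j = a j :=
  if_neg h

/-- The array all of whose cells are `v`. -/
def Arr.const {ι α : Type} (v : α) : Arr ι α := fun _ => v

@[simp] theorem Arr.const_apply {ι α : Type} (v : α) (i : ι) : (Arr.const v : Arr ι α) i = v := rfl

@[simp] theorem Arr.set_val {ι α : Type} [DecidableEq ι] (a : Arr ι α) (i : ι) (v : α) :
    (a.set i v).val = a.update i v := by
  funext j
  exact Function.update_apply (β := α) a i v j

@[simp] theorem Arr.set_cost {ι α : Type} [DecidableEq ι] (a : Arr ι α) (i : ι) (v : α) :
    (a.set i v).cost = 1 := rfl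

@[simp] theorem newArr_val {α : Type} (p : ℕ) (v : α) : (newArr p v).val = Arr.const v := rfl

@[simp] theorem newArr_cost {α : Type} (p : ℕ) (v : α) : (newArr p v).cost = p + 1 := rfl

@[simp] theorem newTable_cost (p : ℕ) : (newTable p).cost = 1 := rfl

@[simp] theorem free_val {p : ℕ} (T : Table p) (S : Fin p) (s : ℤ) :
    (free T S s).val = (T (S, s)).getD s := rfl

@[simp] theorem free_cost {p : ℕ} (T : Table p) (S : Fin p) (s : ℤ) : (free T S s).cost = 1 := rfl

/-! ### Invariants and costs of loops -/

section Loops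

variable {α σ : Type}

@[simp] theorem forEach_nil (s : σ) (f : σ → α → Timed σ) : forEach [] s f = pure s := rfl

@[simp] theorem forEach_cons_val (a : α) (l : List α) (s : σ) (f : σ → α → Timed σ) :
    (forEach (a :: l) s f).val = (forEach l (f s a).val f).val := rfl

theorem forEach_cons_cost (a : α) (l : List α) (s : σ) (f : σ → α → Timed σ) :
    (forEach (a :: l) s f).cost = 1 + ((f s a).cost + (forEach l (f s a).val f).cost) := rfl

/-- Loop invariant depending on the part of the list that has been treated. -/
theorem forEach_prefix_inv (I : List α → σ → Prop) (f : σ → α → Timed σ) (l : List α) (s : σ)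
    (h0 : I [] s)
    (hs : ∀ pre a s, pre ++ [a] <+: l → I pre s → I (pre ++ [a]) (f s a).val) :
    I l (forEach l s f).val := by
  suffices H : ∀ (m pre : List α) (s : σ), pre ++ m = l → I pre s → I l (forEach m s f).val from
    H l [] s rfl h0
  intro m
  induction m with
  | nil => intro pre s h hI; simpa [← h] using hI
  | cons a m ih =>
    intro pre s h hI
    rw [forEach_cons_val]
    refine ih (pre ++ [a]) _ (by simpa using h) (hs _ _ _ ⟨m, by simpa using h⟩ hI)

theorem forEach_inv (I : σ → Prop) (f : σ → α → Timed σ) (l : List α) (s : σ)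
    (h0 : I s) (hs : ∀ a ∈ l, ∀ s, I s → I (f s a).val) : I (forEach l s f).val :=
  forEach_prefix_inv (fun _ => I) f l s h0 fun pre a s hp hI =>
    hs a (hp.subset (by simp)) s hI

/-- Amortized cost of a loop. -/
theorem forEach_cost (I : σ → Prop) (Φ : σ → ℕ) (c : ℕ) (f : σ → α → Timed σ) (l : List α) (s : σ)
    (h0 : I s)
    (hs : ∀ a ∈ l, ∀ s, I s → I (f s a).val ∧ (f s a).cost + Φ (f s a).val ≤ c + Φ s) :
    I (forEach l s f).val ∧
      (forEach l s f).cost + Φ (forEach l s f).val ≤ l.length * (c + 1) + Φ s := by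
  induction l generalizing s with
  | nil => simpa using h0
  | cons a l ih =>
    obtain ⟨h1, h2⟩ := hs a (by simp) s h0
    obtain ⟨h3, h4⟩ := ih (f s a).val h1 fun b hb => hs b (by simp [hb])
    refine ⟨h3, ?_⟩
    rw [forEach_cons_cost, forEach_cons_val, List.length_cons, add_mul]
    omega

theorem forEach_cost_le (c : ℕ) (f : σ → α → Timed σ) (l : List α) (s : σ)
    (hs : ∀ a ∈ l, ∀ s, (f s a).cost ≤ c) : (forEach l s f).cost ≤ l.length * (c + 1) := by
  simpa using (forEach_cost (fun _ => True) (fun _ => 0) c f l s trivial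
    fun a ha s _ => ⟨trivial, by simpa using hs a ha s⟩).2

theorem anyOf_val (l : List α) (f : α → Timed Bool) :
    (anyOf l f).val = true ↔ ∃ a ∈ l, (f a).val = true := by
  induction l with
  | nil => simp [anyOf]
  | cons a l ih =>
    simp only [anyOf, Timed.bind_val, List.mem_cons, exists_eq_or_imp]
    split
    · simp_all
    · simp_all

theorem anyOf_cost_le (c : ℕ) (l : List α) (f : α → Timed Bool) (hf : ∀ a ∈ l, (f a).cost ≤ c) :
    (anyOf l f).cost ≤ l.length * (c + 1) := by
  induction l with
  | nil => simp [anyOf]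
  | cons a l ih =>
    have h1 := hf a (by simp)
    have h2 := ih fun b hb => hf b (by simp [hb])
    simp only [anyOf, Timed.bind_cost, step_cost, List.length_cons, add_mul]
    split
    · simp only [Timed.pure_cost]; omega
    · omega

end Loops

/-! ### Heaps -/

namespace Heap

variable {α : Type}

def elems : Heap α → Multiset α
  | leaf => 0
  | node _ x l r => x ::ₘ (l.elems + r.elems)

@[simp] theorem elems_leaf : (leaf : Heap α).elems = 0 := rfl

@[simp] theorem elems_node (k : ℕ) (x : α) (l r : Heap α) :
    (node k x l r).elems = x ::ₘ (l.elems + r.elems) := rfl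

def Ordered (before : α → α → Bool) : Heap α → Prop
  | leaf => True
  | node _ x l r => (∀ y ∈ l.elems + r.elems, before x y = true) ∧ l.Ordered before ∧ r.Ordered before

/-- The stored rank is the length of the right spine, and the right child never has the larger rank.
This keeps right spines logarithmic and therefore merging cheap. -/
def Leftist : Heap α → Prop
  | leaf => True
  | node k _ l r => k = r.rank + 1 ∧ r.rank ≤ l.rank ∧ l.Leftist ∧ r.Leftist

@[simp] theorem rank_node (k : ℕ) (x : α) (l r : Heap α) : (node k x l r).rank = k := rfl

theorem elems_make (x : α) (a b : Heap α) : (make x a b).elems = x ::ₘ (a.elems + b.elems) := by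
  unfold make
  split <;> simp [add_comm]

theorem Ordered.make {before : α → α → Bool} {x : α} {a b : Heap α} (ha : a.Ordered before)
    (hb : b.Ordered before) (h : ∀ y ∈ a.elems + b.elems, before x y = true) :
    (make x a b).Ordered before := by
  unfold Heap.make
  split
  · exact ⟨h, ha, hb⟩
  · exact ⟨by rwa [add_comm], hb, ha⟩

theorem Leftist.make {x : α} {a b : Heap α} (ha : a.Leftist) (hb : b.Leftist) :
    (make x a b).Leftist := by
  unfold Heap.make
  split
  · exact ⟨rfl, by assumption, ha, hb⟩
  · exact ⟨rfl, by omega, hb, ha⟩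

theorem elems_merge (before : α → α → Bool) (a b : Heap α) :
    (merge before a b).val.elems = a.elems + b.elems := by
  fun_induction merge before a b with
  | case1 b => simp
  | case2 => simp
  | case3 k x l r k' x' l' r' ih₁ ih₂ =>
    rw [Timed.bind_val]
    split
    · simp only [Timed.bind_val, Timed.pure_val, elems_make, ih₁]
      simp only [elems_node, Multiset.cons_add, Multiset.add_cons, add_assoc]
      rw [Multiset.cons_swap]
    · simp only [Timed.bind_val, Timed.pure_val, elems_make, ih₂]
      simp only [elems_node, Multiset.cons_add, Multiset.add_cons]
      rw [add_left_comm]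

theorem Ordered.merge {before : α → α → Bool} (total : ∀ x y, before x y || before y x)
    (trans : ∀ x y z, before x y → before y z → before x z) {a b : Heap α}
    (ha : a.Ordered before) (hb : b.Ordered before) : (merge before a b).val.Ordered before := by
  fun_induction Heap.merge before a b with
  | case1 b => simpa using hb
  | case2 => simpa using ha
  | case3 k x l r k' x' l' r' ih₁ ih₂ =>
    rw [Timed.bind_val]
    split
    next h =>
      simp only [Timed.bind_val, Timed.pure_val]
      refine Ordered.make ha.2.1 (ih₁ ha.2.2 hb) ?_
      intro y hy
      rw [elems_merge] at hy
      simp only [elems_node, Multiset.mem_add, Multiset.mem_cons] at hy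
      have h1 := ha.1
      have h2 := hb.1
      simp only [Multiset.mem_add] at h1 h2
      rcases hy with hy | hy | rfl | hy
      · exact h1 _ (Or.inl hy)
      · exact h1 _ (Or.inr hy)
      · exact h
      · exact trans _ _ _ h (h2 _ hy)
    next h =>
      simp only [Timed.bind_val, Timed.pure_val]
      refine Ordered.make hb.2.1 (ih₂ ha hb.2.2) ?_
      intro y hy
      rw [elems_merge] at hy
      simp only [elems_node, Multiset.mem_add, Multiset.mem_cons] at hy
      have h1 := ha.1
      have h2 := hb.1
      simp only [Multiset.mem_add] at h1 h2
      have h' : before x' x = true := by have := total x x'; simp_all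
      rcases hy with hy | (rfl | hy) | hy
      · exact h2 _ (Or.inl hy)
      · exact h'
      · exact trans _ _ _ h' (h1 _ hy)
      · exact h2 _ (Or.inr hy)

theorem Leftist.merge (before : α → α → Bool) {a b : Heap α} (ha : a.Leftist) (hb : b.Leftist) :
    (merge before a b).val.Leftist := by
  fun_induction Heap.merge before a b with
  | case1 b => simpa using hb
  | case2 => simpa using ha
  | case3 k x l r k' x' l' r' ih₁ ih₂ =>
    rw [Timed.bind_val]
    split
    · exact Leftist.make ha.2.2.1 (ih₁ ha.2.2.2 hb)
    · exact Leftist.make hb.2.2.1 (ih₂ ha hb.2.2.2)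

/-- Every recursive call moves one step down the right spine of one of the two heaps, and the ranks
are the lengths of these spines; the additional step is the call that meets a leaf. -/
theorem merge_cost_le (before : α → α → Bool) {a b : Heap α} (ha : a.Leftist) (hb : b.Leftist) :
    (merge before a b).cost ≤ a.rank + b.rank + 1 := by
  fun_induction Heap.merge before a b with
  | case1 b => simp
  | case2 => simp
  | case3 k x l r k' x' l' r' ih₁ ih₂ =>
    have h₁ := ih₁ ha.2.2.2 hb
    have h₂ := ih₂ ha hb.2.2.2
    have h₃ := ha.1
    have h₄ := hb.1
    simp only [rank_node] at h₁ h₂ ⊢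
    rw [Timed.bind_cost, step_cost]
    split
    · simp only [Timed.bind_cost, Timed.pure_cost]
      omega
    · simp only [Timed.bind_cost, Timed.pure_cost]
      omega

/-- The left child has at least the rank of the right one, so each unit of rank doubles the number
of elements plus one. -/
theorem Leftist.two_pow_rank_le {h : Heap α} (hh : h.Leftist) : 2 ^ h.rank ≤ h.elems.card + 1 := by
  induction h with
  | leaf => simp [rank]
  | node k x l r ihl ihr =>
    obtain ⟨rfl, h2, h3, h4⟩ := hh
    have h5 := ihl h3
    have h6 := ihr h4
    have h7 : 2 ^ r.rank ≤ 2 ^ l.rank := Nat.pow_le_pow_right (by norm_num) h2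
    simp only [rank_node, pow_succ, elems_node, Multiset.card_cons, Multiset.card_add]
    omega

theorem Leftist.rank_le {h : Heap α} (hh : h.Leftist) {n : ℕ} (hn : h.elems.card ≤ n) :
    h.rank ≤ Nat.log 2 (n + 1) :=
  Nat.le_log_of_pow_le (by norm_num) (hh.two_pow_rank_le.trans (by omega))

theorem elems_insert (before : α → α → Bool) (x : α) (h : Heap α) :
    (h.insert before x).val.elems = x ::ₘ h.elems := by
  simp [insert, elems_merge]

theorem Ordered.insert {before : α → α → Bool} (total : ∀ x y, before x y || before y x)
    (trans : ∀ x y z, before x y → before y z → before x z) (x : α) {h : Heap α}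
    (hh : h.Ordered before) : (h.insert before x).val.Ordered before :=
  Ordered.merge total trans ⟨by simp, trivial, trivial⟩ hh

theorem leftist_singleton (x : α) : (node 1 x leaf leaf).Leftist := ⟨rfl, le_rfl, trivial, trivial⟩

theorem Leftist.insert (before : α → α → Bool) (x : α) {h : Heap α} (hh : h.Leftist) :
    (h.insert before x).val.Leftist :=
  Leftist.merge before (leftist_singleton x) hh

theorem insert_cost_le (before : α → α → Bool) (x : α) {h : Heap α} (hh : h.Leftist) {n : ℕ}
    (hn : h.elems.card ≤ n) : (h.insert before x).cost ≤ Nat.log 2 (n + 1) + 2 := by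
  have h1 := merge_cost_le before (leftist_singleton x) hh
  have h2 := hh.rank_le hn
  simp only [Heap.insert]
  simp only [rank_node] at h1
  omega

theorem pop_eq_none (before : α → α → Bool) (h : Heap α) :
    (h.pop before).val = none ↔ h.elems = 0 := by
  cases h <;> simp [pop]

theorem elems_of_pop {before : α → α → Bool} {h h' : Heap α} {x : α}
    (hp : (h.pop before).val = some (x, h')) : h.elems = x ::ₘ h'.elems := by
  cases h with
  | leaf => simp [pop] at hp
  | node k y l r =>
    simp only [pop, Timed.bind_val, Timed.pure_val, Option.some.injEq, Prod.mk.injEq] at hp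
    obtain ⟨rfl, rfl⟩ := hp
    simp [elems_merge]

theorem before_of_pop {before : α → α → Bool} {h h' : Heap α} {x : α} (hh : h.Ordered before)
    (hp : (h.pop before).val = some (x, h')) : ∀ y ∈ h'.elems, before x y = true := by
  cases h with
  | leaf => simp [pop] at hp
  | node k y l r =>
    simp only [pop, Timed.bind_val, Timed.pure_val, Option.some.injEq, Prod.mk.injEq] at hp
    obtain ⟨rfl, rfl⟩ := hp
    rw [elems_merge]
    exact hh.1

theorem Ordered.of_pop {before : α → α → Bool} (total : ∀ x y, before x y || before y x)
    (trans : ∀ x y z, before x y → before y z → before x z) {h h' : Heap α} {x : α}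
    (hh : h.Ordered before) (hp : (h.pop before).val = some (x, h')) : h'.Ordered before := by
  cases h with
  | leaf => simp [pop] at hp
  | node k y l r =>
    simp only [pop, Timed.bind_val, Timed.pure_val, Option.some.injEq, Prod.mk.injEq] at hp
    obtain ⟨rfl, rfl⟩ := hp
    exact Ordered.merge total trans hh.2.1 hh.2.2

theorem Leftist.of_pop {before : α → α → Bool} {h h' : Heap α} {x : α}
    (hh : h.Leftist) (hp : (h.pop before).val = some (x, h')) : h'.Leftist := by
  cases h with
  | leaf => simp [pop] at hp
  | node k y l r =>
    simp only [pop, Timed.bind_val, Timed.pure_val, Option.some.injEq, Prod.mk.injEq] at hp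
    obtain ⟨rfl, rfl⟩ := hp
    exact Leftist.merge before hh.2.2.1 hh.2.2.2

theorem pop_cost_le (before : α → α → Bool) {h : Heap α} (hh : h.Leftist) {n : ℕ}
    (hn : h.elems.card ≤ n) : (h.pop before).cost ≤ 2 * Nat.log 2 (n + 1) + 2 := by
  cases h with
  | leaf => simp [pop]
  | node k y l r =>
    have hc : l.elems.card + r.elems.card + 1 ≤ n := by simpa using hn
    have h1 := merge_cost_le before hh.2.2.1 hh.2.2.2
    have h2 := hh.2.2.1.rank_le (n := n) (by omega)
    have h3 := hh.2.2.2.rank_le (n := n) (by omega)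
    simp only [pop, Timed.bind_cost, step_cost, Timed.pure_cost]
    omega

theorem drain_spec {before : α → α → Bool} (total : ∀ x y, before x y || before y x)
    (trans : ∀ x y z, before x y → before y z → before x z) (k : ℕ) (h : Heap α)
    (hh : h.Ordered before) (hk : h.elems.card = k) :
    ((h.drain before k).val : Multiset α) = h.elems ∧
      (h.drain before k).val.Pairwise (fun a b => before a b = true) := by
  induction k generalizing h with
  | zero =>
    rw [Multiset.card_eq_zero] at hk
    simp [drain, hk]
  | succ k ih =>
    simp only [drain, Timed.bind_val]
    rcases hp : (h.pop before).val with _ | ⟨x, h'⟩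
    · rw [pop_eq_none] at hp
      simp [hp] at hk
    · have he := elems_of_pop hp
      obtain ⟨h1, h2⟩ := ih h' (hh.of_pop total trans hp) (by rw [he] at hk; simpa using hk)
      simp only [Timed.bind_val, Timed.pure_val]
      refine ⟨by rw [he, ← h1]; rfl, List.pairwise_cons.2 ⟨fun y hy => ?_, h2⟩⟩
      exact before_of_pop hh hp y (by rw [← h1]; exact hy)

theorem drain_cost_le (before : α → α → Bool) (k n : ℕ) (h : Heap α) (hh : h.Leftist)
    (hn : h.elems.card ≤ n) : (h.drain before k).cost ≤ k * (2 * Nat.log 2 (n + 1) + 3) := by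
  induction k generalizing h with
  | zero => simp [drain]
  | succ k ih =>
    have h1 := pop_cost_le before hh hn
    simp only [drain, Timed.bind_cost, step_cost, add_mul, one_mul]
    rcases hp : (h.pop before).val with _ | ⟨x, h'⟩
    · simp only [Timed.pure_cost]; omega
    · have he := elems_of_pop hp
      have h2 := ih h' (hh.of_pop hp) (by rw [he, Multiset.card_cons] at hn; omega)
      simp only [Timed.bind_cost, Timed.pure_cost]
      omega

end Heap

/-! ### Correctness and cost of heap sort -/

section Sorting

variable {α : Type}

theorem heapSort_spec {before : α → α → Bool} (total : ∀ x y, before x y || before y x)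
    (trans : ∀ x y z, before x y → before y z → before x z) (l : List α) :
    (heapSort before l).val.Perm l ∧
      (heapSort before l).val.Pairwise (fun a b => before a b = true) := by
  obtain ⟨h1, h2⟩ := forEach_prefix_inv
    (fun pre (h : Heap α) => h.elems = (pre : Multiset α) ∧ h.Ordered before)
    (fun h x => h.insert before x) l Heap.leaf ⟨rfl, trivial⟩
    (fun pre a s _ hI => ⟨by
      rw [Heap.elems_insert, hI.1, Multiset.cons_coe, Multiset.coe_eq_coe]
      exact (List.perm_append_singleton a pre).symm, hI.2.insert total trans a⟩)
  have h3 := Heap.drain_spec total trans l.length _ h2 (by rw [h1]; rfl)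
  refine ⟨?_, h3.2⟩
  rw [← Multiset.coe_eq_coe, ← h1]
  exact h3.1

theorem heapSort_cost_le (before : α → α → Bool) (l : List α) :
    (heapSort before l).cost ≤ l.length * (3 * Nat.log 2 (l.length + 1) + 6) := by
  have h1 := forEach_prefix_inv
    (fun pre (h : Heap α) => h.elems = (pre : Multiset α) ∧ h.Leftist)
    (fun h x => h.insert before x) l Heap.leaf ⟨rfl, trivial⟩
    (fun pre a s _ hI => ⟨by
      rw [Heap.elems_insert, hI.1, Multiset.cons_coe, Multiset.coe_eq_coe]
      exact (List.perm_append_singleton a pre).symm, hI.2.insert before a⟩)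
  -- The size of the growing heap is bounded by the final length throughout, so that all insertions
  -- are charged the same logarithm.
  have h2 : ∀ (m : List α) (h : Heap α), h.Leftist → h.elems.card + m.length ≤ l.length →
      (forEach m h fun h x => h.insert before x).cost ≤
        m.length * (Nat.log 2 (l.length + 1) + 3) := by
    intro m
    induction m with
    | nil => simp
    | cons a m ih =>
      intro h hh hm
      have h3 := Heap.insert_cost_le before a hh (n := l.length) (by omega)
      have h4 := ih (h.insert before a).val (hh.insert before a)
        (by rw [Heap.elems_insert, Multiset.card_cons]; simp at hm; omega)
      rw [forEach_cons_cost, List.length_cons, add_mul]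
      omega
  have h5 := h2 l Heap.leaf trivial (by simp)
  have h6 := Heap.drain_cost_le before l.length l.length _ h1.2 (by rw [h1.1]; exact le_rfl)
  simp only [heapSort, Timed.bind_cost]
  calc _ ≤ _ := add_le_add h5 h6
    _ = _ := by ring

end Sorting

end CommonAdjustment

namespace CommonAdjustment

/-! ### The tables of next and previous times -/

section Tables

variable {p : ℕ} (X : List (Fin p × ℤ))

/-- `T` is the table of the next times outside the interventions. -/
structure IsNextTable (T : Table p) : Prop where
  isSome_iff : ∀ x, (T x).isSome ↔ x ∈ X
  isLeast : ∀ S s, IsLeast {s₁ | s ≤ s₁ ∧ (S, s₁) ∉ X} ((T (S, s)).getD s)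

/-- `T` is the table of the previous times outside the interventions. -/
structure IsPrevTable (T : Table p) : Prop where
  isGreatest : ∀ S s, IsGreatest {s₁ | s₁ ≤ s ∧ (S, s₁) ∉ X} ((T (S, s)).getD s)

/-- In decreasing order of time, the cell at time `s + 1` has already received its final content
when `(S, s)` is treated. If it is blank, `s + 1` is free; otherwise its entry is also the next free
time after `s`. -/
theorem isNextTable_nextTable : IsNextTable X (nextTable X).val := by
  obtain ⟨hperm, hsort⟩ := heapSort_spec (α := Fin p × ℤ)
    (before := fun a b => decide (b.2 ≤ a.2))
    (fun x y => by simpa using le_total y.2 x.2)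
    (fun x y z h₁ h₂ => by simp only [decide_eq_true_eq] at *; omega) X
  have hmain := forEach_prefix_inv
    (fun pre (T : Table p) => ∀ x, (x ∈ pre → ∃ v, T x = some v ∧
      IsLeast {s₁ | x.2 ≤ s₁ ∧ (x.1, s₁) ∉ X} v) ∧ (x ∉ pre → T x = none))
    (fun T x => do
      let r ← T.get (x.1, x.2 + 1)
      T.set x (some (r.getD (x.2 + 1))))
    (heapSort (fun a b => decide (b.2 ≤ a.2)) X).val (Arr.const none) (by simp) (by
      intro pre a T hp hI x
      obtain ⟨post, hpost⟩ := hp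
      have haX : a ∈ X := hperm.subset (by rw [← hpost]; simp)
      have hpre : ∀ y ∈ pre, y ∈ X := fun y hy => hperm.subset (by rw [← hpost]; simp [hy])
      simp only [Timed.bind_val, Arr.get_val, Arr.set_val]
      by_cases hxa : x = a
      · subst hxa
        refine ⟨fun _ => ⟨_, Arr.update_self .., ?_⟩, fun h => absurd (by simp) h⟩
        by_cases hmem : (x.1, x.2 + 1) ∈ X
        · have hin : (x.1, x.2 + 1) ∈ pre := by
            have h1 := hperm.symm.subset hmem
            rw [← hpost] at h1 hsort
            simp only [List.append_assoc, List.singleton_append, List.mem_append,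
              List.mem_cons] at h1
            rcases h1 with h1 | h1 | h1
            · exact h1
            · have := congrArg Prod.snd h1
              simp at this
            -- What is listed after `x` has a time at most `x.2`, so it cannot be `(x.1, x.2 + 1)`.
            · simp only [List.append_assoc, List.singleton_append] at hsort
              have := (List.pairwise_append.1 hsort).2.1
              have := (List.pairwise_cons.1 this).1 _ h1
              simp at this
          obtain ⟨v, hv, hl⟩ := (hI (x.1, x.2 + 1)).1 hin
          rw [hv, Option.getD_some]
          refine ⟨⟨by have := hl.1.1; simp at this; omega, hl.1.2⟩, fun s hs => hl.2 ⟨?_, hs.2⟩⟩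
          rcases hs.1.lt_or_eq with h | h
          · exact h
          · exact absurd haX (by have := hs.2; rwa [← h] at this)
        · have hnone : T (x.1, x.2 + 1) = none := (hI _).2 fun h => hmem (hpre _ h)
          rw [hnone, Option.getD_none]
          refine ⟨⟨by omega, hmem⟩, fun s hs => ?_⟩
          rcases hs.1.lt_or_eq with h | h
          · exact h
          · exact absurd haX (by have := hs.2; rwa [← h] at this)
      · rw [Arr.update_of_ne hxa]
        simpa [hxa] using hI x)
  have hX : ∀ x, x ∈ (heapSort (fun a b : Fin p × ℤ => decide (b.2 ≤ a.2)) X).val ↔ x ∈ X :=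
    fun x => hperm.mem_iff
  simp only [hX] at hmain
  have hT : (nextTable X).val = (forEach (heapSort (fun a b => decide (b.2 ≤ a.2)) X).val
      (Arr.const none : Table p) (fun T x => do
      let r ← T.get (x.1, x.2 + 1)
      T.set x (some (r.getD (x.2 + 1))))).val := rfl
  rw [← hT] at hmain
  refine ⟨fun x => ?_, fun S s => ?_⟩
  · by_cases hx : x ∈ X
    · obtain ⟨v, hv, -⟩ := (hmain x).1 hx
      simp [hv, hx]
    · simp [(hmain x).2 hx, hx]
  · by_cases hx : (S, s) ∈ X
    · obtain ⟨v, hv, h⟩ := (hmain _).1 hx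
      simpa [hv] using h
    · rw [(hmain _).2 hx, Option.getD_none]
      exact ⟨⟨le_rfl, hx⟩, fun s' hs' => hs'.1⟩

/-- The mirror image of `isNextTable_nextTable`: increasing order of time, and the cell at time `s -
1` is consulted. -/
theorem isPrevTable_prevTable : IsPrevTable X (prevTable X).val := by
  obtain ⟨hperm, hsort⟩ := heapSort_spec (α := Fin p × ℤ)
    (before := fun a b => decide (a.2 ≤ b.2))
    (fun x y => by simpa using le_total x.2 y.2)
    (fun x y z h₁ h₂ => by simp only [decide_eq_true_eq] at *; omega) X
  have hmain := forEach_prefix_inv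
    (fun pre (T : Table p) => ∀ x, (x ∈ pre → ∃ v, T x = some v ∧
      IsGreatest {s₁ | s₁ ≤ x.2 ∧ (x.1, s₁) ∉ X} v) ∧ (x ∉ pre → T x = none))
    (fun T x => do
      let r ← T.get (x.1, x.2 - 1)
      T.set x (some (r.getD (x.2 - 1))))
    (heapSort (fun a b => decide (a.2 ≤ b.2)) X).val (Arr.const none) (by simp) (by
      intro pre a T hp hI x
      obtain ⟨post, hpost⟩ := hp
      have haX : a ∈ X := hperm.subset (by rw [← hpost]; simp)
      have hpre : ∀ y ∈ pre, y ∈ X := fun y hy => hperm.subset (by rw [← hpost]; simp [hy])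
      simp only [Timed.bind_val, Arr.get_val, Arr.set_val]
      by_cases hxa : x = a
      · subst hxa
        refine ⟨fun _ => ⟨_, Arr.update_self .., ?_⟩, fun h => absurd (by simp) h⟩
        by_cases hmem : (x.1, x.2 - 1) ∈ X
        · have hin : (x.1, x.2 - 1) ∈ pre := by
            have h1 := hperm.symm.subset hmem
            rw [← hpost] at h1 hsort
            simp only [List.append_assoc, List.singleton_append, List.mem_append,
              List.mem_cons] at h1
            rcases h1 with h1 | h1 | h1
            · exact h1
            · have := congrArg Prod.snd h1
              simp at this
            · simp only [List.append_assoc, List.singleton_append] at hsort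
              have := (List.pairwise_append.1 hsort).2.1
              have := (List.pairwise_cons.1 this).1 _ h1
              simp at this
          obtain ⟨v, hv, hl⟩ := (hI (x.1, x.2 - 1)).1 hin
          rw [hv, Option.getD_some]
          refine ⟨⟨by have := hl.1.1; simp at this; omega, hl.1.2⟩, fun s hs => hl.2 ⟨?_, hs.2⟩⟩
          rcases hs.1.lt_or_eq with h | h
          · exact Int.le_sub_one_of_lt h
          · exact absurd haX (by have := hs.2; rwa [h] at this)
        · have hnone : T (x.1, x.2 - 1) = none := (hI _).2 fun h => hmem (hpre _ h)
          rw [hnone, Option.getD_none]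
          refine ⟨⟨by omega, hmem⟩, fun s hs => ?_⟩
          rcases hs.1.lt_or_eq with h | h
          · exact Int.le_sub_one_of_lt h
          · exact absurd haX (by have := hs.2; rwa [h] at this)
      · rw [Arr.update_of_ne hxa]
        simpa [hxa] using hI x)
  have hX : ∀ x, x ∈ (heapSort (fun a b : Fin p × ℤ => decide (a.2 ≤ b.2)) X).val ↔ x ∈ X :=
    fun x => hperm.mem_iff
  simp only [hX] at hmain
  have hT : (prevTable X).val = (forEach (heapSort (fun a b => decide (a.2 ≤ b.2)) X).val
      (Arr.const none : Table p) (fun T x => do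
      let r ← T.get (x.1, x.2 - 1)
      T.set x (some (r.getD (x.2 - 1))))).val := rfl
  rw [← hT] at hmain
  refine ⟨fun S s => ?_⟩
  by_cases hx : (S, s) ∈ X
  · obtain ⟨v, hv, h⟩ := (hmain _).1 hx
    simpa [hv] using h
  · rw [(hmain _).2 hx, Option.getD_none]
    exact ⟨⟨le_rfl, hx⟩, fun s' hs' => hs'.1⟩

end Tables

/-! ### Backward search -/

/-- Comparison of times, `none` being `-∞`. -/
def OptLe (a b : Option ℤ) : Prop := ∀ s, a = some s → ∃ s', b = some s' ∧ s ≤ s'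

theorem OptLe.refl (a : Option ℤ) : OptLe a a := fun s h => ⟨s, h, le_rfl⟩

theorem OptLe.trans {a b c : Option ℤ} (h₁ : OptLe a b) (h₂ : OptLe b c) : OptLe a c := by
  intro s h
  obtain ⟨s', h', hs'⟩ := h₁ s h
  obtain ⟨s'', h'', hs''⟩ := h₂ s' h'
  exact ⟨s'', h'', hs'.trans hs''⟩

section Search

variable {p : ℕ} (G : SCG p) (best : Fin p → ℤ → Timed (Option ℤ))

theorem later_total (x y : Fin p × ℤ) : (later x y || later y x) = true := by
  simpa [later] using le_total y.2 x.2

theorem later_trans (x y z : Fin p × ℤ) (h₁ : later x y = true) (h₂ : later y z = true) :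
    later x z = true := by
  simp only [later, decide_eq_true_eq] at *
  omega

/-- The treatment of the parent `P` of a vertex at time `s` in the backward search. -/
def relax (s : ℤ) (σ : SearchState p) (P : Fin p) : Timed (SearchState p) := do
  let b ← σ.seen.get P
  if b then pure σ
  else
    let τ ← best P s
    let val ← σ.val.set P τ
    let seen ← σ.seen.set P true
    match τ with
    | none => pure ⟨σ.queue, seen, val⟩
    | some τ => do
      let Q ← σ.queue.insert later (P, τ)
      pure ⟨Q, seen, val⟩

theorem search_succ (k : ℕ) (σ : SearchState p) :
    search G best (k + 1) σ = (do
      step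
      match ← σ.queue.pop later with
      | none => pure σ.val
      | some (u, Q) => do
        let σ ← forEach (G.pa u.1) (⟨Q, σ.seen, σ.val⟩ : SearchState p) (relax best u.2)
        search G best k σ) := rfl

theorem relax_val_of_seen {s : ℤ} {σ : SearchState p} {P : Fin p} (h : σ.seen P = true) :
    (relax best s σ P).val = σ := by
  simp [relax, h]

theorem relax_val_of_none {s : ℤ} {σ : SearchState p} {P : Fin p} (h : σ.seen P = false)
    (hb : (best P s).val = none) :
    (relax best s σ P).val =
      ⟨σ.queue, σ.seen.update P true, σ.val.update P none⟩ := by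
  simp [relax, h, hb]

theorem relax_val_of_some {s τ : ℤ} {σ : SearchState p} {P : Fin p} (h : σ.seen P = false)
    (hb : (best P s).val = some τ) :
    (relax best s σ P).val = ⟨(σ.queue.insert later (P, τ)).val,
      σ.seen.update P true, σ.val.update P (some τ)⟩ := by
  simp [relax, h, hb]

/-- The number of rounds that are left: the weighted number of vertices in the queue and of unseen
series. -/
def SearchState.potential (w : Fin p → ℕ) (σ : SearchState p) : ℕ :=
  (σ.queue.elems.map fun u => w u.1).sum + ∑ P, if σ.seen P then 0 else w P

/-- Marking `P` releases exactly its weight, which pays for the single entry of `P` into the queue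
or onto the stack. -/
theorem sum_unmarked_update (w : Fin p → ℕ) (seen : Arr (Fin p) Bool) (P : Fin p)
    (h : seen P = false) :
    (∑ Q, if seen.update P true Q then 0 else w Q) + w P =
      ∑ Q, if seen Q then 0 else w Q := by
  rw [← Finset.sum_erase_add Finset.univ (fun Q => if seen.update P true Q then 0 else w Q)
      (Finset.mem_univ P),
    ← Finset.sum_erase_add Finset.univ (fun Q => if seen Q then 0 else w Q) (Finset.mem_univ P)]
  simp only [Arr.update_self, if_true, h, add_zero, Bool.false_eq_true, if_false]
  congr 1
  refine Finset.sum_congr rfl fun Q hQ => ?_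
  rw [Arr.update_of_ne (Finset.ne_of_mem_erase hQ)]

/-- A newly seen series moves its weight from the unseen part to the queue, or loses it if no finite
time is found. -/
theorem relax_potential_le (w : Fin p → ℕ) (s : ℤ) (σ : SearchState p) (P : Fin p) :
    (relax best s σ P).val.potential w ≤ σ.potential w := by
  rcases h : σ.seen P with _ | _
  · have h1 := sum_unmarked_update w σ.seen P h
    rcases hb : (best P s).val with _ | τ
    · rw [relax_val_of_none best h hb]
      simp only [SearchState.potential]
      omega
    · rw [relax_val_of_some best h hb]
      simp only [SearchState.potential, Heap.elems_insert, Multiset.map_cons, Multiset.sum_cons]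
      omega
  · rw [relax_val_of_seen best h]

theorem potential_of_pop {w : Fin p → ℕ} {σ : SearchState p} {u : Fin p × ℤ}
    {Q : Heap (Fin p × ℤ)} (hp : (σ.queue.pop later).val = some (u, Q)) :
    σ.potential w = w u.1 + (⟨Q, σ.seen, σ.val⟩ : SearchState p).potential w := by
  simp only [SearchState.potential, Heap.elems_of_pop hp, Multiset.map_cons, Multiset.sum_cons]
  ring

/-- An invariant that is kept by all rounds holds at the end, when the queue is empty. -/
theorem search_inv (I : SearchState p → Prop)
    (hI : ∀ σ u Q, I σ → (σ.queue.pop later).val = some (u, Q) →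
      I (forEach (G.pa u.1) (⟨Q, σ.seen, σ.val⟩ : SearchState p) (relax best u.2)).val)
    (k : ℕ) (σ : SearchState p) (hσ : I σ) (hk : σ.potential 1 ≤ k) :
    ∃ σ' : SearchState p, I σ' ∧ σ'.queue.elems = 0 ∧ (search G best k σ).val = σ'.val := by
  induction k generalizing σ with
  | zero =>
    -- With unit weights the potential is at least the length of the queue, so the search cannot run
    -- out of fuel while vertices are waiting.
    refine ⟨σ, hσ, ?_, rfl⟩
    simp only [SearchState.potential, Pi.one_apply, Multiset.map_const', Multiset.sum_replicate,
      smul_eq_mul, mul_one] at hk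
    exact Multiset.card_eq_zero.1 (by omega)
  | succ k ih =>
    rw [search_succ]
    simp only [Timed.bind_val]
    rcases hp : (σ.queue.pop later).val with _ | ⟨u, Q⟩
    · exact ⟨σ, hσ, (Heap.pop_eq_none _ _).1 hp, rfl⟩
    · refine ih _ (hI σ u Q hσ hp) ?_
      have h1 := forEach_inv
        (fun σ' : SearchState p =>
          σ'.potential 1 ≤ (⟨Q, σ.seen, σ.val⟩ : SearchState p).potential 1)
        (relax best u.2) (G.pa u.1) _ le_rfl
        (fun P _ s hs => (relax_potential_le best 1 u.2 s P).trans hs)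
      rw [potential_of_pop hp] at hk
      simp only [Pi.one_apply] at hk
      omega

/-- Everything that the search records satisfies a property that passes to the parents. -/
theorem search_sound (R V : Fin p × ℤ → Prop) (hVR : ∀ u, V u → R u)
    (hstep : ∀ u, R u → ∀ P ∈ G.pa u.1, ∀ b, (best P u.2).val = some b → V (P, b))
    (k : ℕ) (σ : SearchState p) (hQ : ∀ u ∈ σ.queue.elems, R u)
    (hv : ∀ P b, σ.val P = some b → V (P, b)) (hk : σ.potential 1 ≤ k) :
    ∀ P b, (search G best k σ).val P = some b → V (P, b) := by
  -- Two predicates are needed because the start vertex is in the queue without necessarily having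
  -- been recorded: the queue satisfies `R`, recorded values the stronger `V`.
  obtain ⟨σ', h1, -, h2⟩ := search_inv G best
    (fun σ => (∀ u ∈ σ.queue.elems, R u) ∧ ∀ P b, σ.val P = some b → V (P, b)) (by
      intro σ u Q hσ hp
      have he := Heap.elems_of_pop hp
      have hu : R u := hσ.1 u (by rw [he]; simp)
      refine forEach_inv (fun σ : SearchState p =>
        (∀ u ∈ σ.queue.elems, R u) ∧ ∀ P b, σ.val P = some b → V (P, b)) _ _ _
        ⟨fun w hw => hσ.1 w (by rw [he]; simp [hw]), hσ.2⟩ ?_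
      intro P hP s hs
      rcases h : s.seen P with _ | _
      · rcases hb : (best P u.2).val with _ | τ
        · rw [relax_val_of_none best h hb]
          refine ⟨hs.1, fun P' b => ?_⟩
          by_cases hPP : P' = P
          · subst hPP; simp
          · simpa only [Arr.update_of_ne hPP] using hs.2 P' b
        · rw [relax_val_of_some best h hb]
          have hV := hstep u hu P hP τ hb
          refine ⟨fun w hw => ?_, fun P' b => ?_⟩
          · rw [Heap.elems_insert, Multiset.mem_cons] at hw
            rcases hw with rfl | hw
            · exact hVR _ hV
            · exact hs.1 w hw
          · by_cases hPP : P' = P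
            · subst hPP
              simp only [Arr.update_self, Option.some.injEq]
              rintro rfl
              exact hV
            · simpa only [Arr.update_of_ne hPP] using hs.2 P' b
      · rw [relax_val_of_seen best h]
        exact hs)
    k σ ⟨hQ, hv⟩ hk
  rw [h2]
  exact h1.2

/-- The invariant that makes the recorded times maximal. -/
structure SearchState.Invariant (v : Fin p × ℤ) (σ : SearchState p) : Prop where
  ordered : σ.queue.Ordered later
  bound : ∀ u ∈ σ.queue.elems, ∀ P, σ.seen P = true → OptLe (best P u.2).val (σ.val P)
  seen : ∀ P b, σ.val P = some b → σ.seen P = true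
  treated : ∀ u, (u = v ∨ σ.val u.1 = some u.2) → u ∈ σ.queue.elems ∨
    ∀ P ∈ G.pa u.1, σ.seen P = true ∧ OptLe (best P u.2).val (σ.val P)

/-- Dijkstra's argument. Vertices leave the queue in decreasing order of time, and what is inserted
is never later than the vertex just popped. So the first vertex that sees a series offers it the
best time, and by `hmono` all later offers are no better. At the end the recorded times dominate
every relaxation. -/
theorem search_complete (hle : ∀ P s b, (best P s).val = some b → b ≤ s)
    (hmono : ∀ P s s', s ≤ s' → OptLe (best P s).val (best P s').val)
    (v : Fin p × ℤ) (k : ℕ) (σ : SearchState p) (hσ : σ.Invariant G best v)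
    (hk : σ.potential 1 ≤ k) :
    ∀ u : Fin p × ℤ, (u = v ∨ (search G best k σ).val u.1 = some u.2) →
      ∀ P ∈ G.pa u.1, OptLe (best P u.2).val ((search G best k σ).val P) := by
  obtain ⟨σ', h1, h0, h2⟩ := search_inv G best (fun σ => σ.Invariant G best v) (by
      intro σ u Q hσ hp
      have he := Heap.elems_of_pop hp
      have hmax : ∀ w ∈ Q.elems, w.2 ≤ u.2 := fun w hw => by
        simpa [later] using Heap.before_of_pop hσ.ordered hp w hw
      have huQ : u ∈ σ.queue.elems := by rw [he]; simp
      -- During the loop `u` is no longer in the queue and not yet fully treated, whence the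
      -- additional alternative `w = u`. It disappears at the end, when all parents of `u` are
      -- marked.
      have key := forEach_prefix_inv
        (fun pre (s : SearchState p) => s.queue.Ordered later ∧
          (∀ w ∈ s.queue.elems, w.2 ≤ u.2) ∧
          (∀ P, s.seen P = true → OptLe (best P u.2).val (s.val P)) ∧
          (∀ P b, s.val P = some b → s.seen P = true) ∧
          (∀ w, (w = v ∨ s.val w.1 = some w.2) → w = u ∨ w ∈ s.queue.elems ∨
            ∀ P ∈ G.pa w.1, s.seen P = true ∧ OptLe (best P w.2).val (s.val P)) ∧
          ∀ P ∈ pre, s.seen P = true)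
        (relax best u.2) (G.pa u.1) ⟨Q, σ.seen, σ.val⟩
        ⟨hσ.ordered.of_pop later_total later_trans hp, hmax, hσ.bound u huQ, hσ.seen,
          fun w hw => by
            have := hσ.treated w hw
            rw [he, Multiset.mem_cons] at this
            tauto, by simp⟩
        (by
          rintro pre P s hpre ⟨i1, i2, i3, i4, i5, i6⟩
          rcases h : s.seen P with _ | _
          · have hmark : ∀ P', s.seen P' = true → s.seen.update P true P' = true := by
              intro P' h'
              by_cases hPP : P' = P
              · subst hPP; simp
              · rwa [Arr.update_of_ne hPP]
            have hval : ∀ τ P', s.seen P' = true → s.val.update P τ P' = s.val P' := by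
              intro τ P' h'
              rw [Arr.update_of_ne]
              rintro rfl
              simp [h] at h'
            have hpre' : ∀ P' ∈ pre ++ [P], s.seen.update P true P' = true := by
              intro P' h'
              rcases List.mem_append.1 h' with h' | h'
              · exact hmark _ (i6 _ h')
              · rw [List.mem_singleton.1 h', Arr.update_self]
            have hbound : ∀ P', s.seen.update P true P' = true →
                OptLe (best P' u.2).val (s.val.update P (best P u.2).val P') := by
              intro P' h'
              by_cases hPP : P' = P
              · subst hPP
                rw [Arr.update_self]
                exact OptLe.refl _
              · rw [Arr.update_of_ne hPP] at h' ⊢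
                exact i3 P' h'
            have hseen : ∀ P' b, s.val.update P (best P u.2).val P' = some b →
                s.seen.update P true P' = true := by
              intro P' b h'
              by_cases hPP : P' = P
              · subst hPP; simp
              · rw [Arr.update_of_ne hPP] at h' ⊢
                exact i4 P' b h'
            have hold : ∀ w : Fin p × ℤ, (w = v ∨ s.val w.1 = some w.2) → w = u ∨
                w ∈ s.queue.elems ∨ ∀ P' ∈ G.pa w.1, s.seen.update P true P' = true ∧
                  OptLe (best P' w.2).val (s.val.update P (best P u.2).val P') := by
              intro w hw
              rcases i5 w hw with h' | h' | h'
              · exact Or.inl h'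
              · exact Or.inr (Or.inl h')
              · refine Or.inr (Or.inr fun P' hP' => ?_)
                obtain ⟨h1, h2⟩ := h' P' hP'
                rw [hval _ _ h1]
                exact ⟨hmark _ h1, h2⟩
            rcases hb : (best P u.2).val with _ | τ
            · rw [relax_val_of_none best h hb]
              rw [hb] at hbound hseen hold
              refine ⟨i1, i2, hbound, hseen, fun w hw => hold w ?_, hpre'⟩
              change w = v ∨ s.val.update P none w.1 = some w.2 at hw
              rcases hw with hw | hw
              · exact Or.inl hw
              · by_cases hPP : w.1 = P
                · simp [hPP] at hw
                · rw [Arr.update_of_ne hPP] at hw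
                  exact Or.inr hw
            · rw [relax_val_of_some best h hb]
              rw [hb] at hbound hseen hold
              refine ⟨i1.insert later_total later_trans _, ?_, hbound, hseen, ?_, hpre'⟩
              · intro w hw
                rw [Heap.elems_insert, Multiset.mem_cons] at hw
                rcases hw with rfl | hw
                · exact hle _ _ _ hb
                · exact i2 w hw
              · intro w hw
                change w = v ∨ s.val.update P (some τ) w.1 = some w.2 at hw
                rw [Heap.elems_insert, Multiset.mem_cons]
                by_cases hPP : w = (P, τ)
                · exact Or.inr (Or.inl (Or.inl hPP))
                · have := hold w (by
                    rcases hw with hw | hw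
                    · exact Or.inl hw
                    · by_cases hP1 : w.1 = P
                      · rw [hP1, Arr.update_self] at hw
                        exact absurd (Prod.ext hP1 (Option.some.inj hw).symm) hPP
                      · rw [Arr.update_of_ne hP1] at hw
                        exact Or.inr hw)
                  tauto
          · rw [relax_val_of_seen best h]
            refine ⟨i1, i2, i3, i4, i5, fun P' h' => ?_⟩
            rcases List.mem_append.1 h' with h' | h'
            · exact i6 _ h'
            · rw [List.mem_singleton.1 h', h])
      obtain ⟨i1, i2, i3, i4, i5, i6⟩ := key
      -- Every vertex `w` still in the queue is no later than `u`, so it cannot offer more to a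
      -- marked series than `u` could.
      refine ⟨i1, fun w hw P hP => (hmono P _ _ (i2 w hw)).trans (i3 P hP), i4, fun w hw => ?_⟩
      rcases i5 w hw with rfl | h' | h'
      · exact Or.inr fun P hP => ⟨i6 P hP, i3 P (i6 P hP)⟩
      · exact Or.inl h'
      · exact Or.inr h')
    k σ hσ hk
  rw [h2]
  intro u hu P hP
  have := h1.treated u hu
  rw [h0] at this
  simp only [Multiset.notMem_zero, false_or] at this
  exact (this P hP).2

end Search

end CommonAdjustment

namespace CommonAdjustment

open Relation

/-! ### Ancestor times and times of accessibility -/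

section TimeEdges

variable {V : Type*}

/-- The edges that a candidate full-time graph may have. -/
def TimeEdge (E : V → V → Prop) (u w : V × ℤ) : Prop := E u.1 w.1 ∧ u.2 ≤ w.2

/-- A possible edge that leaves a vertex of `A`; thus a walk along such edges has all its vertices
but the last one in `A`. -/
def TimeEdgeFrom (E : V → V → Prop) (A : Set (V × ℤ)) (u w : V × ℤ) : Prop :=
  TimeEdge E u w ∧ u ∈ A

theorem TimeEdgeFrom.mono {E : V → V → Prop} {A B : Set (V × ℤ)} (h : A ⊆ B) {u w : V × ℤ}
    (huw : TimeEdgeFrom E A u w) : TimeEdgeFrom E B u w := ⟨huw.1, h huw.2⟩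

end TimeEdges

/-! ### The backward search as reachability inside a set of vertices -/

section SearchSpec

variable {p : ℕ} (G : SCG p) (best : Fin p → ℤ → Timed (Option ℤ)) (A : Set (Fin p × ℤ))

/-- `best P s` is the largest time `≤ s` at which `P` is in `A`. -/
structure IsBestIn : Prop where
  mem : ∀ P s b, (best P s).val = some b → b ≤ s ∧ (P, b) ∈ A
  le : ∀ P s s₁, s₁ ≤ s → (P, s₁) ∈ A → ∃ b, (best P s).val = some b ∧ s₁ ≤ b

variable {best A}

theorem IsBestIn.mono (h : IsBestIn best A) (P : Fin p) (s s' : ℤ) (hs : s ≤ s') :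
    OptLe (best P s).val (best P s').val := fun b hb =>
  h.le P s' b ((h.mem P s b hb).1.trans hs) (h.mem P s b hb).2

/-- One vertex in the queue and at most `p` unseen series: the fuel `p + 2` suffices. -/
theorem potential_one_le (Q : Heap (Fin p × ℤ)) (v : Fin p × ℤ) (hQ : Q.elems = {v})
    (seen : Arr (Fin p) Bool) (val : Arr (Fin p) (Option ℤ)) :
    (⟨Q, seen, val⟩ : SearchState p).potential 1 ≤ p + 2 := by
  simp only [SearchState.potential, hQ, Multiset.map_singleton, Multiset.sum_singleton,
    Pi.one_apply]
  have : (∑ P, if seen P then 0 else 1) ≤ ∑ _P : Fin p, 1 :=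
    Finset.sum_le_sum fun P _ => by split <;> simp
  simp at this
  simp
  omega

variable (hb : IsBestIn best A) {Q : Heap (Fin p × ℤ)} {v : Fin p × ℤ}
  {seen : Arr (Fin p) Bool} {val : Arr (Fin p) (Option ℤ)}

include hb

/-- The first alternative occurs only if the start vertex was recorded in advance, as in the search
for the ancestor times. For the times of accessibility the table starts empty and a nonempty walk
remains. -/
theorem search_sound_walk (hQ : Q.elems = {v}) (hv : ∀ P b, val P = some b → (P, b) = v)
    (P : Fin p) (b : ℤ) (h : (search G best (p + 2) ⟨Q, seen, val⟩).val P = some b) :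
    ((P, b) = v ∧ ∃ P' b', val P' = some b') ∨ TransGen (TimeEdgeFrom G.Edge A) (P, b) v := by
  refine search_sound G best (fun u => ReflTransGen (TimeEdgeFrom G.Edge A) u v)
    (fun u => (u = v ∧ ∃ P' b', val P' = some b') ∨ TransGen (TimeEdgeFrom G.Edge A) u v)
    ?_ ?_ (p + 2) ⟨Q, seen, val⟩ ?_ ?_ (potential_one_le Q v hQ seen val) P b h
  · rintro u (⟨rfl, -⟩ | h)
    · exact ReflTransGen.refl
    · exact h.to_reflTransGen
  · intro u hu P hP b hPb
    obtain ⟨h1, h2⟩ := hb.mem P u.2 b hPb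
    exact Or.inr (TransGen.head' ⟨⟨(G.mem_pa P u.1).1 hP, h1⟩, h2⟩ hu)
  · intro u hu
    rw [hQ, Multiset.mem_singleton] at hu
    rw [hu]
  · exact fun P b h => Or.inl ⟨hv P b h, P, b, h⟩

/-- The walk is followed backwards from `v`. If the series of `c` is recorded no earlier than the
walk visits it, then the relaxation at the recorded time offers its predecessor `a` a time no
earlier than that of `a` on the walk. -/
theorem search_complete_walk (hQ : Q.elems = {v}) (hord : Q.Ordered later)
    (hv : ∀ P b, val P = some b → (P, b) = v) (hseen : ∀ P, seen P = true ↔ ∃ b, val P = some b)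
    (u : Fin p × ℤ) (h : TransGen (TimeEdgeFrom G.Edge A) u v) :
    ∃ b, (search G best (p + 2) ⟨Q, seen, val⟩).val u.1 = some b ∧ u.2 ≤ b := by
  have hinv : (⟨Q, seen, val⟩ : SearchState p).Invariant G best v := by
    refine ⟨hord, ?_, fun P b h => (hseen P).2 ⟨b, h⟩, ?_⟩
    · intro w hw P hP s hs
      rw [hQ, Multiset.mem_singleton] at hw
      subst hw
      obtain ⟨b, hPb⟩ := (hseen P).1 hP
      refine ⟨b, hPb, ?_⟩
      rw [← hv P b hPb] at hs
      exact (hb.mem _ _ _ hs).1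
    · intro w hw
      left
      rw [hQ, Multiset.mem_singleton]
      rcases hw with hw | hw
      · exact hw
      · exact hv _ _ hw
  have key := search_complete G best (fun P s b h => (hb.mem P s b h).1) hb.mono v (p + 2) _ hinv
    (potential_one_le Q v hQ seen val)
  induction h using TransGen.head_induction_on with
  | single h =>
    obtain ⟨b, h1, h2⟩ := hb.le _ _ _ h.1.2 h.2
    obtain ⟨b', h3, h4⟩ := key _ (Or.inl rfl) _ ((G.mem_pa _ _).2 h.1.1) b h1
    exact ⟨b', h3, h2.trans h4⟩
  | @head a c h _ ih =>
    obtain ⟨b₀, h5, h6⟩ := ih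
    obtain ⟨b, h1, h2⟩ := hb.le a.1 b₀ a.2 (h.1.2.trans h6) h.2
    obtain ⟨b', h3, h4⟩ := key (c.1, b₀) (Or.inr h5) _ ((G.mem_pa _ _).2 h.1.1) b h1
    exact ⟨b', h3, h2.trans h4⟩

end SearchSpec

/-! ### The two backward searches of the algorithm -/

section AncestorAccess

variable {p : ℕ} {G : SCG p} {X : List (Fin p × ℤ)} {prv : Table p}

theorem IsPrevTable.isBestIn (hprv : IsPrevTable X prv) :
    IsBestIn (fun P s => do
      let τ ← free prv P s
      pure (some τ)) {u | u ∉ X} where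
  mem P s b h := by
    simp only [Timed.bind_val, free_val, Timed.pure_val, Option.some.injEq] at h
    subst h
    exact (hprv.isGreatest P s).1
  le P s s₁ hs h := ⟨_, rfl, (hprv.isGreatest P s).2 ⟨hs, h⟩⟩

theorem ancestorTimes_sound (hprv : IsPrevTable X prv) {Y : Fin p} {t : ℤ} {P : Fin p} {b : ℤ}
    (h : (ancestorTimes G prv Y t).val P = some b) :
    ReflTransGen (TimeEdgeFrom G.Edge {u | u ∉ X}) (P, b) (Y, t) := by
  rcases search_sound_walk G hprv.isBestIn (v := (Y, t)) (by rw [Heap.elems_insert]; rfl)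
    (fun P b h => by
      by_cases hP : P = Y
      · subst hP
        simp only [newArr_val, Arr.set_val, Arr.update_self, Option.some.injEq] at h
        rw [h]
      · simp [Arr.update_of_ne hP] at h) P b h with ⟨h, -⟩ | h
  · rw [h]
  · exact h.to_reflTransGen

theorem ancestorTimes_complete (hprv : IsPrevTable X prv) {Y : Fin p} {t : ℤ} {u : Fin p × ℤ}
    (h : ReflTransGen (TimeEdgeFrom G.Edge {u | u ∉ X}) u (Y, t)) :
    ∃ b, (ancestorTimes G prv Y t).val u.1 = some b ∧ u.2 ≤ b := by
  set Q := (Heap.leaf.insert later (Y, t)).val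
  have hQ : Q.elems = {(Y, t)} := by simp [Q, Heap.elems_insert]
  have hord : Q.Ordered later := Heap.Ordered.insert later_total later_trans _ trivial
  have hv : ∀ P b, ((Arr.const none : Arr (Fin p) (Option ℤ)).update Y (some t)) P = some b →
      (P, b) = (Y, t) := by
    intro P b h
    by_cases hP : P = Y
    · subst hP
      simp only [Arr.update_self, Option.some.injEq] at h
      rw [h]
    · simp [Arr.update_of_ne hP] at h
  have hseen : ∀ P, ((Arr.const false : Arr (Fin p) Bool).update Y true) P = true ↔
      ∃ b, ((Arr.const none : Arr (Fin p) (Option ℤ)).update Y (some t)) P = some b := by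
    intro P
    by_cases hP : P = Y
    · subst hP; simp
    · simp [Arr.update_of_ne hP]
  have hA : (ancestorTimes G prv Y t).val = (search G (fun P s => do
      let τ ← free prv P s
      pure (some τ)) (p + 2) ⟨Q, (Arr.const false).update Y true,
        (Arr.const none).update Y (some t)⟩).val := by
    simp [ancestorTimes, Q]
  rw [hA]
  rcases reflTransGen_iff_eq_or_transGen.1 h with h | h
  -- The empty walk is not covered by `search_complete_walk`; here the value `t` of `Y` survives
  -- because `Y` is marked from the start.
  · obtain ⟨σ', h1, -, h2⟩ := search_inv G (fun P s => do
      let τ ← free prv P s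
      pure (some τ)) (fun σ => σ.seen Y = true ∧ σ.val Y = some t) (by
        intro σ u Q hσ hp
        refine forEach_inv (fun σ : SearchState p => σ.seen Y = true ∧ σ.val Y = some t) _ _ _
          hσ ?_
        intro P hP s hs
        rcases h : s.seen P with _ | _
        · have hne : Y ≠ P := by
            rintro rfl
            simp [hs.1] at h
          rw [relax_val_of_some _ h rfl]
          change s.seen.update P true Y = true ∧ s.val.update P _ Y = some t
          rwa [Arr.update_of_ne hne, Arr.update_of_ne hne]
        · rwa [relax_val_of_seen _ h])
      (p + 2) ⟨Q, (Arr.const false).update Y true, (Arr.const none).update Y (some t)⟩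
      (by simp) (potential_one_le Q _ hQ _ _)
    rw [h2, ← h]
    exact ⟨t, h1.2, le_rfl⟩
  · exact search_complete_walk G hprv.isBestIn hQ hord hv hseen u h

/-- The vertices that the times of accessibility to `v` refer to. -/
def accessSet (X : List (Fin p × ℤ)) (tNC : Arr (Fin p) (Option ℤ)) (v : Fin p × ℤ) :
    Set (Fin p × ℤ) :=
  {u | u ∉ X ∧ u ≠ v ∧ ∃ e, tNC u.1 = some e ∧ e ≤ u.2}

/-- The function that the search for the times of accessibility to `v` maximizes with. -/
def accessBest (prv : Table p) (tNC : Arr (Fin p) (Option ℤ)) (v : Fin p × ℤ) (P : Fin p)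
    (s : ℤ) : Timed (Option ℤ) := do
  let τ₀ ← free prv P s
  let τ ← if (P, τ₀) = v then free prv P (τ₀ - 1) else pure τ₀
  match ← tNC.get P with
  | none => pure none
  | some e => pure (if e ≤ τ then some τ else none)

/-- The last time `≤ s` at which `P` is neither intervened on nor equal to `v`. -/
def prevAvoiding (prv : Table p) (v : Fin p × ℤ) (P : Fin p) (s : ℤ) : ℤ :=
  if (P, (prv (P, s)).getD s) = v then
    (prv (P, (prv (P, s)).getD s - 1)).getD ((prv (P, s)).getD s - 1)
  else (prv (P, s)).getD s

theorem accessBest_val (prv : Table p) (tNC : Arr (Fin p) (Option ℤ)) (v : Fin p × ℤ) (P : Fin p)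
    (s : ℤ) : (accessBest prv tNC v P s).val = (tNC P).bind fun e =>
      if e ≤ prevAvoiding prv v P s then some (prevAvoiding prv v P s) else none := by
  unfold accessBest prevAvoiding
  rw [Timed.bind_val, free_val]
  split <;> rcases he : tNC P with _ | e <;> simp [he] <;> rfl

theorem accessBest_cost_le (prv : Table p) (tNC : Arr (Fin p) (Option ℤ)) (v : Fin p × ℤ)
    (P : Fin p) (s : ℤ) : (accessBest prv tNC v P s).cost ≤ 3 := by
  unfold accessBest
  rw [Timed.bind_cost, free_val]
  split <;> rcases he : tNC P with _ | e <;> simp [he]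

/-- Only one vertex is excluded in addition to `X`. If the first look-up hits `v`, the second starts
strictly before `v` and cannot hit it again. -/
theorem IsPrevTable.isGreatest_prevAvoiding (hprv : IsPrevTable X prv) (v : Fin p × ℤ)
    (P : Fin p) (s : ℤ) :
    IsGreatest {s₁ | s₁ ≤ s ∧ (P, s₁) ∉ X ∧ (P, s₁) ≠ v} (prevAvoiding prv v P s) := by
  have h1 := hprv.isGreatest P s
  unfold prevAvoiding
  split
  next h =>
    have h2 := hprv.isGreatest P ((prv (P, s)).getD s - 1)
    have h3 := h1.1.1
    have h4 := h2.1.1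
    refine ⟨⟨by omega, h2.1.2, ?_⟩, fun s' hs' => h2.2 ⟨?_, hs'.2.1⟩⟩
    · intro h'
      have := congrArg Prod.snd (h'.trans h.symm)
      simp only at this
      omega
    · rcases (h1.2 ⟨hs'.1, hs'.2.1⟩).lt_or_eq with h5 | h5
      · omega
      · exact absurd (by rw [h5]; exact h) hs'.2.2
  next h =>
    exact ⟨⟨h1.1.1, h1.1.2, h⟩, fun s' hs' => h1.2 ⟨hs'.1, hs'.2.1⟩⟩

/-- The condition on the entrance time is a lower bound. So the last admissible time is the last one
avoiding `X` and `v`, provided that it respects this bound. -/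
theorem IsPrevTable.isBestIn_access (hprv : IsPrevTable X prv) (tNC : Arr (Fin p) (Option ℤ))
    (v : Fin p × ℤ) : IsBestIn (accessBest prv tNC v) (accessSet X tNC v) := by
  constructor
  · intro P s b h
    have hk := (hprv.isGreatest_prevAvoiding v P s).1
    simp only [accessBest_val, Option.bind_eq_some_iff] at h
    obtain ⟨e, he, h⟩ := h
    split at h
    next hle =>
      rw [Option.some.injEq] at h
      rw [h] at hk hle
      exact ⟨hk.1, hk.2.1, hk.2.2, e, he, hle⟩
    next => simp at h
  · rintro P s s₁ hs ⟨h1, h2, e, he, hle⟩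
    have hk := (hprv.isGreatest_prevAvoiding v P s).2 ⟨hs, h1, h2⟩
    rw [accessBest_val, he]
    exact ⟨_, if_pos (hle.trans hk), hk⟩

theorem accessTimes_sound (hprv : IsPrevTable X prv) {tNC : Arr (Fin p) (Option ℤ)}
    {v : Fin p × ℤ} {P : Fin p} {b : ℤ} (h : (accessTimes G prv tNC v).val P = some b) :
    TransGen (TimeEdgeFrom G.Edge (accessSet X tNC v)) (P, b) v := by
  rcases search_sound_walk G (hprv.isBestIn_access tNC v) (v := v)
    (by rw [Heap.elems_insert]; rfl) (fun P b h => by simp at h) P b h with ⟨-, P', b', h⟩ | h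
  · simp at h
  · exact h

theorem accessTimes_complete (hprv : IsPrevTable X prv) {tNC : Arr (Fin p) (Option ℤ)}
    {u v : Fin p × ℤ} (h : TransGen (TimeEdgeFrom G.Edge (accessSet X tNC v)) u v) :
    ∃ b, (accessTimes G prv tNC v).val u.1 = some b ∧ u.2 ≤ b :=
  search_complete_walk G (hprv.isBestIn_access tNC v) (by rw [Heap.elems_insert]; rfl)
    (Heap.Ordered.insert (h := Heap.leaf) later_total later_trans _ trivial) (fun P b h => by simp at h)
    (fun P => by simp) u h

end AncestorAccess

end CommonAdjustment

namespace CommonAdjustment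

open Relation

/-! ### Forward search -/

section Explore

variable {p : ℕ} (G : SCG p) (ok : Fin p → Timed Bool)

/-- The edges along which the forward search moves. -/
def OkEdge (u w : Fin p) : Prop := G.Edge u w ∧ (ok w).val = true

/-- The treatment of the child `w` in the forward search. -/
def enter (σ : List (Fin p) × Arr (Fin p) Bool) (w : Fin p) :
    Timed (List (Fin p) × Arr (Fin p) Bool) := do
  let b ← σ.2.get w
  let c ← ok w
  if b || !c then pure σ
  else
    let vis ← σ.2.set w true
    pure (w :: σ.1, vis)

theorem explore_cons (k : ℕ) (v : Fin p) (stack : List (Fin p)) (vis : Arr (Fin p) Bool)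
    (acc : List (Fin p)) :
    explore G ok (k + 1) (v :: stack) vis acc = (do
      step
      let σ ← forEach (G.ch v) (stack, vis) (enter ok)
      explore G ok k σ.1 σ.2 (v :: acc)) := rfl

theorem enter_val (σ : List (Fin p) × Arr (Fin p) Bool) (w : Fin p) :
    (enter ok σ w).val = if σ.2 w = false ∧ (ok w).val = true then (w :: σ.1, σ.2.update w true)
      else σ := by
  unfold enter
  rcases h : σ.2 w <;> rcases h' : (ok w).val <;> simp [h, h']

/-- The weighted number of vertices on the stack and of unmarked vertices. -/
def stackPotential (w : Fin p → ℕ) (σ : List (Fin p) × Arr (Fin p) Bool) : ℕ :=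
  (σ.1.map w).sum + ∑ P, if σ.2 P then 0 else w P

theorem enter_potential (w : Fin p → ℕ) (σ : List (Fin p) × Arr (Fin p) Bool) (v : Fin p) :
    stackPotential w (enter ok σ v).val = stackPotential w σ := by
  rw [enter_val]
  split
  next h =>
    have := sum_unmarked_update w σ.2 v h.1
    simp only [stackPotential, List.map_cons, List.sum_cons]
    omega
  next => rfl

theorem forEach_enter_potential (w : Fin p → ℕ) (l : List (Fin p))
    (σ : List (Fin p) × Arr (Fin p) Bool) :
    stackPotential w (forEach l σ (enter ok)).val = stackPotential w σ :=
  forEach_inv (fun σ' => stackPotential w σ' = stackPotential w σ) _ _ _ rfl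
    fun a _ s hs => (enter_potential ok w s a).trans hs

theorem explore_inv (I : List (Fin p) → Arr (Fin p) Bool → List (Fin p) → Prop)
    (hI : ∀ v stack vis acc, I (v :: stack) vis acc →
      I (forEach (G.ch v) (stack, vis) (enter ok)).val.1
        (forEach (G.ch v) (stack, vis) (enter ok)).val.2 (v :: acc))
    (k : ℕ) (stack : List (Fin p)) (vis : Arr (Fin p) Bool) (acc : List (Fin p))
    (h : I stack vis acc) (hk : stackPotential 1 (stack, vis) ≤ k) :
    I [] (explore G ok k stack vis acc).val.1 (explore G ok k stack vis acc).val.2 := by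
  induction k generalizing stack vis acc with
  | zero =>
    cases stack with
    | nil => simpa [explore] using h
    | cons v stack => simp [stackPotential] at hk
  | succ k ih =>
    cases stack with
    | nil => simpa [explore] using h
    | cons v stack =>
      rw [explore_cons]
      refine ih _ _ _ (hI v stack vis acc h) ?_
      have := forEach_enter_potential ok 1 (G.ch v) (stack, vis)
      change stackPotential 1 (forEach (G.ch v) (stack, vis) (enter ok)).val ≤ k
      rw [this]
      simp only [stackPotential, List.map_cons, List.sum_cons, Pi.one_apply] at hk ⊢
      omega

theorem stackPotential_singleton_le (C : Fin p) (vis : Arr (Fin p) Bool) :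
    stackPotential 1 ([C], vis) ≤ p + 1 := by
  have : (∑ P, if vis P then 0 else 1) ≤ ∑ _P : Fin p, 1 :=
    Finset.sum_le_sum fun P _ => by split <;> simp
  simp [stackPotential] at this ⊢
  omega

variable {ok}

theorem descendants_val_of_not {C : Fin p} {vis : Arr (Fin p) Bool}
    (h : ¬ (vis C = false ∧ (ok C).val = true)) : (descendants G ok C vis).val = (vis, []) := by
  unfold descendants
  rcases h1 : vis C <;> rcases h2 : (ok C).val <;> simp_all

theorem descendants_val_of {C : Fin p} {vis : Arr (Fin p) Bool} (h1 : vis C = false)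
    (h2 : (ok C).val = true) : (descendants G ok C vis).val =
      (explore G ok (p + 1) [C] (vis.update C true) []).val := by
  unfold descendants
  simp [h1, h2]

theorem enter_loop_spec (l : List (Fin p)) (stack : List (Fin p)) (vis : Arr (Fin p) Bool) :
    (∀ u, (forEach l (stack, vis) (enter ok)).val.2 u = true ↔
      vis u = true ∨ u ∈ l ∧ (ok u).val = true) ∧
    ∀ u, u ∈ (forEach l (stack, vis) (enter ok)).val.1 ↔
      u ∈ stack ∨ (vis u = false ∧ u ∈ l ∧ (ok u).val = true) := by
  refine forEach_prefix_inv (fun pre (σ : List (Fin p) × Arr (Fin p) Bool) =>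
    (∀ u, σ.2 u = true ↔ vis u = true ∨ u ∈ pre ∧ (ok u).val = true) ∧
    ∀ u, u ∈ σ.1 ↔ u ∈ stack ∨ (vis u = false ∧ u ∈ pre ∧ (ok u).val = true)) _ l (stack, vis)
    (by simp) ?_
  rintro pre a σ - ⟨h1, h2⟩
  rw [enter_val]
  have h3 := h1 a
  split
  next h =>
    have hva : vis a = false := by
      rw [h.1] at h3
      by_contra hc
      exact absurd (h3.2 (Or.inl (by simpa using hc))) (by simp)
    refine ⟨fun u => ?_, fun u => ?_⟩
    · by_cases hu : u = a
      · subst hu; simp [h.2]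
      · simp [Arr.update_of_ne hu, h1 u, hu]
    · by_cases hu : u = a
      · subst hu; simp [h.2, hva]
      · simp [h2 u, hu]
  next h =>
    refine ⟨fun u => ?_, fun u => ?_⟩
    · by_cases hu : u = a
      · subst hu
        rcases hv : σ.2 u <;> rcases ho : (ok u).val <;> simp_all
      · simp [h1 u, hu]
    · by_cases hu : u = a
      · subst hu
        rcases hv : σ.2 u <;> rcases ho : (ok u).val <;> rcases hw : vis u <;> simp_all
      · simp [h2 u, hu]

/-- The marks grow by exactly the returned list, and everything returned is reachable. This half
needs no assumption on the previous marks. -/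
theorem descendants_mem (C : Fin p) (vis : Arr (Fin p) Bool) :
    (∀ u, (descendants G ok C vis).val.1 u = true ↔
      vis u = true ∨ u ∈ (descendants G ok C vis).val.2) ∧
    ∀ u ∈ (descendants G ok C vis).val.2, (ok C).val = true ∧ ReflTransGen (OkEdge G ok) C u := by
  by_cases h : vis C = false ∧ (ok C).val = true
  · rw [descendants_val_of G h.1 h.2]
    have key := explore_inv G ok (fun stack vis' acc =>
      (∀ u, vis' u = true ↔ vis u = true ∨ u ∈ stack ∨ u ∈ acc) ∧
      ∀ u, u ∈ stack ∨ u ∈ acc → ReflTransGen (OkEdge G ok) C u) (by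
        rintro v stack vis' acc ⟨h1, h2⟩
        obtain ⟨l1, l2⟩ := enter_loop_spec (ok := ok) (G.ch v) stack vis'
        refine ⟨fun u => ?_, fun u hu => ?_⟩
        · rw [l1, l2, h1 u, List.mem_cons, List.mem_cons]
          rcases hv : vis' u
          · have := h1 u
            rw [hv] at this
            simp only [List.mem_cons] at this
            tauto
          · have := (h1 u).1 hv
            simp only [List.mem_cons] at this
            tauto
        · rw [l2, List.mem_cons] at hu
          have hv := h2 v (by simp)
          rcases hu with (hu | ⟨-, hu1, hu2⟩) | hu | hu
          · exact h2 u (by simp [hu])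
          · exact hv.tail ⟨hu1, hu2⟩
          · rwa [hu]
          · exact h2 u (by simp [hu])) (p + 1) [C] (vis.update C true) [] (by
        refine ⟨fun u => ?_, fun u hu => ?_⟩
        · by_cases hu : u = C
          · subst hu; simp
          · simp [Arr.update_of_ne hu, hu]
        · simp only [List.mem_singleton, List.not_mem_nil, or_false] at hu
          rw [hu]) (stackPotential_singleton_le C _)
    simp only [List.not_mem_nil, false_or] at key
    exact ⟨key.1, fun u hu => ⟨h.2, key.2 u hu⟩⟩
  · rw [descendants_val_of_not G h]
    simp

/-- Stopping at vertices that were marked before loses nothing, because the earlier marks are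
already closed under the permitted edges. -/
theorem descendants_closed {C : Fin p} {vis : Arr (Fin p) Bool}
    (hvis : ∀ u w, vis u = true → OkEdge G ok u w → vis w = true) :
    (∀ u w, (descendants G ok C vis).val.1 u = true → OkEdge G ok u w →
      (descendants G ok C vis).val.1 w = true) ∧
    ((ok C).val = true → (descendants G ok C vis).val.1 C = true) := by
  by_cases h : vis C = false ∧ (ok C).val = true
  · rw [descendants_val_of G h.1 h.2]
    have key := explore_inv G ok (fun stack vis' acc =>
      (∀ u, vis' u = true → u ∈ stack ∨ ∀ w, OkEdge G ok u w → vis' w = true) ∧ vis' C = true) (by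
        rintro v stack vis' acc ⟨h1, h2⟩
        obtain ⟨l1, l2⟩ := enter_loop_spec (ok := ok) (G.ch v) stack vis'
        refine ⟨fun u hu => ?_, (l1 C).2 (Or.inl h2)⟩
        rw [l2]
        simp only [l1] at hu ⊢
        by_cases huv : u = v
        · subst huv
          exact Or.inr fun w hw => Or.inr hw
        · rcases hvu : vis' u
          · rw [hvu] at hu
            simp only [Bool.false_eq_true, false_or] at hu
            exact Or.inl (Or.inr ⟨rfl, hu⟩)
          · rcases h1 u hvu with h' | h'
            · rw [List.mem_cons] at h'
              exact Or.inl (Or.inl (h'.resolve_left huv))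
            · exact Or.inr fun w hw => Or.inl (h' w hw)) (p + 1) [C] (vis.update C true) [] (by
        refine ⟨fun u hu => ?_, by simp⟩
        by_cases huC : u = C
        · exact Or.inl (by simp [huC])
        · rw [Arr.update_of_ne huC] at hu
          refine Or.inr fun w hw => ?_
          by_cases hwC : w = C
          · rw [hwC, Arr.update_self]
          · rw [Arr.update_of_ne hwC]
            exact hvis u w hu hw) (stackPotential_singleton_le C _)
    refine ⟨fun u w hu hw => ?_, fun _ => key.2⟩
    simpa using (key.1 u hu).resolve_left (by simp) w hw
  · rw [descendants_val_of_not G h]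
    refine ⟨hvis, fun hC => ?_⟩
    by_contra hc
    exact h ⟨by simpa using hc, hC⟩

theorem descendants_reach {C : Fin p} {vis : Arr (Fin p) Bool}
    (hvis : ∀ u w, vis u = true → OkEdge G ok u w → vis w = true) (hC : (ok C).val = true)
    {D : Fin p} (hD : ReflTransGen (OkEdge G ok) C D) :
    (descendants G ok C vis).val.1 D = true := by
  obtain ⟨h1, h2⟩ := descendants_closed (C := C) G hvis
  induction hD with
  | refl => exact h2 hC
  | tail _ h ih => exact h1 _ _ ih h

end Explore

/-! ### Entrance times -/

section Entrance

variable {p : ℕ} {G : SCG p} {X : List (Fin p × ℤ)} {nxt prv : Table p}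

theorem optMin_eq_some {a b : Option ℤ} {m : ℤ} (h : optMin a b = some m) :
    a = some m ∨ b = some m := by
  rcases a with _ | a <;> rcases b with _ | b <;> simp [optMin] at h ⊢
  · exact h
  · exact h
  · rcases min_choice a b with h' | h' <;> rw [h'] at h <;> simp [h]

theorem optMin_le_left {a b : Option ℤ} {s : ℤ} (h : a = some s) :
    ∃ m, optMin a b = some m ∧ m ≤ s := by
  subst h
  rcases b with _ | b <;> simp [optMin]

theorem optMin_le_right {a b : Option ℤ} {s : ℤ} (h : b = some s) :
    ∃ m, optMin a b = some m ∧ m ≤ s := by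
  subst h
  rcases a with _ | a <;> simp [optMin]

theorem firstTimes_spec (X : List (Fin p × ℤ)) :
    (∀ S s, (firstTimes X).val S = some s → (S, s) ∈ X) ∧
    ∀ S s, (S, s) ∈ X → ∃ s', (firstTimes X).val S = some s' ∧ s' ≤ s := by
  refine forEach_prefix_inv (fun pre (A : Arr (Fin p) (Option ℤ)) =>
    (∀ S s, A S = some s → (S, s) ∈ pre) ∧
    ∀ S s, (S, s) ∈ pre → ∃ s', A S = some s' ∧ s' ≤ s) _ X (Arr.const none) (by simp) ?_
  rintro pre a A - ⟨h1, h2⟩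
  simp only [Timed.bind_val, Arr.get_val, Arr.set_val]
  constructor
  · intro S s h
    by_cases hS : S = a.1
    · subst hS
      rw [Arr.update_self] at h
      rcases optMin_eq_some h with h | h
      · simp [h1 _ _ h]
      · rw [Option.some.injEq] at h
        simp [← h]
    · rw [Arr.update_of_ne hS] at h
      simp [h1 _ _ h]
  · intro S s h
    by_cases hS : S = a.1
    · subst hS
      rw [Arr.update_self]
      rcases List.mem_append.1 h with h | h
      · obtain ⟨s', h3, h4⟩ := h2 _ _ h
        obtain ⟨m, h5, h6⟩ := optMin_le_left (b := some a.2) h3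
        exact ⟨m, h5, h6.trans h4⟩
      · rw [List.mem_singleton] at h
        exact optMin_le_right (by rw [← h])
    · rw [Arr.update_of_ne hS]
      refine h2 S s ((List.mem_append.1 h).resolve_right fun h => hS ?_)
      rw [List.mem_singleton] at h
      rw [← h]

theorem optMin_loop_spec (f : Arr (Fin p) (Option ℤ)) (l : List (Fin p)) :
    (∀ m, (forEach l none fun m x => do
        let r ← f.get x
        pure (optMin m r)).val = some m → ∃ x ∈ l, f x = some m) ∧
    ∀ x ∈ l, ∀ s, f x = some s → ∃ m, (forEach l none fun m x => do
        let r ← f.get x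
        pure (optMin m r)).val = some m ∧ m ≤ s := by
  refine forEach_prefix_inv (fun pre (o : Option ℤ) =>
    (∀ m, o = some m → ∃ x ∈ pre, f x = some m) ∧
    ∀ x ∈ pre, ∀ s, f x = some s → ∃ m, o = some m ∧ m ≤ s) _ l none (by simp) ?_
  rintro pre a o - ⟨h1, h2⟩
  simp only [Timed.bind_val, Arr.get_val, Timed.pure_val]
  constructor
  · intro m h
    rcases optMin_eq_some h with h | h
    · obtain ⟨x, hx, hm⟩ := h1 m h
      exact ⟨x, by simp [hx], hm⟩
    · exact ⟨a, by simp, h⟩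
  · intro x hx s h
    rcases List.mem_append.1 hx with hx | hx
    · obtain ⟨m, h3, h4⟩ := h2 x hx s h
      obtain ⟨m', h5, h6⟩ := optMin_le_left (b := f a) h3
      exact ⟨m', h5, h6.trans h4⟩
    · rw [List.mem_singleton] at hx
      subst hx
      exact optMin_le_right h

/-- The body of the loop that collects the entries. -/
def entryStep (G : SCG p) (nxt : Table p) (first anc : Arr (Fin p) (Option ℤ))
    (L : List (Entry p)) (C : Fin p) : Timed (List (Entry p)) := do
  let tmin ← forEach (G.pa C) none fun m x => do
    let r ← first.get x
    pure (optMin m r)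
  let a ← anc.get C
  match tmin, a with
  | some tmin, some a => do
    let tC ← free nxt C tmin
    if a < tC then pure L
    else
      let simul ← forEach (G.pa C) [] fun l x => do
        let r ← nxt.get (x, tC)
        pure (if r.isSome then x :: l else l)
      let d := decide (tmin < tC) || decide (2 ≤ simul.length)
      pure (⟨C, tC, if d then none else simul.head?⟩ :: L)
  | _, _ => pure L

theorem entries_eq (first anc : Arr (Fin p) (Option ℤ)) :
    entries G nxt first anc = forEach (List.finRange p) [] (entryStep G nxt first anc) := rfl

/-- What is needed about an entry of the list of children of intervened series. -/
structure Entry.IsValid (G : SCG p) (X : List (Fin p × ℤ)) (anc : Arr (Fin p) (Option ℤ))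
    (e : Entry p) : Prop where
  notMem : (e.C, e.time) ∉ X
  parent : ∃ x ∈ X, x.2 ≤ e.time ∧ G.Edge x.1 e.C
  anc_le : ∃ a, anc e.C = some a ∧ e.time ≤ a
  skip_mem : ∀ x, e.skip = some x → (x, e.time) ∈ X ∧ G.Edge x e.C

/-- The table of next times doubles as a membership test: a cell is nonblank exactly at an
intervention. -/
theorem simul_loop_spec (hnxt : IsNextTable X nxt) (s : ℤ) (l : List (Fin p)) :
    ∀ x ∈ (forEach l [] fun l x => do
        let r ← nxt.get (x, s)
        pure (if r.isSome then x :: l else l)).val, x ∈ l ∧ (x, s) ∈ X := by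
  refine forEach_inv (fun m : List (Fin p) => ∀ x ∈ m, x ∈ l ∧ (x, s) ∈ X) _ l [] (by simp) ?_
  intro a ha m hm x hx
  obtain ⟨r, hr⟩ : ∃ r, (nxt.get (a, s)).val = r := ⟨_, rfl⟩
  simp only [Timed.bind_val, Timed.pure_val, hr] at hx
  rcases r with _ | r
  · exact hm x hx
  · rcases List.mem_cons.1 hx with rfl | hx
    · exact ⟨ha, (hnxt.isSome_iff _).1 (by rw [Arr.get_val] at hr; simp [hr])⟩
    · exact hm x hx

/-- The candidate time is the first free time of `C` from the earliest intervention on a parent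
onwards. If it lies beyond the ancestor time, `C` offers no entrance at all; otherwise it is a lower
bound for every entrance through `C`. Of the skipped series only its intervention at that time and
its edge to `C` are retained, not its uniqueness. -/
theorem entryStep_spec (hnxt : IsNextTable X nxt) (anc : Arr (Fin p) (Option ℤ))
    (L : List (Entry p)) (C : Fin p) :
    ((entryStep G nxt (firstTimes X).val anc L C).val = L ∧
      ∀ x ∈ X, G.Edge x.1 C → ∀ c, x.2 ≤ c → (C, c) ∉ X → ∀ a, anc C = some a → a < c) ∨
    ∃ e : Entry p, (entryStep G nxt (firstTimes X).val anc L C).val = e :: L ∧ e.C = C ∧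
      e.IsValid G X anc ∧
      ∀ x ∈ X, G.Edge x.1 C → ∀ c, x.2 ≤ c → (C, c) ∉ X → e.time ≤ c := by
  obtain ⟨f1, f2⟩ := firstTimes_spec X
  obtain ⟨m1, m2⟩ := optMin_loop_spec (firstTimes X).val (G.pa C)
  have m3 : ∀ x ∈ X, G.Edge x.1 C → ∃ m, (forEach (G.pa C) none fun m x => do
      let r ← (firstTimes X).val.get x
      pure (optMin m r)).val = some m ∧ m ≤ x.2 := by
    intro x hx hC
    obtain ⟨s', h1, h2⟩ := f2 x.1 x.2 hx
    obtain ⟨m, h3, h4⟩ := m2 x.1 ((G.mem_pa _ _).2 hC) s' h1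
    exact ⟨m, h3, h4.trans h2⟩
  unfold entryStep
  simp only [Timed.bind_val, Arr.get_val]
  generalize (forEach (G.pa C) none fun m x => do
      let r ← (firstTimes X).val.get x
      pure (optMin m r)).val = o at m1 m3
  rcases o with _ | tmin
  · left
    refine ⟨rfl, fun x hx hC => ?_⟩
    obtain ⟨m, h, -⟩ := m3 x hx hC
    simp at h
  · rcases ha : anc C with _ | a
    · left
      refine ⟨rfl, fun x hx hC c hc hcX a ha' => ?_⟩
      simp at ha'
    · obtain ⟨tC, htC⟩ : ∃ tC, tC = (free nxt C tmin).val := ⟨_, rfl⟩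
      have hl := hnxt.isLeast C tmin
      rw [← free_val, ← htC] at hl
      have hmin : ∀ x ∈ X, G.Edge x.1 C → ∀ c, x.2 ≤ c → (C, c) ∉ X → tC ≤ c := by
        intro x hx hC c hc hcX
        obtain ⟨m, h1, h2⟩ := m3 x hx hC
        rw [Option.some.injEq] at h1
        exact hl.2 ⟨by omega, hcX⟩
      simp only [Timed.bind_val, ← htC]
      by_cases hlt : a < tC
      · left
        rw [if_pos hlt]
        refine ⟨rfl, fun x hx hC c hc hcX a' ha' => ?_⟩
        rw [Option.some.injEq] at ha'
        have := hmin x hx hC c hc hcX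
        omega
      · right
        rw [if_neg hlt]
        refine ⟨_, rfl, rfl, ⟨hl.1.2, ?_, ⟨a, ha, not_lt.1 hlt⟩, ?_⟩, hmin⟩
        · obtain ⟨x, hx, hm⟩ := m1 tmin rfl
          exact ⟨(x, tmin), f1 _ _ hm, hl.1.1, (G.mem_pa _ _).1 hx⟩
        · intro x hx
          simp only at hx
          split at hx
          · simp at hx
          · have := simul_loop_spec hnxt tC (G.pa C) x (List.mem_of_mem_head? hx)
            exact ⟨this.2, (G.mem_pa _ _).1 this.1⟩

theorem entries_spec (hnxt : IsNextTable X nxt) (anc : Arr (Fin p) (Option ℤ)) :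
    (∀ e ∈ (entries G nxt (firstTimes X).val anc).val, e.IsValid G X anc) ∧
    ∀ x ∈ X, ∀ C, G.Edge x.1 C → ∀ c, x.2 ≤ c → (C, c) ∉ X → ∀ a, anc C = some a → c ≤ a →
      ∃ e ∈ (entries G nxt (firstTimes X).val anc).val, e.C = C ∧ e.time ≤ c := by
  rw [entries_eq]
  have key := forEach_prefix_inv (fun pre (L : List (Entry p)) =>
    (∀ e ∈ L, e.IsValid G X anc) ∧
    ∀ x ∈ X, ∀ C ∈ pre, G.Edge x.1 C → ∀ c, x.2 ≤ c → (C, c) ∉ X → ∀ a, anc C = some a → c ≤ a →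
      ∃ e ∈ L, e.C = C ∧ e.time ≤ c) (entryStep G nxt (firstTimes X).val anc) (List.finRange p) []
    (by simp) (by
      rintro pre C L - ⟨h1, h2⟩
      rcases entryStep_spec (G := G) hnxt anc L C with ⟨h3, h4⟩ | ⟨e, h3, h4, h5, h6⟩
      · rw [h3]
        refine ⟨h1, fun x hx C' hC' hE c hc hcX a ha hca => ?_⟩
        rcases List.mem_append.1 hC' with hC' | hC'
        · exact h2 x hx C' hC' hE c hc hcX a ha hca
        · rw [List.mem_singleton] at hC'
          subst hC'
          exact absurd hca (not_le.2 (h4 x hx hE c hc hcX a ha))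
      · rw [h3]
        refine ⟨fun e' he' => ?_, fun x hx C' hC' hE c hc hcX a ha hca => ?_⟩
        · rcases List.mem_cons.1 he' with rfl | he'
          · exact h5
          · exact h1 e' he'
        · rcases List.mem_append.1 hC' with hC' | hC'
          · obtain ⟨e', he', h7⟩ := h2 x hx C' hC' hE c hc hcX a ha hca
            exact ⟨e', by simp [he'], h7⟩
          · rw [List.mem_singleton] at hC'
            subst hC'
            exact ⟨e, by simp, h4, h6 x hx hE c hc hcX⟩)
  exact ⟨key.1, fun x hx C => key.2 x hx C (List.mem_finRange C)⟩

theorem assign_val (nxt : Table p) (s : ℤ) (ds : List (Fin p)) (T : Arr (Fin p) (Option ℤ))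
    (D : Fin p) : (assign nxt s ds T).val D =
      if D ∈ ds then some ((T D).getD ((nxt (D, s)).getD s)) else T D := by
  refine forEach_prefix_inv (fun pre (T' : Arr (Fin p) (Option ℤ)) => ∀ D, T' D =
    if D ∈ pre then some ((T D).getD ((nxt (D, s)).getD s)) else T D) _ ds T (by simp) ?_ D
  rintro pre a T' - hI D
  simp only [Timed.bind_val, Arr.get_val]
  rcases ha : T' a with _ | v
  · have h1 := hI a
    rw [ha] at h1
    simp only [Timed.bind_val, Arr.set_val, free_val]
    by_cases hD : D = a
    · subst hD
      split at h1
      · simp at h1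
      · simp [← h1]
    · simp [Arr.update_of_ne hD, hI D, hD]
  · simp only [Timed.pure_val]
    by_cases hD : D = a
    · subst hD
      have h1 := hI D
      rw [ha] at h1
      split at h1
      · simp [h1, ha]
      · simp [← h1, ha]
    · simp [hI D, hD]

/-- The treatment of an entry. -/
def entranceStep (G : SCG p) (nxt : Table p) (σ : EntranceState p) (e : Entry p) :
    Timed (EntranceState p) := do
  match e.skip with
  | none => do
    let r₂ ← descendants G (fun _ => pure true) e.C σ.vis₂
    let tNC ← assign nxt e.time r₂.2 σ.tNC
    pure ⟨σ.vis₁, r₂.1, tNC⟩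
  | some x => do
    let r₁ ← descendants G (fun w => pure (decide (w ≠ x))) e.C σ.vis₁
    let tNC ← assign nxt e.time r₁.2 σ.tNC
    let r₂ ← descendants G (fun _ => pure true) e.C σ.vis₂
    let tNC ← assign nxt (e.time + 1) r₂.2 tNC
    pure ⟨r₁.1, r₂.1, tNC⟩

end Entrance

end CommonAdjustment

namespace CommonAdjustment

open Relation

/-! ### The loop over the sorted entries -/

section Entrance

variable {p : ℕ} {G : SCG p} {X : List (Fin p × ℤ)} {nxt prv : Table p}

/-- The first time `≥ s` at which `D` is not intervened on, read off the table. -/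
def nextFree (nxt : Table p) (D : Fin p) (s : ℤ) : ℤ := (nxt (D, s)).getD s

theorem IsNextTable.nextFree_le (hnxt : IsNextTable X nxt) {D : Fin p} {s s₁ : ℤ} (hs : s ≤ s₁)
    (h : (D, s₁) ∉ X) : nextFree nxt D s ≤ s₁ := (hnxt.isLeast D s).2 ⟨hs, h⟩

theorem IsNextTable.le_nextFree (hnxt : IsNextTable X nxt) (D : Fin p) (s : ℤ) :
    s ≤ nextFree nxt D s := (hnxt.isLeast D s).1.1

theorem IsNextTable.nextFree_notMem (hnxt : IsNextTable X nxt) (D : Fin p) (s : ℤ) :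
    (D, nextFree nxt D s) ∉ X := (hnxt.isLeast D s).1.2

theorem IsNextTable.nextFree_mono (hnxt : IsNextTable X nxt) (D : Fin p) {s s' : ℤ}
    (hs : s ≤ s') : nextFree nxt D s ≤ nextFree nxt D s' :=
  hnxt.nextFree_le (hs.trans (hnxt.le_nextFree D s')) (hnxt.nextFree_notMem D s')

theorem assign_of_some {s : ℤ} {ds : List (Fin p)} {T : Arr (Fin p) (Option ℤ)} {D : Fin p}
    {v : ℤ} (h : T D = some v) : (assign nxt s ds T).val D = some v := by
  rw [assign_val, h]
  simp

theorem assign_of_mem {s : ℤ} {ds : List (Fin p)} {T : Arr (Fin p) (Option ℤ)} {D : Fin p}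
    (hD : D ∈ ds) : T D = none ∧ (assign nxt s ds T).val D = some (nextFree nxt D s) ∨
      ∃ v, T D = some v ∧ (assign nxt s ds T).val D = some v := by
  rw [assign_val, if_pos hD]
  rcases T D with _ | v
  · exact Or.inl ⟨rfl, rfl⟩
  · exact Or.inr ⟨v, rfl, rfl⟩

theorem of_assign_eq_some {s : ℤ} {ds : List (Fin p)} {T : Arr (Fin p) (Option ℤ)} {D : Fin p}
    {v : ℤ} (h : (assign nxt s ds T).val D = some v) :
    T D = some v ∨ D ∈ ds ∧ v = nextFree nxt D s := by
  by_cases hD : D ∈ ds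
  · rcases assign_of_mem (nxt := nxt) (s := s) (T := T) hD with ⟨-, h'⟩ | ⟨v', h', h''⟩
    · rw [h, Option.some.injEq] at h'
      exact Or.inr ⟨hD, h'⟩
    · rw [h, Option.some.injEq] at h''
      exact Or.inl (by rw [h', h''])
  · rw [assign_val, if_neg hD] at h
    exact Or.inl h

theorem entranceStep_of_none {σ : EntranceState p} {e : Entry p} (h : e.skip = none) :
    (entranceStep G nxt σ e).val =
      ⟨σ.vis₁, (descendants G (fun _ => pure true) e.C σ.vis₂).val.1,
        (assign nxt e.time (descendants G (fun _ => pure true) e.C σ.vis₂).val.2 σ.tNC).val⟩ := by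
  unfold entranceStep
  rw [h]
  rfl

theorem entranceStep_of_some {σ : EntranceState p} {e : Entry p} {x : Fin p}
    (h : e.skip = some x) :
    (entranceStep G nxt σ e).val =
      ⟨(descendants G (fun w => pure (decide (w ≠ x))) e.C σ.vis₁).val.1,
        (descendants G (fun _ => pure true) e.C σ.vis₂).val.1,
        (assign nxt (e.time + 1) (descendants G (fun _ => pure true) e.C σ.vis₂).val.2
          (assign nxt e.time
            (descendants G (fun w => pure (decide (w ≠ x))) e.C σ.vis₁).val.2 σ.tNC).val).val⟩ := by
  unfold entranceStep
  rw [h]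
  rfl

theorem entranceTimes_val (Y : Fin p) (t : ℤ) :
    (entranceTimes G X Y t nxt prv).val =
      (forEach (heapSort Entry.before
        (entries G nxt (firstTimes X).val (ancestorTimes G prv Y t).val).val).val
        ⟨Arr.const false, Arr.const false, Arr.const none⟩ (entranceStep G nxt)).val.tNC := rfl

theorem OkEdge.edge {ok : Fin p → Timed Bool} {u w : Fin p}
    (h : ReflTransGen (OkEdge G ok) u w) : ReflTransGen G.Edge u w :=
  ReflTransGen.mono (fun _ _ h => h.1) _ _ h

theorem entranceStep_persist {σ : EntranceState p} {e : Entry p} {D : Fin p} {v : ℤ}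
    (h : σ.tNC D = some v) : (entranceStep G nxt σ e).val.tNC D = some v := by
  rcases hs : e.skip with _ | x
  · rw [entranceStep_of_none hs]
    exact assign_of_some h
  · rw [entranceStep_of_some hs]
    exact assign_of_some (assign_of_some h)

theorem entranceStep_sound {σ : EntranceState p} {e : Entry p} {D : Fin p} {v : ℤ}
    (h : (entranceStep G nxt σ e).val.tNC D = some v) : σ.tNC D = some v ∨
      ReflTransGen G.Edge e.C D ∧ (v = nextFree nxt D e.time ∨ v = nextFree nxt D (e.time + 1)) := by
  rcases hs : e.skip with _ | x
  · rw [entranceStep_of_none hs] at h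
    rcases of_assign_eq_some h with h | ⟨h1, h2⟩
    · exact Or.inl h
    · exact Or.inr ⟨OkEdge.edge ((descendants_mem G _ _).2 D h1).2, Or.inl h2⟩
  · rw [entranceStep_of_some hs] at h
    rcases of_assign_eq_some h with h | ⟨h1, h2⟩
    · rcases of_assign_eq_some h with h | ⟨h1, h2⟩
      · exact Or.inl h
      · exact Or.inr ⟨OkEdge.edge ((descendants_mem G _ _).2 D h1).2, Or.inl h2⟩
    · exact Or.inr ⟨OkEdge.edge ((descendants_mem G _ _).2 D h1).2, Or.inr h2⟩

/-- The entry `e` has to avoid a series that is a descendant of its child. -/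
def Entry.IsCyclic (G : SCG p) (e : Entry p) : Prop :=
  ∃ x, e.skip = some x ∧ ReflTransGen G.Edge e.C x

/-- The invariant of the loop over the entries as long as no cyclic one is met. -/
structure EntranceInv (G : SCG p) (nxt : Table p) (pre : List (Entry p)) (σ : EntranceState p) :
    Prop where
  closed₁ : ∀ u w, σ.vis₁ u = true → G.Edge u w → σ.vis₁ w = true
  closed₂ : ∀ u w, σ.vis₂ u = true → G.Edge u w → σ.vis₂ w = true
  marked₁ : ∀ D, σ.vis₁ D = true → ∃ v, σ.tNC D = some v
  marked₂ : ∀ D, σ.vis₂ D = true → ∃ v, σ.tNC D = some v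
  value : ∀ D v, σ.tNC D = some v →
    ∃ e ∈ pre, v = nextFree nxt D e.time ∧ ReflTransGen G.Edge e.C D
  cover : ∀ e ∈ pre, ∀ D, ReflTransGen G.Edge e.C D →
    ∃ v, σ.tNC D = some v ∧ v ≤ nextFree nxt D e.time

/-- If nothing reachable from `C` is excluded, a restricted search is a full one. This makes the
search without a series harmless when that series does not descend from `C`. -/
theorem descendants_all {ok : Fin p → Timed Bool} {C : Fin p} {vis : Arr (Fin p) Bool}
    (hvis : ∀ u w, vis u = true → G.Edge u w → vis w = true)
    (hok : ∀ D, ReflTransGen G.Edge C D → (ok D).val = true) :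
    (∀ u w, (descendants G ok C vis).val.1 u = true → G.Edge u w →
      (descendants G ok C vis).val.1 w = true) ∧
    (∀ D, ReflTransGen G.Edge C D → (descendants G ok C vis).val.1 D = true) := by
  obtain ⟨h1, h2⟩ := descendants_mem (ok := ok) G C vis
  obtain ⟨h3, h4⟩ := descendants_closed (ok := ok) (C := C) G (vis := vis)
    fun u w hu h => hvis u w hu h.1
  have h5 : ∀ u w, (descendants G ok C vis).val.1 u = true → G.Edge u w →
      (descendants G ok C vis).val.1 w = true := by
    intro u w hu huw
    rcases (h1 u).1 hu with h | h
    · exact (h1 w).2 (Or.inl (hvis u w h huw))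
    · exact h3 u w hu ⟨huw, hok w ((OkEdge.edge (h2 u h).2).tail huw)⟩
  refine ⟨h5, fun D hD => ?_⟩
  induction hD with
  | refl => exact h4 (hok C ReflTransGen.refl)
  | tail _ h ih => exact h5 _ _ ih h

/-- Entries come in increasing order of time, so a value set earlier is the next free time after an
earlier or equal moment and is at most the one that `e` would give. -/
theorem assign_first {pre : List (Entry p)} {e : Entry p} {T : Arr (Fin p) (Option ℤ)}
    (hnxt : IsNextTable X nxt) (hsort : ∀ e' ∈ pre, e'.time ≤ e.time)
    (hval : ∀ D v, T D = some v →
      ∃ e ∈ pre, v = nextFree nxt D e.time ∧ ReflTransGen G.Edge e.C D)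
    {ds : List (Fin p)} {D : Fin p} (hD : (∃ v, T D = some v) ∨ D ∈ ds) :
    ∃ v, (assign nxt e.time ds T).val D = some v ∧ v ≤ nextFree nxt D e.time := by
  rcases hT : T D with _ | v
  · rw [hT] at hD
    rcases assign_of_mem (nxt := nxt) (s := e.time) (T := T) (hD.resolve_left (by simp)) with
      h | ⟨v, h, -⟩
    · exact ⟨_, h.2, le_rfl⟩
    · rw [hT] at h
      simp at h
  · obtain ⟨e', he', hv, -⟩ := hval D v hT
    exact ⟨v, assign_of_some hT, hv ▸ hnxt.nextFree_mono D (hsort e' he')⟩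

/-- An entry that is not cyclic acts like a full search from its child at time `e.time`, whether or
not it skips a series. -/
theorem EntranceInv.next {pre : List (Entry p)} {e : Entry p} {σ : EntranceState p}
    (hnxt : IsNextTable X nxt) (hI : EntranceInv G nxt pre σ)
    (hsort : ∀ e' ∈ pre, e'.time ≤ e.time) (he : ¬ e.IsCyclic G) :
    EntranceInv G nxt (pre ++ [e]) (entranceStep G nxt σ e).val := by
  obtain ⟨a1, a2⟩ := descendants_all (ok := fun _ => pure true) (C := e.C) hI.closed₂
    (fun _ _ => rfl)
  obtain ⟨m1, m2⟩ := descendants_mem (ok := fun _ => pure true) G e.C σ.vis₂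
  rcases hs : e.skip with _ | x
  · have key : ∀ D, (σ.vis₁ D = true ∨
        (descendants G (fun _ => pure true) e.C σ.vis₂).val.1 D = true) →
        ∃ v, (assign nxt e.time (descendants G (fun _ => pure true) e.C σ.vis₂).val.2 σ.tNC).val D
          = some v ∧ v ≤ nextFree nxt D e.time := by
      intro D hD
      refine assign_first hnxt hsort hI.value ?_
      rcases hD with hD | hD
      · exact Or.inl (hI.marked₁ D hD)
      · rcases (m1 D).1 hD with hD | hD
        · exact Or.inl (hI.marked₂ D hD)
        · exact Or.inr hD
    rw [entranceStep_of_none hs]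
    refine ⟨hI.closed₁, a1, fun D hD => ?_, fun D hD => ?_, fun D v h => ?_, fun e' he' D hD => ?_⟩
    · obtain ⟨v, hv, -⟩ := key D (Or.inl hD)
      exact ⟨v, hv⟩
    · obtain ⟨v, hv, -⟩ := key D (Or.inr hD)
      exact ⟨v, hv⟩
    · rcases of_assign_eq_some h with h | ⟨h1, h2⟩
      · obtain ⟨e', he', h'⟩ := hI.value D v h
        exact ⟨e', by simp [he'], h'⟩
      · exact ⟨e, by simp, h2, OkEdge.edge (m2 D h1).2⟩
    · rcases List.mem_append.1 he' with he' | he'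
      · obtain ⟨v, h1, h2⟩ := hI.cover e' he' D hD
        exact ⟨v, assign_of_some h1, h2⟩
      · rw [List.mem_singleton] at he'
        subst he'
        exact key D (Or.inr (a2 D hD))
  · have hx : ∀ D, ReflTransGen G.Edge e.C D →
        ((pure (decide (D ≠ x)) : Timed Bool)).val = true := by
      intro D hD
      rw [Timed.pure_val, decide_eq_true_eq]
      rintro rfl
      exact he ⟨D, hs, hD⟩
    obtain ⟨b1, b2⟩ := descendants_all (ok := fun w => pure (decide (w ≠ x))) (C := e.C)
      hI.closed₁ hx
    obtain ⟨n1, n2⟩ := descendants_mem (ok := fun w => pure (decide (w ≠ x))) G e.C σ.vis₁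
    set ds₁ := (descendants G (fun w => pure (decide (w ≠ x))) e.C σ.vis₁).val.2
    have key : ∀ D, (σ.vis₂ D = true ∨
        (descendants G (fun w => pure (decide (w ≠ x))) e.C σ.vis₁).val.1 D = true) →
        ∃ v, (assign nxt e.time ds₁ σ.tNC).val D = some v ∧ v ≤ nextFree nxt D e.time := by
      intro D hD
      refine assign_first hnxt hsort hI.value ?_
      rcases hD with hD | hD
      · exact Or.inl (hI.marked₂ D hD)
      · rcases (n1 D).1 hD with hD | hD
        · exact Or.inl (hI.marked₁ D hD)
        · exact Or.inr hD
    rw [entranceStep_of_some hs]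
    refine ⟨b1, a1, fun D hD => ?_, fun D hD => ?_, fun D v h => ?_, fun e' he' D hD => ?_⟩
    · obtain ⟨v, hv, -⟩ := key D (Or.inr hD)
      exact ⟨v, assign_of_some hv⟩
    · obtain ⟨v, hv, -⟩ := key D (by
        rcases (m1 D).1 hD with hD | hD
        · exact Or.inl hD
        · exact Or.inr (b2 D (OkEdge.edge (m2 D hD).2)))
      exact ⟨v, assign_of_some hv⟩
    -- The second pass, one time unit later, sets no new value: everything it reaches was reached
    -- and set in the first pass.
    · have h' : (assign nxt e.time ds₁ σ.tNC).val D = some v := by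
        rcases of_assign_eq_some h with h | ⟨h1, h2⟩
        · exact h
        · obtain ⟨v', hv', -⟩ := key D (Or.inr (b2 D (OkEdge.edge (m2 D h1).2)))
          have h3 := assign_of_some (nxt := nxt) (s := e.time + 1)
            (ds := (descendants G (fun _ => pure true) e.C σ.vis₂).val.2) hv'
          have h4 := h3.symm.trans h
          rw [hv', h4]
      rcases of_assign_eq_some h' with h | ⟨h1, h2⟩
      · obtain ⟨e', he', h'⟩ := hI.value D v h
        exact ⟨e', by simp [he'], h'⟩
      · exact ⟨e, by simp, h2, OkEdge.edge (n2 D h1).2⟩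
    · rcases List.mem_append.1 he' with he' | he'
      · obtain ⟨v, h1, h2⟩ := hI.cover e' he' D hD
        exact ⟨v, assign_of_some (assign_of_some h1), h2⟩
      · rw [List.mem_singleton] at he'
        subst he'
        obtain ⟨v, h1, h2⟩ := key D (Or.inr (b2 D hD))
        exact ⟨v, assign_of_some h1, h2⟩

/-- The marks `vis₁` are shared by searches that skip different series. Up to the first cyclic entry
they are closed under all edges, so that this sharing loses nothing; afterwards this may fail. The
estimates here concern that first entry only, and values once set are never changed. -/
theorem EntranceInv.cyclic {pre : List (Entry p)} {e : Entry p} {σ : EntranceState p} {x : Fin p}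
    (hnxt : IsNextTable X nxt) (hI : EntranceInv G nxt pre σ)
    (hsort : ∀ e' ∈ pre, e'.time ≤ e.time) (hs : e.skip = some x) (hx : e.C ≠ x) :
    (∀ D, ReflTransGen (fun u w => G.Edge u w ∧ w ≠ x) e.C D →
      ∃ v, (entranceStep G nxt σ e).val.tNC D = some v ∧ v ≤ nextFree nxt D e.time) ∧
    ∀ D, ReflTransGen G.Edge e.C D →
      ∃ v, (entranceStep G nxt σ e).val.tNC D = some v ∧ v ≤ nextFree nxt D (e.time + 1) := by
  obtain ⟨a1, a2⟩ := descendants_all (ok := fun _ => pure true) (C := e.C) hI.closed₂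
    (fun _ _ => rfl)
  obtain ⟨m1, m2⟩ := descendants_mem (ok := fun _ => pure true) G e.C σ.vis₂
  obtain ⟨n1, n2⟩ := descendants_mem (ok := fun w => pure (decide (w ≠ x))) G e.C σ.vis₁
  rw [entranceStep_of_some hs]
  constructor
  · intro D hD
    have hD' := descendants_reach (ok := fun w => pure (decide (w ≠ x))) (C := e.C) G
      (vis := σ.vis₁) (fun u w hu h => hI.closed₁ u w hu h.1) (by simpa using hx)
      (D := D) (ReflTransGen.mono (fun u w h => ⟨h.1, by simpa using h.2⟩) _ _ hD)
    obtain ⟨v, h1, h2⟩ := assign_first hnxt hsort hI.value (e := e) (D := D)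
      (ds := (descendants G (fun w => pure (decide (w ≠ x))) e.C σ.vis₁).val.2) (by
        rcases (n1 D).1 hD' with h | h
        · exact Or.inl (hI.marked₁ D h)
        · exact Or.inr h)
    exact ⟨v, assign_of_some h1, h2⟩
  · intro D hD
    rcases hT : (assign nxt e.time
      (descendants G (fun w => pure (decide (w ≠ x))) e.C σ.vis₁).val.2 σ.tNC).val D with _ | v
    · rcases (m1 D).1 (a2 D hD) with h | h
      · obtain ⟨v, hv⟩ := hI.marked₂ D h
        rw [assign_of_some hv] at hT
        simp at hT
      · rcases assign_of_mem (nxt := nxt) (s := e.time + 1) (T := (assign nxt e.time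
          (descendants G (fun w => pure (decide (w ≠ x))) e.C σ.vis₁).val.2 σ.tNC).val) h with
          h | ⟨v, h, -⟩
        · exact ⟨_, h.2, le_rfl⟩
        · rw [hT] at h
          simp at h
    · refine ⟨v, assign_of_some hT, ?_⟩
      rcases of_assign_eq_some hT with h | ⟨-, h⟩
      · obtain ⟨e', he', hv, -⟩ := hI.value D v h
        rw [hv]
        exact hnxt.nextFree_mono D (by have := hsort e' he'; omega)
      · rw [h]
        exact hnxt.nextFree_mono D (by omega)

theorem forEach_append_val {α σ : Type} (l₁ l₂ : List α) (s : σ) (f : σ → α → Timed σ) :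
    (forEach (l₁ ++ l₂) s f).val = (forEach l₂ (forEach l₁ s f).val f).val := by
  induction l₁ generalizing s with
  | nil => rfl
  | cons a l ih => exact ih _

theorem exists_first_of_exists {α : Type*} {P : α → Prop} {l : List α} (h : ∃ a ∈ l, P a) :
    ∃ pre a post, l = pre ++ a :: post ∧ P a ∧ ∀ b ∈ pre, ¬ P b := by
  induction l with
  | nil => simp at h
  | cons b l ih =>
    by_cases hb : P b
    · exact ⟨[], b, l, rfl, hb, by simp⟩
    · obtain ⟨a, ha, hP⟩ := h
      rcases List.mem_cons.1 ha with rfl | ha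
      · exact absurd hP hb
      · obtain ⟨pre, a, post, h1, h2, h3⟩ := ih ⟨a, ha, hP⟩
        refine ⟨b :: pre, a, post, by rw [h1]; rfl, h2, fun c hc => ?_⟩
        rcases List.mem_cons.1 hc with rfl | hc
        · exact hb
        · exact h3 c hc

/-- What the proof of correctness uses about the entrance times `T`. -/
structure EntranceSpec (G : SCG p) (X : List (Fin p × ℤ)) (Y : Fin p) (t : ℤ)
    (T : Arr (Fin p) (Option ℤ)) : Prop where
  sound : ∀ D v, T D = some v → (D, v) ∉ X ∧ ∃ x ∈ X, x.2 ≤ v ∧ TransGen G.Edge x.1 D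
  alternative :
    ((∀ D v, T D = some v → ∀ D', ReflTransGen G.Edge D D' → ∀ s, v ≤ s → (D', s) ∉ X →
        ∃ v', T D' = some v' ∧ v' ≤ s) ∧
      ∀ x ∈ X, ∀ c, c ∉ X → TimeEdge G.Edge x c →
        ReflTransGen (TimeEdgeFrom G.Edge {u | u ∉ X}) c (Y, t) →
        ∃ v, T c.1 = some v ∧ v ≤ c.2) ∨
    ∃ (C : Fin p) (τ : ℤ) (x : Fin p), (C, τ) ∉ X ∧ (x, τ) ∈ X ∧ ReflTransGen G.Edge C x ∧
      G.Edge x C ∧ τ ≤ t ∧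
      (C ≠ Y → ReflTransGen (TimeEdgeFrom G.Edge {u | u ∉ X}) (C, τ) (Y, t)) ∧
      (∀ D, ReflTransGen (fun u w => G.Edge u w ∧ w ≠ x) C D → ∀ s, τ ≤ s → (D, s) ∉ X →
        ∃ v, T D = some v ∧ v ≤ s) ∧
      ∀ D, ReflTransGen G.Edge C D → ∀ s, τ + 1 ≤ s → (D, s) ∉ X → ∃ v, T D = some v ∧ v ≤ s

theorem TimeEdgeFrom.time_le {V : Type*} {E : V → V → Prop} {A : Set (V × ℤ)} {u w : V × ℤ}
    (h : ReflTransGen (TimeEdgeFrom E A) u w) : u.2 ≤ w.2 := by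
  induction h with
  | refl => exact le_rfl
  | tail _ h ih => exact ih.trans h.1.2

theorem before_time_le {a b : Entry p} (h : Entry.before a b = true) : a.time ≤ b.time := by
  simp only [Entry.before, Bool.or_eq_true, decide_eq_true_eq, Bool.and_eq_true] at h
  rcases h with h | h
  · exact h.le
  · exact h.1.le

theorem before_total (a b : Entry p) : (Entry.before a b || Entry.before b a) = true := by
  simp only [Entry.before, Bool.or_eq_true, decide_eq_true_eq, Bool.and_eq_true]
  rcases lt_trichotomy a.time b.time with h | h | h
  · simp [h]
  · rcases a.skip <;> rcases b.skip <;> simp [h]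
  · simp [h]

theorem before_trans (a b c : Entry p) (h₁ : Entry.before a b = true)
    (h₂ : Entry.before b c = true) : Entry.before a c = true := by
  simp only [Entry.before, Bool.or_eq_true, decide_eq_true_eq, Bool.and_eq_true] at *
  rcases h₁ with h₁ | ⟨h₁, h₁'⟩ <;> rcases h₂ with h₂ | ⟨h₂, h₂'⟩
  · exact Or.inl (h₁.trans h₂)
  · exact Or.inl (h₂ ▸ h₁)
  · exact Or.inl (h₁ ▸ h₂)
  · refine Or.inr ⟨h₁.trans h₂, ?_⟩
    rcases ha : a.skip <;> rcases hb : b.skip <;> rcases hc : c.skip <;> simp_all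

/-- Either the invariant survives all entries, which gives closedness and all entrances, or the
first cyclic entry supplies the second alternative. Soundness holds in both cases, entry by entry.
-/
theorem entranceTimes_spec (hnxt : IsNextTable X nxt) (hprv : IsPrevTable X prv) (Y : Fin p)
    (t : ℤ) : EntranceSpec G X Y t (entranceTimes G X Y t nxt prv).val := by
  rw [entranceTimes_val]
  set anc := (ancestorTimes G prv Y t).val with hanc
  obtain ⟨hvalid, hex⟩ := entries_spec (G := G) hnxt anc
  obtain ⟨hperm, hsorted⟩ := heapSort_spec before_total before_trans
    (entries G nxt (firstTimes X).val anc).val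
  set L := (heapSort Entry.before (entries G nxt (firstTimes X).val anc).val).val
  have hvalid' : ∀ e ∈ L, e.IsValid G X anc := fun e he => hvalid e (hperm.subset he)
  have hpre : ∀ pre e post, L = pre ++ e :: post → ∀ e' ∈ pre, e'.time ≤ e.time := by
    intro pre e post h e' he'
    rw [h] at hsorted
    exact before_time_le ((List.pairwise_append.1 hsorted).2.2 e' he' e (by simp))
  set σ₀ : EntranceState p := ⟨Arr.const false, Arr.const false, Arr.const none⟩
  have hinit : EntranceInv G nxt [] σ₀ := by
    constructor <;> simp [σ₀]
  have hrun : ∀ pre post, L = pre ++ post → (∀ e ∈ pre, ¬ e.IsCyclic G) →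
      EntranceInv G nxt pre (forEach pre σ₀ (entranceStep G nxt)).val := by
    intro pre post hL hc
    refine forEach_prefix_inv (fun l σ => EntranceInv G nxt l σ) _ pre σ₀ hinit ?_
    intro l e σ hl hI
    refine hI.next hnxt ?_ (hc e (hl.subset (by simp)))
    obtain ⟨m, rfl⟩ := hl
    exact hpre l e (m ++ post) (by rw [hL]; simp)
  constructor
  · refine forEach_inv (fun σ : EntranceState p => ∀ D v, σ.tNC D = some v →
      (D, v) ∉ X ∧ ∃ x ∈ X, x.2 ≤ v ∧ TransGen G.Edge x.1 D) _ L σ₀ (by simp [σ₀]) ?_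
    intro e he σ hσ D v h
    rcases entranceStep_sound h with h | ⟨h1, h2⟩
    · exact hσ D v h
    · obtain ⟨x, hx, hxt, hxE⟩ := (hvalid' e he).parent
      have h3 : e.time ≤ v ∧ (D, v) ∉ X := by
        rcases h2 with rfl | rfl
        · exact ⟨hnxt.le_nextFree _ _, hnxt.nextFree_notMem _ _⟩
        · exact ⟨by have := hnxt.le_nextFree D (e.time + 1); omega, hnxt.nextFree_notMem _ _⟩
      exact ⟨h3.2, x, hx, hxt.trans h3.1, TransGen.head' hxE h1⟩
  · by_cases hcyc : ∃ e ∈ L, e.IsCyclic G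
    · right
      obtain ⟨pre, e, post, hL, ⟨x, hs, hx⟩, hpre'⟩ := exists_first_of_exists hcyc
      have he := hvalid' e (by rw [hL]; simp)
      have hI := hrun pre (e :: post) hL hpre'
      have hxm := he.skip_mem x hs
      have hne : e.C ≠ x := by
        intro h
        exact he.notMem (by rw [h]; exact hxm.1)
      obtain ⟨k1, k2⟩ := hI.cyclic hnxt (hpre pre e post hL) hs hne
      have hpersist : ∀ D v, (entranceStep G nxt (forEach pre σ₀ (entranceStep G nxt)).val e).val.tNC
          D = some v → (forEach L σ₀ (entranceStep G nxt)).val.tNC D = some v := by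
        intro D v h
        rw [hL, forEach_append_val, forEach_cons_val]
        exact forEach_inv (fun σ : EntranceState p => σ.tNC D = some v) _ post _ h
          fun _ _ _ h => entranceStep_persist h
      obtain ⟨a, ha, hta⟩ := he.anc_le
      have hwalk := ancestorTimes_sound hprv ha
      refine ⟨e.C, e.time, x, he.notMem, hxm.1, hx, hxm.2,
        hta.trans (TimeEdgeFrom.time_le hwalk), fun hCY => ?_, fun D hD s hs hDs => ?_,
        fun D hD s hs hDs => ?_⟩
      -- The ancestor time belongs to a walk that may start later than `e.time`. Its first edge can
      -- also be taken from the earlier copy of `e.C`; an empty walk has no first edge and occurs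
      -- only for `e.C = Y`.
      · rcases ReflTransGen.cases_head hwalk with h | ⟨w, h1, h2⟩
        · exact absurd (congrArg Prod.fst h) hCY
        · exact ReflTransGen.head ⟨⟨h1.1.1, hta.trans h1.1.2⟩, he.notMem⟩ h2
      · obtain ⟨v, h1, h2⟩ := k1 D hD
        exact ⟨v, hpersist D v h1, h2.trans (hnxt.nextFree_le hs hDs)⟩
      · obtain ⟨v, h1, h2⟩ := k2 D hD
        exact ⟨v, hpersist D v h1, h2.trans (hnxt.nextFree_le hs hDs)⟩
    · left
      have hI := hrun L [] (by simp) fun e he h => hcyc ⟨e, he, h⟩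
      refine ⟨fun D v h D' hE s hs hD's => ?_, fun x hx c hc hxc hwalk => ?_⟩
      · obtain ⟨e, he, hv, hR⟩ := hI.value D v h
        obtain ⟨v', h1, h2⟩ := hI.cover e he D' (hR.trans hE)
        refine ⟨v', h1, h2.trans (hnxt.nextFree_le ?_ hD's)⟩
        have := hnxt.le_nextFree D e.time
        omega
      · obtain ⟨a, ha, hca⟩ := ancestorTimes_complete hprv hwalk
        obtain ⟨e, he, hC, hte⟩ := hex x hx c.1 hxc.1 c.2 hxc.2 hc a ha hca
        obtain ⟨v, h1, h2⟩ := hI.cover e (hperm.symm.subset he) c.1 (by rw [hC])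
        exact ⟨v, h1, h2.trans (hnxt.nextFree_le hte hc)⟩

end Entrance

end CommonAdjustment

namespace CommonAdjustment

open Relation

/-! ### Lists that follow a relation -/

section Chains

variable {W : Type*} {R : W → W → Prop}

/-- A walk from `u` to `x` contains a simple walk that starts in `q` and does not come back to
`q`, or a simple walk from `u` that avoids `q`. -/
theorem exists_branch (q : List W) {u x : W} (h : ReflTransGen R u x) :
    (∃ v ∈ q, ∃ l, (v :: l).IsChain R ∧ (v :: l).Nodup ∧ (∀ w ∈ l, w ∉ q) ∧
      (v :: l).getLast? = some x) ∨
    ∃ l, (u :: l).IsChain R ∧ (u :: l).Nodup ∧ (∀ w ∈ u :: l, w ∉ q) ∧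
      (u :: l).getLast? = some x := by
  induction h using ReflTransGen.head_induction_on with
  | refl =>
    by_cases hx : x ∈ q
    · exact Or.inl ⟨x, hx, [], by simp⟩
    · exact Or.inr ⟨[], by simp [hx]⟩
  | @head a b hab _ ih =>
    rcases ih with ih | ⟨l, h1, h2, h3, h4⟩
    · exact Or.inl ih
    · by_cases ha : a ∈ b :: l
      · obtain ⟨s, t, hst⟩ := List.append_of_mem ha
        have hsuf : a :: t <:+ b :: l := ⟨s, hst.symm⟩
        refine Or.inr ⟨t, h1.suffix hsuf, h2.sublist hsuf.sublist,
          fun w hw => h3 w (hsuf.subset hw), ?_⟩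
        rw [hst, List.getLast?_append] at h4
        simpa using h4
      · have h5 : (a :: b :: l).IsChain R := List.isChain_cons_cons.2 ⟨hab, h1⟩
        have h6 : (a :: b :: l).Nodup := List.nodup_cons.2 ⟨ha, h2⟩
        have h7 : (a :: b :: l).getLast? = some x := by
          rw [List.getLast?_cons_cons]
          exact h4
        by_cases haq : a ∈ q
        · exact Or.inl ⟨a, haq, b :: l, h5, h6, h3, h7⟩
        · refine Or.inr ⟨b :: l, h5, h6, fun w hw => ?_, h7⟩
          rcases List.mem_cons.1 hw with rfl | hw
          · exact haq
          · exact h3 w hw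

theorem exists_simple_chain {u x : W} (h : ReflTransGen R u x) :
    ∃ l, (u :: l).IsChain R ∧ (u :: l).Nodup ∧ (u :: l).getLast? = some x := by
  rcases exists_branch [] h with ⟨v, hv, -⟩ | ⟨l, h1, h2, -, h3⟩
  · simp at hv
  · exact ⟨l, h1, h2, h3⟩

theorem reflTransGen_of_isChain {v x : W} {l : List W} (h : (v :: l).IsChain R)
    (hx : (v :: l).getLast? = some x) : ReflTransGen R v x := by
  induction l generalizing v with
  | nil =>
    simp only [List.getLast?_singleton, Option.some.injEq] at hx
    rw [hx]
  | cons w l ih =>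
    rw [List.isChain_cons_cons] at h
    rw [List.getLast?_cons_cons] at hx
    exact ReflTransGen.head h.1 (ih h.2 hx)

theorem eq_or_mem_of_isChain {A : Set W} {l : List W} {z : W}
    (h : l.IsChain fun a b => R a b ∧ a ∈ A) (hz : l.getLast? = some z) :
    ∀ w ∈ l, w = z ∨ w ∈ A := by
  induction l with
  | nil => simp
  | cons a l ih =>
    intro w hw
    cases l with
    | nil =>
      simp only [List.getLast?_singleton, Option.some.injEq] at hz
      left
      rw [← hz]
      simpa using hw
    | cons b l =>
      rw [List.isChain_cons_cons] at h
      rw [List.getLast?_cons_cons] at hz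
      rcases List.mem_cons.1 hw with rfl | hw
      · exact Or.inr h.1.2
      · exact ih h.2 hz w hw

/-- A path that follows the arrows backwards and then forwards has no colliders. -/
theorem not_isCollider_of_fork (asymm : ∀ a b, R a b → ¬ R b a) {m q : List W} {v : W}
    (hm : (m ++ [v]).IsChain fun a b => R b a) (hq : (v :: q).IsChain R) (c : W) :
    ¬ IsCollider R (m ++ v :: q) c := by
  rintro ⟨a, b, hinf, ha, hb⟩
  induction m with
  | nil =>
    have h := hq.infix hinf
    simp only [List.isChain_cons_cons] at h
    exact asymm _ _ hb h.2.1
  | cons d m ih =>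
    rw [List.cons_append, List.infix_cons_iff] at hinf
    rcases hinf with ⟨s, hs⟩ | hinf
    · cases m with
      | nil =>
        simp at hs hm
        rw [hs.1, hs.2.1] at ha
        exact asymm _ _ ha hm
      | cons e m =>
        simp only [List.cons_append, List.nil_append, List.cons.injEq,
          List.isChain_cons_cons] at hs hm
        rw [hs.1, hs.2.1] at ha
        exact asymm _ _ ha hm.1
    · refine ih ?_ hinf
      rw [List.cons_append] at hm
      exact hm.suffix (List.suffix_cons _ _)

/-- On a path without repetitions a vertex determines its two neighbours, so the existential in
`IsCollider` refers to them. -/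
theorem isCollider_iff {π pre rest : List W} {a b c : W} (hπ : π.Nodup)
    (h : π = pre ++ a :: c :: b :: rest) : IsCollider R π c ↔ R a c ∧ R b c := by
  constructor
  · rintro ⟨a', b', ⟨s, t, hst⟩, ha, hb⟩
    have h1 : (s ++ [a']) ++ c :: (b' :: t) = (pre ++ [a]) ++ c :: (b :: rest) := by
      simp only [List.append_assoc, List.singleton_append] at *
      simp only [List.cons_append, List.nil_append] at *
      rw [hst, h]
    have h2 : ((s ++ [a']) ++ c :: (b' :: t)).Nodup := by
      rw [h1]
      rw [h] at hπ
      simpa using hπ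
    rw [List.nodup_append, List.nodup_cons] at h2
    rw [List.append_cons_inj_of_notMem
      (fun hc => h2.2.2 c hc c (by simp) rfl) h2.2.1.1] at h1
    have h3 := List.append_inj_right' h1.1 rfl
    simp only [List.cons.injEq, and_true] at h3
    have h4 := h1.2.2
    simp only [List.cons.injEq] at h4
    rw [← h3, ← h4.1]
    exact ⟨ha, hb⟩
  · rintro ⟨ha, hb⟩
    exact ⟨a, b, ⟨pre, rest, by rw [h]; simp⟩, ha, hb⟩

end Chains

/-! ### Candidate full-time graphs -/

section Candidates

variable {V : Type*} (E : V → V → Prop)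

/-- The full-time graph with all possible edges between different times, and with the edges at one
time that increase `r`. -/
def rankFTCG (r : V × ℤ → ℕ) : FTCG V where
  Edge a b := E a.1 b.1 ∧ (a.2 < b.2 ∨ a.2 = b.2 ∧ r a < r b)
  forward a b h := by
    rcases h.2 with h | h
    · exact h.le
    · exact h.1.le
  acyclic a h := by
    have key : ∀ b, TransGen (fun a b : V × ℤ => E a.1 b.1 ∧
        (a.2 < b.2 ∨ a.2 = b.2 ∧ r a < r b)) a b → a.2 < b.2 ∨ a.2 = b.2 ∧ r a < r b := by
      intro b hb
      induction hb with
      | single h => exact h.2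
      | tail _ h ih => have := h.2; omega
    have := key a h
    omega

/-- Edges of lag one realise every summary edge, self-loops included, whatever `r` is. The rank is
thus free to be adapted to a given walk. -/
theorem isCandidate_rankFTCG (r : V × ℤ → ℕ) : IsCandidate E (rankFTCG E r) := by
  intro A B
  constructor
  · intro h
    exact ⟨0, 1, h, Or.inl (by simp)⟩
  · rintro ⟨s, γ, h⟩
    exact h.1

variable {E}

theorem IsCandidate.timeEdge {F : FTCG V} (hF : IsCandidate E F) {a b : V × ℤ}
    (h : F.Edge a b) : TimeEdge E a b := by
  have hle := F.forward a b h
  refine ⟨(hF a.1 b.1).2 ⟨b.2, (b.2 - a.2).toNat, ?_⟩, hle⟩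
  have : b.2 - ((b.2 - a.2).toNat : ℤ) = a.2 := by omega
  rw [this]
  exact h

theorem FTCG.asymm (F : FTCG V) (a b : V × ℤ) (h : F.Edge a b) : ¬ F.Edge b a := fun h' =>
  F.acyclic a (TransGen.head h (TransGen.single h'))

/-- A simple walk with a branch is contained in some candidate. -/
theorem exists_candidate_of_branch {q l : List (V × ℤ)} {v : V × ℤ} (hq : q.IsChain (TimeEdge E))
    (hqn : q.Nodup) (hl : (v :: l).IsChain (TimeEdge E)) (hln : (v :: l).Nodup) (hv : v ∈ q)
    (hlq : ∀ w ∈ l, w ∉ q) :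
    ∃ F : FTCG V, IsCandidate E F ∧ q.IsChain F.Edge ∧ (v :: l).IsChain F.Edge := by
  classical
  -- Vertices of `q` are ranked by position and those of `l` after all of `q`, so every edge along
  -- `q`, along `l`, and from `v` into `l` increases the rank.
  set r : V × ℤ → ℕ := fun w => if w ∈ q then q.idxOf w else q.length + l.idxOf w with hr
  have hedge : ∀ a b, TimeEdge E a b → r a < r b → (rankFTCG E r).Edge a b := by
    intro a b h hab
    refine ⟨h.1, ?_⟩
    rcases h.2.lt_or_eq with h' | h'
    · exact Or.inl h'
    · exact Or.inr ⟨h', hab⟩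
  refine ⟨rankFTCG E r, isCandidate_rankFTCG E r, ?_, ?_⟩
  · rw [List.isChain_iff_getElem] at hq ⊢
    intro i hi
    refine hedge _ _ (hq i hi) ?_
    simp only [hr, List.getElem_mem, if_true]
    rw [hqn.idxOf_getElem, hqn.idxOf_getElem]
    omega
  · rw [List.isChain_iff_getElem] at hl ⊢
    intro i hi
    refine hedge _ _ (hl i hi) ?_
    have hi' : i < l.length := by simpa using hi
    have h1 : r (v :: l)[i + 1] = q.length + i := by
      rw [List.getElem_cons_succ]
      simp only [hr]
      rw [if_neg (hlq _ (List.getElem_mem hi')), (List.nodup_cons.1 hln).2.idxOf_getElem]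
    rw [h1]
    rcases i with _ | i
    · simp only [List.getElem_cons_zero, hr, hv, if_true]
      have := List.idxOf_lt_length_of_mem hv
      omega
    · rw [List.getElem_cons_succ]
      simp only [hr]
      rw [if_neg (hlq _ (List.getElem_mem (by omega))),
        (List.nodup_cons.1 hln).2.idxOf_getElem]
      omega

/-- The vertices outside `A` that are reached from an entrance to a proper causal path are
forbidden in some candidate. -/
theorem exists_candidate_mem_forb {A : Set (V × ℤ)} {x c y d : V × ℤ} (hx : x ∈ A)
    (hy : y ∉ A) (hd : d ∉ A) (hxc : TimeEdge E x c)
    (hcy : ReflTransGen (TimeEdgeFrom E Aᶜ) c y) (hcd : ReflTransGen (TimeEdgeFrom E Aᶜ) c d) :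
    ∃ F : FTCG V, IsCandidate E F ∧ d ∈ Forb F.Edge A {y} := by
  obtain ⟨l, l1, l2, l3⟩ := exists_simple_chain hcy
  have hlA : ∀ w ∈ c :: l, w ∉ A := by
    intro w hw
    rcases eq_or_mem_of_isChain l1 l3 w hw with rfl | h
    · exact hy
    · exact h
  have hq : (x :: c :: l).IsChain (TimeEdge E) :=
    List.isChain_cons_cons.2 ⟨hxc, l1.imp fun _ _ h => h.1⟩
  have hqn : (x :: c :: l).Nodup := List.nodup_cons.2 ⟨fun h => hlA x h hx, l2⟩
  -- The walk to `d` leaves the causal path for the last time at `v`. As `v ∉ A`, it is a vertex of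
  -- that path whose descendants are forbidden.
  rcases exists_branch (x :: c :: l) hcd with ⟨v, hv, m, m1, m2, m3, m4⟩ | ⟨m, -, -, m3, -⟩
  · have hvA : v ∉ A := by
      rcases eq_or_mem_of_isChain m1 m4 v (by simp) with rfl | h
      · exact hd
      · exact h
    obtain ⟨F, hF, f1, f2⟩ := exists_candidate_of_branch hq hqn (m1.imp fun _ _ h => h.1) m2 hv m3
    refine ⟨F, hF, x :: c :: l, ⟨⟨hqn, f1.imp fun _ _ h => Or.inl h⟩, ⟨x, hx, rfl⟩, ⟨y, rfl, ?_⟩,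
      hlA⟩, f1, v, hv, hvA, reflTransGen_of_isChain f2 m4⟩
    rw [List.getLast?_cons_cons]
    exact l3
  · exact absurd (by simp) (m3 c (by simp))

/-- If a vertex reaches both `x ∈ A` and `y` through vertices that no adjustment set may contain,
then there is no adjustment set. -/
theorem not_commonAdjustment_of_fork {A N Z : Set (V × ℤ)} {r x y : V × ℤ} (hNA : Disjoint N A)
    (hx : x ∈ A) (hy : y ∉ A) (hry : ReflTransGen (TimeEdgeFrom E N) r y)
    (hrx : ReflTransGen (TimeEdgeFrom E N) r x) (hZA : Disjoint Z A) (hZy : Disjoint Z {y})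
    (hZN : Disjoint Z N) : ¬ CommonAdjustmentCriterion E A {y} Z := by
  intro hcrit
  obtain ⟨l, l1, l2, l3⟩ := exists_simple_chain hry
  have hlN := eq_or_mem_of_isChain l1 l3
  rcases exists_branch (r :: l) hrx with ⟨v, hv, m, m1, m2, m3, m4⟩ | ⟨m, -, -, m3, -⟩
  swap
  · exact absurd (by simp) (m3 r (by simp))
  have hmN := eq_or_mem_of_isChain m1 m4
  have hvA : v ∉ A := by
    rcases hlN v hv with rfl | h
    · exact hy
    · exact fun h' => Set.disjoint_left.1 hNA h h'
  -- The walk to `y` is cut at `v`, where the walk to `x` finally leaves it; its two remaining parts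
  -- meet only in `v`.
  obtain ⟨s, q, hsq⟩ := List.append_of_mem hv
  have hsuf : v :: q <:+ r :: l := ⟨s, hsq.symm⟩
  have hqlast : (v :: q).getLast? = some y := by
    rw [hsq, List.getLast?_append] at l3
    simpa using l3
  obtain ⟨F, hF, f1, f2⟩ := exists_candidate_of_branch
    ((l1.suffix hsuf).imp fun _ _ h => h.1) (l2.sublist hsuf.sublist)
    (m1.imp fun _ _ h => h.1) m2 (by simp) (fun w hw hw' => m3 w hw (hsuf.subset hw'))
  -- The branch is nonempty since it ends in `A` and `v` is outside `A`. So the joined path contains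
  -- an edge pointing back towards `x` and is not causal.
  obtain ⟨b, m', rfl⟩ : ∃ b m', m = b :: m' := by
    cases m with
    | nil =>
      simp only [List.getLast?_singleton, Option.some.injEq] at m4
      exact absurd hx (m4 ▸ hvA)
    | cons b m' => exact ⟨b, m', rfl⟩
  set m := b :: m' with hm
  have hmlast : m.getLast? = some x := by
    rw [hm, List.getLast?_cons_cons] at m4
    exact m4
  have hmem : ∀ w ∈ m.reverse ++ v :: q, w = x ∨ w = y ∨ w ∈ N := by
    intro w hw
    rcases List.mem_append.1 hw with hw | hw
    · rw [List.mem_reverse] at hw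
      rcases hmN w (by simp [hw]) with h | h
      · exact Or.inl h
      · exact Or.inr (Or.inr h)
    · exact Or.inr (hlN w (hsuf.subset hw))
  have hrev : (m.reverse ++ [v]).IsChain fun a b => F.Edge b a := by
    rw [← List.reverse_cons, List.isChain_reverse]
    exact f2
  have hnodup : (m.reverse ++ v :: q).Nodup := by
    rw [List.nodup_append]
    refine ⟨List.nodup_reverse.2 (List.nodup_cons.1 m2).2, l2.sublist hsuf.sublist, ?_⟩
    rintro a ha b hb rfl
    exact m3 a (List.mem_reverse.1 ha) (hsuf.subset hb)
  have hhead : (m.reverse ++ v :: q).head? = some x := by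
    rw [List.head?_append, List.head?_reverse, hmlast]
    rfl
  have hproper : IsProperPath F.Edge A {y} (m.reverse ++ v :: q) := by
    refine ⟨⟨hnodup, ?_⟩, ⟨x, hx, hhead⟩, ⟨y, rfl, ?_⟩, fun w hw hwA => ?_⟩
    · rw [List.isChain_split]
      exact ⟨hrev.imp fun _ _ h => Or.inr h, f1.imp fun _ _ h => Or.inl h⟩
    · rw [List.getLast?_append, hqlast]
      rfl
    · rcases hmem w (List.mem_of_mem_tail hw) with rfl | rfl | h
      · obtain ⟨t, ht⟩ := List.head?_eq_some_iff.1 hhead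
        rw [ht] at hnodup hw
        exact (List.nodup_cons.1 hnodup).1 hw
      · exact hy hwA
      · exact Set.disjoint_left.1 hNA h hwA
  have hnc : ¬ IsCausal F.Edge (m.reverse ++ v :: q) := by
    intro hcausal
    have h1 : [b, v] <:+: m.reverse ++ v :: q := ⟨m'.reverse, q, by simp [hm]⟩
    have h2 := List.IsChain.infix hcausal h1
    rw [hm] at f2
    simp only [List.isChain_cons_cons] at h2 f2
    exact F.asymm _ _ h2.1 f2.1
  have hcoll := not_isCollider_of_fork F.asymm hrev f1
  -- Without colliders, only a vertex of `Z` on the path could block it, but all its vertices are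
  -- `x`, `y` or in `N`.
  rcases (hcrit F hF).2 _ hproper hnc with ⟨w, hw, -, hwZ⟩ | ⟨c, hc, -⟩
  · rcases hmem w hw with rfl | rfl | h
    · exact Set.disjoint_left.1 hZA hwZ hx
    · exact Set.disjoint_left.1 hZy hwZ rfl
    · exact Set.disjoint_left.1 hZN hwZ h
  · exact hcoll c hc

end Candidates

/-! ### Paths that are not blocked -/

section Unblocked

variable {V : Type*} {F : FTCG V} {A N : Set (V × ℤ)} {y : V × ℤ} {π : List (V × ℤ)}

/-- An open proper non-causal path gives a vertex of `N` that reaches both `A` and `y` in `N`,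
if one adjusts for all that is not in `N`. -/
theorem exists_fork_of_not_blocks (hyN : y ∈ N) (hyA : y ∉ A)
    (hclosed : ∀ u w, u ∈ N → F.Edge u w → w ∉ A → w ∈ N)
    (hπ : IsProperPath F.Edge A {y} π) (hnc : ¬ IsCausal F.Edge π)
    (hopen : ¬ Blocks F.Edge {w | w ∉ A ∧ w ∉ N ∧ w ≠ y} π) :
    ∃ r ∈ N, ∃ x ∈ A, ReflTransGen (fun a b => F.Edge a b ∧ a ∈ N) r x ∧
      ReflTransGen (fun a b => F.Edge a b ∧ a ∈ N) r y := by
  obtain ⟨⟨hnodup, hchain⟩, ⟨x, hx, hhead⟩, ⟨y', hy', hlast⟩, htail⟩ := hπ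
  rw [Set.mem_singleton_iff] at hy'
  subst y'
  simp only [Blocks, not_or, not_exists, not_and, not_forall, not_not] at hopen
  obtain ⟨hopen₁, hopen₂⟩ := hopen
  have hnotA : ∀ pre u w rest, π = pre ++ u :: w :: rest → w ∉ A := by
    intro pre u w rest h
    refine htail w ?_
    rw [h]
    cases pre <;> simp
  have hNcoll : ∀ w ∈ π, w ∉ A → ¬ IsCollider F.Edge π w → w ∈ N := by
    intro w hw hwA hwc
    by_contra hwN
    refine hopen₁ w hw hwc ⟨hwA, hwN, ?_⟩
    rintro rfl
    exact hwN hyN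
  have hadj : ∀ pre u w rest, π = pre ++ u :: w :: rest → F.Edge u w ∨ F.Edge w u := by
    intro pre u w rest h
    rw [h, List.isChain_split, List.isChain_cons_cons] at hchain
    exact hchain.2.1
  have hlast' : ∀ pre w, π = pre ++ [w] → w = y := by
    intro pre w h
    rw [h, List.getLast?_append] at hlast
    simpa using hlast
  -- A vertex entered against an arrow has an outgoing edge on the path. It is therefore not a
  -- collider, and openness puts it into `N`, unless it is the end `y`, which is in `N` anyway.
  have hN : ∀ pre u w rest, π = pre ++ u :: w :: rest → F.Edge w u → w ∈ N := by
    intro pre u w rest h hwu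
    cases rest with
    | nil => rwa [hlast' (pre ++ [u]) w (by simp [h])]
    | cons b rest =>
      refine hNcoll w (by rw [h]; simp) (hnotA _ _ _ _ h) fun hc => ?_
      rw [isCollider_iff hnodup h] at hc
      exact F.asymm _ _ hc.1 hwu
  set EN : V × ℤ → V × ℤ → Prop := fun a b => F.Edge a b ∧ a ∈ N with hEN
  -- Two statements are proved together by induction on the rest of the path. If the path goes
  -- backwards from `u`, one carries along that `u` reaches `A` in `N`. If it arrives at `u`
  -- forwards, then either a root reaching both `A` and `u` is known, or the path has been causal so
  -- far.
  have key : ∀ n, ∀ rest : List (V × ℤ), rest.length = n →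
      (∀ pre u w rest', rest = w :: rest' → π = pre ++ u :: rest → F.Edge w u →
        (∃ x ∈ A, ReflTransGen EN u x) →
        ∃ r ∈ N, ∃ x ∈ A, ReflTransGen EN r x ∧ ReflTransGen EN r y) ∧
      (∀ pre a u, π = pre ++ a :: u :: rest → F.Edge a u →
        ((∃ r ∈ N, (∃ x ∈ A, ReflTransGen EN r x) ∧ ReflTransGen EN r u) ∨
          (pre ++ [a, u]).IsChain F.Edge) →
        ∃ r ∈ N, ∃ x ∈ A, ReflTransGen EN r x ∧ ReflTransGen EN r y) := by
    intro n
    induction n using Nat.strong_induction_on with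
    | _ n ih =>
      intro rest hlen
      have back : ∀ pre u w rest', rest = w :: rest' → π = pre ++ u :: rest → F.Edge w u →
          (∃ x ∈ A, ReflTransGen EN u x) →
          ∃ r ∈ N, ∃ x ∈ A, ReflTransGen EN r x ∧ ReflTransGen EN r y := by
        rintro pre u w rest' rfl h hwu ⟨x', hx', hux⟩
        have hwN := hN pre u w rest' h hwu
        have hwx : ReflTransGen EN w x' := ReflTransGen.head ⟨hwu, hwN⟩ hux
        cases rest' with
        | nil =>
          have := hlast' (pre ++ [u]) w (by simp [h])
          subst this
          exact ⟨w, hwN, x', hx', hwx, ReflTransGen.refl⟩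
        | cons b rest' =>
          have h' : π = (pre ++ [u]) ++ w :: b :: rest' := by simp [h]
          simp only [List.length_cons] at hlen
          rcases hadj _ _ _ _ h' with hwb | hbw
          · refine (ih rest'.length (by omega) rest' rfl).2 (pre ++ [u]) w b h' hwb (Or.inl ?_)
            exact ⟨w, hwN, ⟨x', hx', hwx⟩, ReflTransGen.single ⟨hwb, hwN⟩⟩
          · exact (ih (b :: rest').length (by simp; omega) (b :: rest') rfl).1 (pre ++ [u]) w b rest'
              rfl h' hbw ⟨x', hx', hwx⟩
      refine ⟨back, ?_⟩
      intro pre a u h hau hH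
      have huA := hnotA _ _ _ _ h
      cases rest with
      | nil =>
        have := hlast' (pre ++ [a]) u (by simp [h])
        subst this
        rcases hH with ⟨r, hr, ⟨x', hx', h1⟩, h2⟩ | hH
        · exact ⟨r, hr, x', hx', h1, h2⟩
        · exact absurd (by rw [h]; exact hH) hnc
      | cons w rest =>
        have h' : π = (pre ++ [a]) ++ u :: w :: rest := by simp [h]
        have huπ : u ∈ π := by rw [h]; simp
        rcases hadj _ _ _ _ h' with huw | hwu
        · have huN : u ∈ N := by
            refine hNcoll u huπ huA fun hc => ?_
            rw [isCollider_iff hnodup h] at hc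
            exact F.asymm _ _ huw hc.2
          simp only [List.length_cons] at hlen
          refine (ih rest.length (by omega) rest rfl).2 (pre ++ [a]) u w h' huw ?_
          rcases hH with ⟨r, hr, h1, h2⟩ | hH
          · exact Or.inl ⟨r, hr, h1, h2.tail ⟨huw, huN⟩⟩
          · right
            rw [List.isChain_split]
            simp only [List.append_assoc, List.singleton_append]
            exact ⟨hH, by simpa using huw⟩
        · have hwN := hN _ _ _ _ h' hwu
          have huN := hclosed w u hwN hwu huA
          obtain ⟨d, hd, hdZ⟩ := hopen₂ u ((isCollider_iff hnodup h).2 ⟨hau, hwu⟩)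
          refine back (pre ++ [a]) u w rest rfl h' hwu ?_
          -- The collider `u` has a descendant `d` outside `N` and `A`. Since `N` is closed under
          -- edges that end outside `A`, the directed path to `d` must meet `A` on leaving `N`.
          have hreach : ∀ z, ReflTransGen F.Edge u z →
              (∃ x ∈ A, ReflTransGen EN u x) ∨ (z ∈ N ∧ ReflTransGen EN u z) := by
            intro z hz
            induction hz with
            | refl => exact Or.inr ⟨huN, ReflTransGen.refl⟩
            | @tail b c _ hbc ih =>
              rcases ih with ih | ⟨hb, ih⟩
              · exact Or.inl ih
              · have hc : ReflTransGen EN u c := ih.tail ⟨hbc, hb⟩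
                by_cases hcA : c ∈ A
                · exact Or.inl ⟨c, hcA, hc⟩
                · exact Or.inr ⟨hclosed b c hb hbc hcA, hc⟩
          exact (hreach d hd).resolve_right fun h => hdZ.2.1 h.1
  obtain ⟨rest, rfl⟩ := List.head?_eq_some_iff.1 hhead
  cases rest with
  | nil =>
    have := hlast' [] x rfl
    exact absurd (this ▸ hx) hyA
  | cons w rest =>
    rcases hadj [] x w rest rfl with h | h
    · exact (key rest.length rest rfl).2 [] x w rfl h (Or.inr (by simpa using h))
    · exact (key (w :: rest).length (w :: rest) rfl).1 [] x w rest rfl rfl h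
        ⟨x, hx, ReflTransGen.refl⟩

/-- The case without proper causal paths in which all interventions are on the series of `y`, which
lies on no cycle. -/
theorem commonAdjustment_of_not_transGen {E : V → V → Prop} (hA : ∀ x ∈ A, x.1 = y.1)
    (hyA : y ∉ A) (hcyc : ¬ TransGen E y.1 y.1) :
    CommonAdjustmentCriterion E A {y} {w | TransGen E w.1 y.1} := by
  intro F hF
  have hdesc : ∀ {u w : V × ℤ}, ReflTransGen F.Edge u w → ReflTransGen E u.1 w.1 := by
    intro u w h
    induction h with
    | refl => exact ReflTransGen.refl
    | tail _ h ih => exact ih.tail (hF.timeEdge h).1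
  constructor
  · rw [Set.disjoint_left]
    rintro d ⟨π, ⟨-, ⟨x, hx, hhead⟩, ⟨y', hy', hlast⟩, -⟩, hcausal, -⟩ -
    rw [Set.mem_singleton_iff] at hy'
    -- A causal path starts on the series of `y` and would close a cycle through it, so there is
    -- none and the forbidden set is empty.
    subst y'
    obtain ⟨rest, rfl⟩ := List.head?_eq_some_iff.1 hhead
    cases rest with
    | nil =>
      simp only [List.getLast?_singleton, Option.some.injEq] at hlast
      exact hyA (hlast ▸ hx)
    | cons w rest =>
      have hc : F.Edge x w ∧ (w :: rest).IsChain F.Edge := List.isChain_cons_cons.1 hcausal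
      rw [List.getLast?_cons_cons] at hlast
      refine hcyc (TransGen.head' (b := w.1) ?_ (hdesc (reflTransGen_of_isChain hc.2 hlast)))
      rw [← hA x hx]
      exact (hF.timeEdge hc.1).1
  · rintro π ⟨⟨hnodup, hchain⟩, ⟨x, hx, hhead⟩, ⟨y', hy', hlast⟩, htail⟩ hnc
    rw [Set.mem_singleton_iff] at hy'
    subst y'
    by_contra hopen
    simp only [Blocks, not_or, not_exists, not_and, not_forall, not_not] at hopen
    obtain ⟨hopen₁, hopen₂⟩ := hopen
    have hadj : ∀ pre u w rest, π = pre ++ u :: w :: rest → F.Edge u w ∨ F.Edge w u := by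
      intro pre u w rest h
      rw [h, List.isChain_split, List.isChain_cons_cons] at hchain
      exact hchain.2.1
    -- While the path runs forwards, its vertices descend from the series of `y`. An open collider
    -- would have a descendant that is an ancestor of `y.1`, closing a cycle; so the path never
    -- turns and is causal.
    have key : ∀ rest pre a u, π = pre ++ a :: u :: rest → F.Edge a u → TransGen E y.1 u.1 →
        (pre ++ [a, u]).IsChain F.Edge → False := by
      intro rest
      induction rest with
      | nil =>
        intro pre a u h _ _ hc
        exact hnc (by rw [h]; exact hc)
      | cons w rest ih =>
        intro pre a u h hau hyu hc
        have h' : π = (pre ++ [a]) ++ u :: w :: rest := by simp [h]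
        rcases hadj _ _ _ _ h' with huw | hwu
        · refine ih (pre ++ [a]) u w h' huw (hyu.tail (hF.timeEdge huw).1) ?_
          rw [List.isChain_split]
          simp only [List.append_assoc, List.singleton_append]
          exact ⟨hc, by simpa using huw⟩
        · obtain ⟨d, hd, hdZ⟩ := hopen₂ u ((isCollider_iff hnodup h).2 ⟨hau, hwu⟩)
          exact hcyc ((hyu.trans_left (hdesc hd)).trans hdZ)
    obtain ⟨rest, rfl⟩ := List.head?_eq_some_iff.1 hhead
    cases rest with
    | nil =>
      simp only [List.getLast?_singleton, Option.some.injEq] at hlast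
      exact hyA (hlast ▸ hx)
    | cons w rest =>
      rcases hadj [] x w rest rfl with h | h
      · refine key rest [] x w rfl h ?_ (by simpa using h)
        rw [← hA x hx]
        exact TransGen.single (hF.timeEdge h).1
      -- If the first edge points into `x`, its other end `w` is an ancestor of `y.1`, hence in the
      -- adjustment set, and not a collider.
      · refine hopen₁ w (by simp) ?_ ?_
        · rintro ⟨a, b, hinf, ha, hb⟩
          rw [List.infix_cons_iff] at hinf
          rcases hinf with ⟨s, hs⟩ | ⟨s, t, hst⟩
          · simp only [List.cons_append, List.nil_append, List.cons.injEq] at hs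
            rw [hs.1] at ha
            exact F.asymm _ _ ha h
          · have hw := (List.nodup_cons.1 hnodup).2
            rw [← hst] at hw
            cases s with
            | nil =>
              simp only [List.cons_append, List.nil_append, List.cons.injEq] at hst
              rw [hst.1] at hw
              simp at hw
            | cons e s =>
              simp only [List.cons_append, List.cons.injEq] at hst
              rw [hst.1] at hw
              simp at hw
        · change TransGen E w.1 y.1
          rw [← hA x hx]
          exact TransGen.single (hF.timeEdge h).1

end Unblocked

end CommonAdjustment

namespace CommonAdjustment

open Relation

/-! ### The outcome of the algorithm -/

section Outcome

variable {p : ℕ} (G : SCG p) (X : List (Fin p × ℤ)) (Y : Fin p) (t : ℤ)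

/-- The marks of the series that are non-conditionable or intervened on at time `t`. -/
def finalMarks (tNC : Arr (Fin p) (Option ℤ)) : Timed (Arr (Fin p) Bool) := do
  let inS ← newArr p false
  let inS ← forEach (List.finRange p) inS fun inS S => do
    let e ← tNC.get S
    if leTimes e (some t) then inS.set S true else pure inS
  forEach X inS fun inS x =>
    if x.2 = t then inS.set x.1 true else pure inS

/-- The test for directed paths. -/
def directTest (tNC : Arr (Fin p) (Option ℤ)) : Timed Bool := do
  let inS ← finalMarks X t tNC
  let vis ← newArr p false
  let r ← descendants G (fun w => inS.get w) Y vis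
  anyOf X fun x => do
    let b ← r.1.get x.1
    pure (b && decide (x.2 = t))

/-- The test for fork paths. -/
def forkTest (prv : Table p) (tNC : Arr (Fin p) (Option ℤ)) : Timed Bool := do
  let accY ← accessTimes G prv tNC (Y, t)
  let accX ← forEach X [] fun l x => do
    let a ← accessTimes G prv tNC x
    pure (a :: l)
  anyOf accX fun a =>
    anyOf (List.finRange p) fun F => do
      let e ← tNC.get F
      let s₁ ← a.get F
      let s₂ ← accY.get F
      pure (leTimes e s₁ && leTimes e s₂)

theorem decideIdentifiable_val :
    (decideIdentifiable G X Y t).val =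
      !((directTest G X Y t
          (entranceTimes G X Y t (nextTable X).val (prevTable X).val).val).val ||
        (forkTest G X Y t (prevTable X).val
          (entranceTimes G X Y t (nextTable X).val (prevTable X).val).val).val) := by
  have h : (decideIdentifiable G X Y t).val =
      (if (directTest G X Y t
          (entranceTimes G X Y t (nextTable X).val (prevTable X).val).val).val then pure false else do
        let b ← forkTest G X Y t (prevTable X).val
          (entranceTimes G X Y t (nextTable X).val (prevTable X).val).val
        pure (!b) : Timed Bool).val := rfl
  rw [h]
  split
  next h => simp [h]
  next h => simp [h]

/-- The fork test is charged even when the direct test already decides; hence an inequality. -/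
theorem decideIdentifiable_cost_le :
    (decideIdentifiable G X Y t).cost ≤
      (nextTable X).cost + (prevTable X).cost +
      (entranceTimes G X Y t (nextTable X).val (prevTable X).val).cost +
      (directTest G X Y t
          (entranceTimes G X Y t (nextTable X).val (prevTable X).val).val).cost +
      (forkTest G X Y t (prevTable X).val
          (entranceTimes G X Y t (nextTable X).val (prevTable X).val).val).cost := by
  unfold decideIdentifiable directTest forkTest finalMarks
  simp only [Timed.bind_cost, Timed.bind_val]
  split
  · simp only [Timed.pure_cost]
    omega
  · simp only [Timed.bind_cost, Timed.pure_cost]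
    omega

theorem leTimes_iff (a b : Option ℤ) :
    leTimes a b = true ↔ ∃ s s', a = some s ∧ b = some s' ∧ s ≤ s' := by
  rcases a with _ | a <;> rcases b with _ | b <;> simp [leTimes]

theorem finalMarks_val (tNC : Arr (Fin p) (Option ℤ)) (S : Fin p) :
    (finalMarks X t tNC).val S = true ↔ (∃ e, tNC S = some e ∧ e ≤ t) ∨ (S, t) ∈ X := by
  have h1 := forEach_prefix_inv (fun pre (M : Arr (Fin p) Bool) => ∀ S,
      M S = true ↔ S ∈ pre ∧ leTimes (tNC S) (some t) = true)
    (fun inS S => do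
      let e ← tNC.get S
      if leTimes e (some t) then inS.set S true else pure inS) (List.finRange p)
    (Arr.const false) (by simp) (by
      rintro pre a M - hI S
      obtain ⟨e, he⟩ : ∃ e, (tNC.get a).val = e := ⟨_, rfl⟩
      have he' : tNC a = e := he
      rw [Timed.bind_val, he]
      by_cases hl : leTimes e (some t) = true
      · rw [if_pos hl, Arr.set_val]
        by_cases hS : S = a
        · subst hS
          simp [he', hl]
        · simp [Arr.update_of_ne hS, hI S, hS]
      · rw [if_neg hl, Timed.pure_val, hI S]
        by_cases hS : S = a
        · subst hS
          simp [he', hl]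
        · simp [hS])
  simp only [List.mem_finRange, true_and] at h1
  have h2 := forEach_prefix_inv (fun pre (M : Arr (Fin p) Bool) => ∀ S,
      M S = true ↔ leTimes (tNC S) (some t) = true ∨ (S, t) ∈ pre)
    (fun inS x => if x.2 = t then inS.set x.1 true else pure inS) X _ (by simpa using h1) (by
      rintro pre a M - hI S
      by_cases ha : a.2 = t
      · rw [if_pos ha, Arr.set_val]
        by_cases hS : S = a.1
        · subst hS
          simp [← ha]
        · simp only [Arr.update_of_ne hS, hI S, List.mem_append, List.mem_singleton]
          have : (S, t) ≠ a := fun h => hS (by rw [← h])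
          simp [this]
      · rw [if_neg ha, Timed.pure_val, hI S, List.mem_append, List.mem_singleton]
        have : (S, t) ≠ a := fun h => ha (by rw [← h])
        simp [this])
  have h3 := h2 S
  rw [leTimes_iff] at h3
  refine Iff.trans h3 (or_congr_left ⟨?_, ?_⟩)
  · rintro ⟨s, s', h4, h5, h6⟩
    rw [Option.some.injEq] at h5
    exact ⟨s, h4, h5 ▸ h6⟩
  · rintro ⟨e, h4, h5⟩
    exact ⟨e, t, h4, rfl, h5⟩

theorem directTest_val (tNC : Arr (Fin p) (Option ℤ)) :
    (directTest G X Y t tNC).val = true ↔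
      ((finalMarks X t tNC).val Y = true ∧ ∃ x ∈ X, x.2 = t ∧
        ReflTransGen (fun u w => G.Edge u w ∧ (finalMarks X t tNC).val w = true) Y x.1) := by
  have h : (directTest G X Y t tNC).val = (anyOf X fun x => do
    let b ← (descendants G (fun w => (finalMarks X t tNC).val.get w) Y
      (Arr.const false)).val.1.get x.1
    pure (b && decide (x.2 = t))).val := rfl
  rw [h, anyOf_val]
  simp only [Timed.bind_val, Arr.get_val, Timed.pure_val, Bool.and_eq_true, decide_eq_true_eq]
  constructor
  · rintro ⟨x, hx, h1, h2⟩
    obtain ⟨m1, m2⟩ := descendants_mem (ok := fun w => (finalMarks X t tNC).val.get w) G Y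
      (Arr.const false)
    obtain ⟨h3, h4⟩ := m2 _ (((m1 x.1).1 h1).resolve_left (by simp))
    exact ⟨h3, x, hx, h2, h4⟩
  · rintro ⟨h1, x, hx, h2, h3⟩
    exact ⟨x, hx, descendants_reach (ok := fun w => (finalMarks X t tNC).val.get w) G
      (by simp) h1 h3, h2⟩

theorem forkTest_val (prv : Table p) (tNC : Arr (Fin p) (Option ℤ)) :
    (forkTest G X Y t prv tNC).val = true ↔ ∃ x ∈ X, ∃ F e s₁ s₂, tNC F = some e ∧
      (accessTimes G prv tNC x).val F = some s₁ ∧ e ≤ s₁ ∧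
      (accessTimes G prv tNC (Y, t)).val F = some s₂ ∧ e ≤ s₂ := by
  have hacc : ∀ a, a ∈ (forEach X [] fun l x => do
      let a ← accessTimes G prv tNC x
      pure (a :: l)).val ↔ ∃ x ∈ X, (accessTimes G prv tNC x).val = a :=
    forEach_prefix_inv (fun pre (L : List (Arr (Fin p) (Option ℤ))) => ∀ a, a ∈ L ↔
      ∃ x ∈ pre, (accessTimes G prv tNC x).val = a) _ X [] (by simp) (by
        rintro pre x L - hI a
        simp only [Timed.bind_val, Timed.pure_val, List.mem_cons, hI a, List.mem_append,
          List.not_mem_nil, or_false]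
        constructor
        · rintro (rfl | ⟨x', h1, h2⟩)
          · exact ⟨x, Or.inr rfl, rfl⟩
          · exact ⟨x', Or.inl h1, h2⟩
        · rintro ⟨x', h1 | rfl, h2⟩
          · exact Or.inr ⟨x', h1, h2⟩
          · exact Or.inl h2.symm)
  unfold forkTest
  simp only [Timed.bind_val]
  rw [anyOf_val]
  constructor
  · rintro ⟨a, ha, h⟩
    obtain ⟨x, hx, rfl⟩ := (hacc a).1 ha
    obtain ⟨F, -, h⟩ := (anyOf_val _ _).1 h
    simp only [Timed.bind_val, Arr.get_val, Timed.pure_val, Bool.and_eq_true, leTimes_iff] at h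
    obtain ⟨⟨e, s₁, h1, h2, h3⟩, ⟨e', s₂, h4, h5, h6⟩⟩ := h
    rw [h1, Option.some.injEq] at h4
    exact ⟨x, hx, F, e, s₁, s₂, h1, h2, h3, h5, h4 ▸ h6⟩
  · rintro ⟨x, hx, F, e, s₁, s₂, h1, h2, h3, h4, h5⟩
    refine ⟨_, (hacc _).2 ⟨x, hx, rfl⟩, (anyOf_val _ _).2 ⟨F, List.mem_finRange F, ?_⟩⟩
    simp only [Timed.bind_val, Arr.get_val, Timed.pure_val, Bool.and_eq_true, leTimes_iff]
    exact ⟨⟨e, s₁, h1, h2, h3⟩, ⟨e, s₂, h1, h4, h5⟩⟩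

end Outcome

/-! ### Walks -/

section Walks

variable {V : Type*} {E : V → V → Prop} {A N : Set (V × ℤ)}

theorem TimeEdgeFrom.reach {u w : V × ℤ} (h : ReflTransGen (TimeEdgeFrom E A) u w) :
    ReflTransGen E u.1 w.1 := by
  induction h with
  | refl => exact ReflTransGen.refl
  | tail _ h ih => exact ih.tail h.1.1

/-- A walk can be confined to a set that contains everything reached from its start. -/
theorem TimeEdgeFrom.confine {c r z : V × ℤ} 
    (hN : ∀ d, d ∉ A → ReflTransGen (TimeEdgeFrom E Aᶜ) c d → d ∈ N)
    (hcr : ReflTransGen (TimeEdgeFrom E Aᶜ) c r) (hrz : ReflTransGen (TimeEdgeFrom E Aᶜ) r z) :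
    ReflTransGen (TimeEdgeFrom E N) r z := by
  induction hrz with
  | refl => exact ReflTransGen.refl
  | tail h1 h2 ih => exact ih.tail ⟨h2.1, hN _ h2.2 (hcr.trans h1)⟩

/-- The start of a walk can be moved back in time. -/
theorem TimeEdgeFrom.earlier {S : V} {s s' : ℤ} {z : V × ℤ} (hs : s' ≤ s) (hS : (S, s') ∉ A)
    (h : TransGen (TimeEdgeFrom E Aᶜ) (S, s) z) : TransGen (TimeEdgeFrom E Aᶜ) (S, s') z := by
  obtain ⟨w, h1, h2⟩ := TransGen.head'_iff.1 h
  exact TransGen.head' ⟨⟨h1.1.1, hs.trans h1.1.2⟩, hS⟩ h2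

/-- The walk is cut at its first visit to its end. The times of accessibility demand this, as they
exclude the target vertex. -/
theorem TimeEdgeFrom.avoid_end {r y : V × ℤ} (hry : r ≠ y)
    (h : ReflTransGen (TimeEdgeFrom E N) r y) : TransGen (TimeEdgeFrom E (N \ {y})) r y := by
  induction h using ReflTransGen.head_induction_on with
  | refl => exact absurd rfl hry
  | @head a b hab _ ih =>
    by_cases hb : b = y
    · subst hb
      exact TransGen.single ⟨hab.1, hab.2, hry⟩
    · exact TransGen.head ⟨hab.1, hab.2, hry⟩ (ih hb)

/-- Following a walk of the summary graph at one time, one meets `A` or one stays outside `A`. -/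
theorem walk_at_time {S S' : V} (s : ℤ) (h : ReflTransGen E S S') :
    (∃ x ∈ A, ReflTransGen (TimeEdgeFrom E Aᶜ) (S, s) x) ∨
      ReflTransGen (TimeEdgeFrom E Aᶜ) (S, s) (S', s) := by
  induction h with
  | refl => exact Or.inr ReflTransGen.refl
  | @tail b c _ hbc ih =>
    rcases ih with ih | ih
    · exact Or.inl ih
    · by_cases hb : (b, s) ∈ A
      · exact Or.inl ⟨_, hb, ih⟩
      · exact Or.inr (ih.tail ⟨⟨hbc, le_rfl⟩, hb⟩)

/-- A vertex that descends from an intervention descends from one outside `A`. -/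
theorem exists_entrance {x : V × ℤ} (hx : x ∈ A) {D : V} {s : ℤ} (hxs : x.2 ≤ s)
    (hD : (D, s) ∉ A) (h : TransGen E x.1 D) :
    ∃ x' ∈ A, ∃ c, c ∉ A ∧ TimeEdge E x' c ∧ ReflTransGen (TimeEdgeFrom E Aᶜ) c (D, s) := by
  induction h with
  | @single b h => exact ⟨x, hx, (b, s), hD, ⟨h, hxs⟩, ReflTransGen.refl⟩
  | @tail b c _ hbc ih =>
    by_cases hb : (b, s) ∈ A
    · exact ⟨(b, s), hb, (c, s), hD, ⟨hbc, le_rfl⟩, ReflTransGen.refl⟩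
    · obtain ⟨x', hx', c', hc', h1, h2⟩ := ih hb
      exact ⟨x', hx', c', hc', h1, h2.tail ⟨⟨hbc, le_rfl⟩, hb⟩⟩

/-- Since `c` reaches `y` by way of `r`, everything reached from `c` outside `A` is forbidden in
some candidate. So `Z` avoids this set, inside which `r` reaches both `x` and `y`. -/
theorem not_isIdentifiable_of_root {x' c r x y : V × ℤ} (hx' : x' ∈ A) (hx'c : TimeEdge E x' c)
    (hcr : ReflTransGen (TimeEdgeFrom E Aᶜ) c r) (hx : x ∈ A) (hy : y ∉ A)
    (hrx : ReflTransGen (TimeEdgeFrom E Aᶜ) r x) (hry : ReflTransGen (TimeEdgeFrom E Aᶜ) r y) :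
    ¬ IsIdentifiable E A {y} := by
  rintro ⟨Z, hZA, hZy, hcrit⟩
  set N : Set (V × ℤ) := {d | d ∉ A ∧ ReflTransGen (TimeEdgeFrom E Aᶜ) c d} with hN
  have hN' : ∀ d, d ∉ A → ReflTransGen (TimeEdgeFrom E Aᶜ) c d → d ∈ N := fun d h1 h2 => ⟨h1, h2⟩
  refine not_commonAdjustment_of_fork (N := N) (Set.disjoint_left.2 fun d hd => hd.1) hx hy
    (TimeEdgeFrom.confine hN' hcr hry) (TimeEdgeFrom.confine hN' hcr hrx) hZA hZy
    (Set.disjoint_left.2 fun d hdZ hd => ?_) hcrit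
  obtain ⟨F, hF, hdF⟩ := exists_candidate_mem_forb hx' hy hd.1 hx'c (hcr.trans hry) hd.2
  exact Set.disjoint_left.1 (hcrit F hF).1 hdF hdZ

end Walks

/-! ### Correctness -/

section Correctness

variable {p : ℕ} {G : SCG p} {X : List (Fin p × ℤ)} {Y : Fin p} {t : ℤ}
  {T : Arr (Fin p) (Option ℤ)} {prv : Table p}

/-- The non-conditionable set given by the entrance times `T`. -/
def ncSet (X : List (Fin p × ℤ)) (T : Arr (Fin p) (Option ℤ)) : Set (Fin p × ℤ) :=
  {u | u ∉ X ∧ ∃ e, T u.1 = some e ∧ e ≤ u.2}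

theorem accessSet_eq (v : Fin p × ℤ) : accessSet X T v = ncSet X T \ {v} := by
  ext u
  simp only [accessSet, ncSet, Set.mem_ofPred_eq, Set.mem_sdiff, Set.mem_singleton_iff]
  tauto

/-- The algorithm finds all forks in the non-conditionable set. -/
theorem tests_of_fork (hprv : IsPrevTable X prv) (hXt : ∀ x ∈ X, x.2 ≤ t)
    {r x : Fin p × ℤ} (hr : r ∈ ncSet X T) (hx : x ∈ X)
    (hrx : ReflTransGen (TimeEdgeFrom G.Edge (ncSet X T)) r x)
    (hry : ReflTransGen (TimeEdgeFrom G.Edge (ncSet X T)) r (Y, t)) :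
    (directTest G X Y t T).val = true ∨ (forkTest G X Y t prv T).val = true := by
  by_cases hrY : r = (Y, t)
  · left
    subst hrY
    rw [directTest_val]
    obtain ⟨-, e, he, het⟩ := hr
    -- A walk from `Y_t` to an intervention at time at most `t` never leaves time `t`, so its series
    -- are all marked for the direct test.
    have key : ∀ z, ReflTransGen (TimeEdgeFrom G.Edge (ncSet X T)) (Y, t) z → z.2 ≤ t →
        (z ∈ ncSet X T ∨ z ∈ X) →
        ReflTransGen (fun u w => G.Edge u w ∧ (finalMarks X t T).val w = true) Y z.1 := by
      intro z hz
      induction hz with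
      | refl => exact fun _ _ => ReflTransGen.refl
      | @tail b c hb hbc ih =>
        intro hct hc
        refine (ih (hbc.1.2.trans hct) (Or.inl hbc.2)).tail ⟨hbc.1.1, ?_⟩
        rw [finalMarks_val]
        rcases hc with ⟨-, e', he', hle⟩ | hc
        · exact Or.inl ⟨e', he', hle.trans hct⟩
        · right
          have h1 := TimeEdgeFrom.time_le hb
          have h2 := hbc.1.2
          have : c.2 = t := by simp only at h1; omega
          rwa [← this]
    exact ⟨(finalMarks_val X t T Y).2 (Or.inl ⟨e, he, het⟩), x, hx,
      le_antisymm (hXt x hx) (TimeEdgeFrom.time_le hrx), key x hrx (hXt x hx) (Or.inr hx)⟩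
  · right
    rw [forkTest_val]
    obtain ⟨hrX, e, he, hle⟩ := hr
    have hrx' := TimeEdgeFrom.avoid_end (y := x) (fun h => hrX (by rwa [h])) hrx
    have hry' := TimeEdgeFrom.avoid_end hrY hry
    rw [← accessSet_eq] at hrx' hry'
    obtain ⟨s₁, h1, h2⟩ := accessTimes_complete hprv hrx'
    obtain ⟨s₂, h3, h4⟩ := accessTimes_complete hprv hry'
    exact ⟨x, hx, r.1, e, s₁, s₂, he, h1, hle.trans h2, h3, hle.trans h4⟩

/-- The root is `Y_t` itself. The walk found by the test is followed at time `t` up to the first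
intervention it meets, and soundness of the entrance time of `Y` gives an entrance that reaches
`Y_t`. -/
theorem not_isIdentifiable_of_directTest (hT : EntranceSpec G X Y t T) (hY : (Y, t) ∉ X)
    (h : (directTest G X Y t T).val = true) : ¬ IsIdentifiable G.Edge {x | x ∈ X} {(Y, t)} := by
  rw [directTest_val, finalMarks_val] at h
  obtain ⟨h1, x, hx, hxt, hreach⟩ := h
  obtain ⟨e, he, het⟩ := h1.resolve_right hY
  obtain ⟨-, x₀, hx₀, hx₀e, hx₀Y⟩ := hT.sound Y e he
  obtain ⟨x', hx', c, -, hx'c, hcY⟩ := exists_entrance (A := {x | x ∈ X}) hx₀ (hx₀e.trans het) hY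
    hx₀Y
  have hreach' : ReflTransGen G.Edge Y x.1 := ReflTransGen.mono (fun _ _ h => h.1) _ _ hreach
  obtain ⟨x'', hx'', hYx⟩ : ∃ x'' ∈ {x | x ∈ X},
      ReflTransGen (TimeEdgeFrom G.Edge {x | x ∈ X}ᶜ) (Y, t) x'' := by
    rcases walk_at_time (A := {x | x ∈ X}) t hreach' with h | h
    · exact h
    · exact ⟨x, hx, by rwa [← hxt] at h ⊢⟩
  exact not_isIdentifiable_of_root hx' hx'c hcY hx'' hY hYx ReflTransGen.refl

/-- The walks to the intervention and to `Y_t` may leave `F` at different times. Both can be started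
at the common earlier time `e`, at which `F` is free, and this vertex is the root. -/
theorem not_isIdentifiable_of_forkTest (hprv : IsPrevTable X prv) (hT : EntranceSpec G X Y t T)
    (hY : (Y, t) ∉ X) (h : (forkTest G X Y t prv T).val = true) :
    ¬ IsIdentifiable G.Edge {x | x ∈ X} {(Y, t)} := by
  rw [forkTest_val] at h
  obtain ⟨x, hx, F, e, s₁, s₂, he, h1, h2, h3, h4⟩ := h
  obtain ⟨hFe, x₀, hx₀, hx₀e, hx₀F⟩ := hT.sound F e he
  obtain ⟨x', hx', c, -, hx'c, hcF⟩ := exists_entrance (A := {x | x ∈ X}) hx₀ hx₀e hFe hx₀F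
  have hsub : ∀ v, accessSet X T v ⊆ {x | x ∈ X}ᶜ := fun v u hu => hu.1
  have hwalk : ∀ v s, (accessTimes G prv T v).val F = some s → e ≤ s →
      ReflTransGen (TimeEdgeFrom G.Edge {x | x ∈ X}ᶜ) (F, e) v := by
    intro v s hs hes
    exact (TimeEdgeFrom.earlier (A := {x | x ∈ X}) hes hFe
      (TransGen.mono (fun _ _ h => h.mono (hsub v)) _ _
        (accessTimes_sound hprv hs))).to_reflTransGen
  exact not_isIdentifiable_of_root hx' hx'c hcF hx hY (hwalk x s₁ h1 h2) (hwalk _ s₂ h3 h4)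

/-- If the entrance times come from a cyclic entry, the algorithm detects a fork. -/
theorem tests_of_cyclic (hprv : IsPrevTable X prv) (hXt : ∀ x ∈ X, x.2 ≤ t) {C x : Fin p} {τ : ℤ}
    (hC : (C, τ) ∉ X) (hx : (x, τ) ∈ X) (hCx : ReflTransGen G.Edge C x) (hxC : G.Edge x C)
    (hτ : τ ≤ t) (hY : (Y, t) ∉ X)
    (hCY : C ≠ Y → ReflTransGen (TimeEdgeFrom G.Edge {u | u ∉ X}) (C, τ) (Y, t))
    (h₁ : ∀ D, ReflTransGen (fun u w => G.Edge u w ∧ w ≠ x) C D → ∀ s, τ ≤ s → (D, s) ∉ X →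
      ∃ v, T D = some v ∧ v ≤ s)
    (h₂ : ∀ D, ReflTransGen G.Edge C D → ∀ s, τ + 1 ≤ s → (D, s) ∉ X →
      ∃ v, T D = some v ∧ v ≤ s) :
    (directTest G X Y t T).val = true ∨ (forkTest G X Y t prv T).val = true := by
  set A : Set (Fin p × ℤ) := {x | x ∈ X} with hA
  -- As long as time stays `τ`, a walk outside the interventions cannot visit `x`, because `(x, τ)`
  -- is one. It therefore stays in the graph without `x`, where the bound at time `τ` applies; later
  -- times are covered by `h₂`.
  have hreach : ∀ z, ReflTransGen (TimeEdgeFrom G.Edge Aᶜ) (C, τ) z → z ∉ A → z.2 = τ →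
      ReflTransGen (fun u w => G.Edge u w ∧ w ≠ x) C z.1 := by
    intro z hz
    induction hz with
    | refl => exact fun _ _ => ReflTransGen.refl
    | @tail b c hb hbc ih =>
      intro hcA hcτ
      have h3 := TimeEdgeFrom.time_le hb
      have h4 := hbc.1.2
      simp only at h3
      refine (ih hbc.2 (by omega)).tail ⟨hbc.1.1, ?_⟩
      intro hcx
      refine hcA ?_
      rw [show c = (x, τ) from Prod.ext hcx hcτ]
      exact hx
  have hN : ∀ d, d ∉ A → ReflTransGen (TimeEdgeFrom G.Edge Aᶜ) (C, τ) d → d ∈ ncSet X T := by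
    intro d hd hcd
    refine ⟨hd, ?_⟩
    have h3 := TimeEdgeFrom.time_le hcd
    rcases h3.lt_or_eq with h4 | h4
    · exact h₂ d.1 (TimeEdgeFrom.reach hcd) d.2 h4 hd
    · exact h₁ d.1 (hreach d hcd hd h4.symm) d.2 h3 hd
  have hroot : ReflTransGen (TimeEdgeFrom G.Edge Aᶜ) (C, τ) (Y, t) →
      (directTest G X Y t T).val = true ∨ (forkTest G X Y t prv T).val = true := by
    intro hwalk
    obtain ⟨x', hx', hCx'⟩ : ∃ x' ∈ A, ReflTransGen (TimeEdgeFrom G.Edge Aᶜ) (C, τ) x' := by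
      rcases walk_at_time (A := A) τ hCx with h | h
      · exact h
      · exact ⟨_, hx, h⟩
    exact tests_of_fork hprv hXt (hN _ hC ReflTransGen.refl) hx'
      (TimeEdgeFrom.confine hN ReflTransGen.refl hCx')
      (TimeEdgeFrom.confine hN ReflTransGen.refl hwalk)
  by_cases hCY' : C = Y
  · subst hCY'
    -- No walk from `(C, τ)` to `(Y, t)` is given for `C = Y`. One follows the cycle through `x` at
    -- time `t`: it either meets an intervention, and `Y_t` is a root, or closes up at `Y_t`, and
    -- its first edge can then be taken from `(C, τ)`.
    rcases hτ.lt_or_eq with hlt | rfl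
    · have hN' : ∀ d, d ∉ A → ReflTransGen (TimeEdgeFrom G.Edge Aᶜ) (C, t) d → d ∈ ncSet X T := by
        intro d hd hcd
        have h3 := TimeEdgeFrom.time_le hcd
        simp only at h3
        exact ⟨hd, h₂ d.1 (TimeEdgeFrom.reach hcd) d.2 (by omega) hd⟩
      have hhit : (∃ x' ∈ A, ReflTransGen (TimeEdgeFrom G.Edge Aᶜ) (C, t) x') →
          (directTest G X C t T).val = true ∨ (forkTest G X C t prv T).val = true := by
        rintro ⟨x', hx', hx''⟩
        exact tests_of_fork hprv hXt (hN' _ hY ReflTransGen.refl) hx'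
          (TimeEdgeFrom.confine hN' ReflTransGen.refl hx'') ReflTransGen.refl
      rcases walk_at_time (A := A) t hCx with h | h
      · exact hhit h
      · by_cases hxt : (x, t) ∈ A
        · exact hhit ⟨_, hxt, h⟩
        · have hcycle : TransGen (TimeEdgeFrom G.Edge Aᶜ) (C, t) (C, t) :=
            TransGen.tail' h ⟨⟨hxC, le_rfl⟩, hxt⟩
          exact hroot (TimeEdgeFrom.earlier hτ hC hcycle).to_reflTransGen
    · exact hroot ReflTransGen.refl
  · exact hroot (hCY hCY')

/-- Negative tests rule out the cyclic alternative, so `N` is closed and contains all entrances. If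
an entrance exists, everything outside `N`, the interventions and `Y_t` is an adjustment set;
otherwise the ancestors of `Y`, or the empty set if nothing is intervened on. -/
theorem isIdentifiable_of_tests (hprv : IsPrevTable X prv) (hT : EntranceSpec G X Y t T)
    (hY : (Y, t) ∉ X) (hXt : ∀ x ∈ X, x.2 ≤ t) (hXY : ∀ x ∈ X, Y ∈ Desc G.Edge x.1)
    (h : ¬ ((directTest G X Y t T).val = true ∨ (forkTest G X Y t prv T).val = true)) :
    IsIdentifiable G.Edge {x | x ∈ X} {(Y, t)} := by
  set A : Set (Fin p × ℤ) := {x | x ∈ X} with hA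
  rcases hT.alternative with ⟨hclosed, henter⟩ |
    ⟨C, τ, x, hC, hx, hCx, hxC, hτ, hCY, h₁, h₂⟩
  swap
  · exact absurd (tests_of_cyclic hprv hXt hC hx hCx hxC hτ hY hCY h₁ h₂) h
  by_cases hent : ∃ x ∈ A, ∃ c, c ∉ A ∧ TimeEdge G.Edge x c ∧
      ReflTransGen (TimeEdgeFrom G.Edge Aᶜ) c (Y, t)
  · set N := ncSet X T with hN
    have hstep : ∀ u w, u ∈ N → ReflTransGen G.Edge u.1 w.1 → u.2 ≤ w.2 → w ∉ A → w ∈ N := by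
      rintro u w ⟨-, e, he, hle⟩ huw hle' hw
      exact ⟨hw, hclosed u.1 e he w.1 huw w.2 (hle.trans hle') hw⟩
    have hin : ∀ x ∈ A, ∀ c, c ∉ A → TimeEdge G.Edge x c →
        ReflTransGen (TimeEdgeFrom G.Edge Aᶜ) c (Y, t) → c ∈ N :=
      fun x hx c hc hxc hcY => ⟨hc, henter x hx c hc hxc hcY⟩
    have hyN : (Y, t) ∈ N := by
      obtain ⟨x, hx, c, hc, hxc, hcY⟩ := hent
      exact hstep c _ (hin x hx c hc hxc hcY) (TimeEdgeFrom.reach hcY)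
        (TimeEdgeFrom.time_le hcY) hY
    refine ⟨{w | w ∉ A ∧ w ∉ N ∧ w ≠ (Y, t)}, Set.disjoint_left.2 fun w hw => hw.1,
      Set.disjoint_left.2 fun w hw => hw.2.2, fun F hF => ⟨?_, fun π hπ hnc => ?_⟩⟩
    · rw [Set.disjoint_left]
      rintro d ⟨π, ⟨⟨hnodup, -⟩, ⟨x, hx, hhead⟩, ⟨y', hy', hlast⟩, htail⟩, hcausal, w, hw, hwA, hwd⟩
        hdZ
      rw [Set.mem_singleton_iff] at hy'
      subst y'
      obtain ⟨rest, rfl⟩ := List.head?_eq_some_iff.1 hhead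
      have hw' : w ∈ rest := (List.mem_cons.1 hw).resolve_left fun h => hwA (h ▸ hx)
      cases rest with
      | nil => simp at hw'
      | cons c rest =>
        have hc : F.Edge x c ∧ (c :: rest).IsChain F.Edge := List.isChain_cons_cons.1 hcausal
        rw [List.getLast?_cons_cons] at hlast
        have hchainA : (c :: rest).IsChain (TimeEdgeFrom G.Edge Aᶜ) := by
          rw [List.isChain_iff_getElem]
          intro i hi
          exact ⟨hF.timeEdge (List.isChain_iff_getElem.1 hc.2 i hi),
            htail _ (List.getElem_mem _)⟩
        have hcN : c ∈ N := hin x hx c (htail c (by simp)) (hF.timeEdge hc.1)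
          (reflTransGen_of_isChain hchainA hlast)
        have hcw : ReflTransGen F.Edge c w := by
          obtain ⟨s, q, hsq⟩ := List.append_of_mem hw'
          have h1 : (s ++ [w]).IsChain F.Edge := by
            have := hc.2
            rw [hsq, List.isChain_split] at this
            exact this.1
          cases s with
          | nil =>
            simp only [List.nil_append, List.cons.injEq] at hsq
            rw [hsq.1]
          | cons e s =>
            simp only [List.cons_append, List.cons.injEq] at hsq
            rw [hsq.1]
            exact reflTransGen_of_isChain (l := s ++ [w]) h1 (by
              rw [← List.cons_append]; exact List.getLast?_concat)
        have hreach : ∀ z, ReflTransGen F.Edge c z →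
            ReflTransGen G.Edge c.1 z.1 ∧ c.2 ≤ z.2 := by
          intro z hz
          induction hz with
          | refl => exact ⟨ReflTransGen.refl, le_rfl⟩
          | tail _ h ih => exact ⟨ih.1.tail (hF.timeEdge h).1, ih.2.trans (hF.timeEdge h).2⟩
        have hd := hreach d (hcw.trans hwd)
        exact hdZ.2.1 (hstep c d hcN hd.1 hd.2 hdZ.1)
    · by_contra hopen
      obtain ⟨r, hr, x, hx, hrx, hry⟩ := exists_fork_of_not_blocks hyN hY
        (fun u w hu huw hw => hstep u w hu (ReflTransGen.single (hF.timeEdge huw).1)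
          (hF.timeEdge huw).2 hw) hπ hnc hopen
      exact h (tests_of_fork hprv hXt hr hx
        (ReflTransGen.mono (fun _ _ h => ⟨hF.timeEdge h.1, h.2⟩) _ _ hrx)
        (ReflTransGen.mono (fun _ _ h => ⟨hF.timeEdge h.1, h.2⟩) _ _ hry))
  -- Without entrances no nonempty summary walk leads from an intervened series to `Y`. As `Y`
  -- descends from each of them, they all coincide with `Y`.
  · have hnot : ∀ x ∈ A, ¬ TransGen G.Edge x.1 Y := by
      intro x hx hxY
      obtain ⟨x', hx', c, hc, h1, h2⟩ := exists_entrance hx (hXt x hx) hY hxY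
      exact hent ⟨x', hx', c, hc, h1, h2⟩
    have heq : ∀ x ∈ A, x.1 = Y := by
      intro x hx
      rcases reflTransGen_iff_eq_or_transGen.1 (hXY x hx) with h | h
      · exact h.symm
      · exact absurd h (hnot x hx)
    by_cases hne : ∃ x, x ∈ A
    · obtain ⟨x₀, hx₀⟩ := hne
      have hcyc : ¬ TransGen G.Edge Y Y := by
        have := hnot x₀ hx₀
        rwa [heq x₀ hx₀] at this
      refine ⟨{w | TransGen G.Edge w.1 Y}, Set.disjoint_left.2 fun w hw hwA => hnot w hwA hw,
        Set.disjoint_left.2 fun w hw hwY => ?_,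
        commonAdjustment_of_not_transGen (y := (Y, t)) heq hY hcyc⟩
      rw [Set.mem_singleton_iff] at hwY
      subst hwY
      exact hcyc hw
    · refine ⟨∅, Set.empty_disjoint _, Set.empty_disjoint _, fun F _ =>
        ⟨Set.disjoint_empty _, fun π hπ => ?_⟩⟩
      obtain ⟨x, hx, -⟩ := hπ.2.1
      exact absurd ⟨x, hx⟩ hne

theorem isIdentifiable_iff (G : SCG p) (X : List (Fin p × ℤ)) (Y : Fin p) (t : ℤ)
    (hY : (Y, t) ∉ X) (hXt : ∀ x ∈ X, x.2 ≤ t) (hXY : ∀ x ∈ X, Y ∈ Desc G.Edge x.1) :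
    IsIdentifiable G.Edge {x | x ∈ X} {(Y, t)} ↔ (decideIdentifiable G X Y t).val = true := by
  have hprv := isPrevTable_prevTable X
  have hT := entranceTimes_spec (G := G) (isNextTable_nextTable X) hprv Y t
  rw [decideIdentifiable_val, Bool.not_eq_true', Bool.or_eq_false_iff]
  constructor
  · intro h
    constructor
    · by_contra hc
      exact not_isIdentifiable_of_directTest hT hY (by simpa using hc) h
    · by_contra hc
      exact not_isIdentifiable_of_forkTest hprv hT hY (by simpa using hc) h
  · rintro ⟨h1, h2⟩
    exact isIdentifiable_of_tests hprv hT hY hXt hXY (by rw [h1, h2]; simp)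

end Correctness

end CommonAdjustment

namespace CommonAdjustment

/-! ### Running time -/

section EdgeCount

variable {p : ℕ} (G : SCG p)

theorem sum_length_ch : ∑ v, (G.ch v).length = G.numEdges := by
  have h : ∀ v, (G.ch v).length = ∑ w, if G.Edge v w then 1 else 0 := by
    intro v
    rw [← Finset.card_filter, ← List.toFinset_card_of_nodup (G.ch_nodup v)]
    congr 1
    ext w
    rw [List.mem_toFinset, Finset.mem_filter]
    exact ⟨fun h => ⟨Finset.mem_univ _, h⟩, fun h => h.2⟩
  simp only [h, SCG.numEdges, Finset.card_filter, ← Finset.univ_product_univ,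
    Finset.sum_product]

theorem sum_length_pa : ∑ v, (G.pa v).length = G.numEdges := by
  have h : ∀ v, (G.pa v).length = ∑ u, if G.Edge u v then 1 else 0 := by
    intro v
    rw [← Finset.card_filter, ← List.toFinset_card_of_nodup (G.pa_nodup v)]
    congr 1
    ext w
    rw [List.mem_toFinset, Finset.mem_filter, G.mem_pa]
    exact ⟨fun h => ⟨Finset.mem_univ _, h⟩, fun h => h.2⟩
  simp only [h, SCG.numEdges, Finset.card_filter, ← Finset.univ_product_univ,
    Finset.sum_product]
  exact Finset.sum_comm

theorem sum_affine (a b : ℕ) (f : Fin p → ℕ) : ∑ v, (a + b * f v) = a * p + b * ∑ v, f v := by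
  rw [Finset.sum_add_distrib, ← Finset.mul_sum]
  simp [mul_comm]

end EdgeCount

theorem forEach_cost_sum {α σ : Type} (c : α → ℕ) (f : σ → α → Timed σ) (l : List α) (s : σ)
    (hs : ∀ a s, (f s a).cost ≤ c a) :
    (forEach l s f).cost ≤ (l.map fun a => c a + 1).sum := by
  induction l generalizing s with
  | nil => simp
  | cons a l ih =>
    have h1 := hs a s
    have h2 := ih (f s a).val
    rw [forEach_cons_cost, List.map_cons, List.sum_cons]
    omega

/-! ### Cost of the tables -/

section TableCost

variable {p : ℕ} (X : List (Fin p × ℤ))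

theorem nextTable_cost_le :
    (nextTable X).cost ≤ X.length * (3 * Nat.log 2 (X.length + 1) + 9) + 1 := by
  unfold nextTable
  simp only [Timed.bind_cost, newTable_cost]
  have h1 := heapSort_cost_le (fun a b : Fin p × ℤ => decide (b.2 ≤ a.2)) X
  have h2 := (heapSort_spec (α := Fin p × ℤ) (before := fun a b => decide (b.2 ≤ a.2))
    (fun x y => by simpa using le_total y.2 x.2)
    (fun x y z h₁ h₂ => by simp only [decide_eq_true_eq] at *; omega) X).1.length_eq
  have h3 := forEach_cost_le 2 (fun (T : Table p) x => do
    let r ← T.get (x.1, x.2 + 1)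
    T.set x (some (r.getD (x.2 + 1))))
    (heapSort (fun a b : Fin p × ℤ => decide (b.2 ≤ a.2)) X).val (newTable p).val
    (fun a _ s => by simp)
  rw [h2] at h3
  calc _ ≤ _ := add_le_add h1 (add_le_add_right h3 1)
    _ = _ := by ring

theorem prevTable_cost_le :
    (prevTable X).cost ≤ X.length * (3 * Nat.log 2 (X.length + 1) + 9) + 1 := by
  unfold prevTable
  simp only [Timed.bind_cost, newTable_cost]
  have h1 := heapSort_cost_le (fun a b : Fin p × ℤ => decide (a.2 ≤ b.2)) X
  have h2 := (heapSort_spec (α := Fin p × ℤ) (before := fun a b => decide (a.2 ≤ b.2))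
    (fun x y => by simpa using le_total x.2 y.2)
    (fun x y z h₁ h₂ => by simp only [decide_eq_true_eq] at *; omega) X).1.length_eq
  have h3 := forEach_cost_le 2 (fun (T : Table p) x => do
    let r ← T.get (x.1, x.2 - 1)
    T.set x (some (r.getD (x.2 - 1))))
    (heapSort (fun a b : Fin p × ℤ => decide (a.2 ≤ b.2)) X).val (newTable p).val
    (fun a _ s => by simp)
  rw [h2] at h3
  calc _ ≤ _ := add_le_add h1 (add_le_add_right h3 1)
    _ = _ := by ring

end TableCost

/-! ### Cost of the backward searches -/

section SearchCost

variable {p : ℕ} (G : SCG p) (best : Fin p → ℤ → Timed (Option ℤ))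

theorem card_le_potential (σ : SearchState p) : σ.queue.elems.card ≤ σ.potential 1 := by
  simp [SearchState.potential]

theorem relax_leftist {s : ℤ} {σ : SearchState p} {P : Fin p} (h : σ.queue.Leftist) :
    (relax best s σ P).val.queue.Leftist := by
  rcases hs : σ.seen P with _ | _
  · rcases hb : (best P s).val with _ | τ
    · rw [relax_val_of_none best hs hb]
      exact h
    · rw [relax_val_of_some best hs hb]
      exact h.insert _ _
  · rw [relax_val_of_seen best hs]
    exact h

theorem relax_cost_le {B M : ℕ} (hB : ∀ P s, (best P s).cost ≤ B) {s : ℤ} {σ : SearchState p}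
    {P : Fin p} (h : σ.queue.Leftist) (hM : σ.potential 1 ≤ M) :
    (relax best s σ P).cost ≤ B + Nat.log 2 (M + 1) + 5 := by
  have h1 := hB P s
  unfold relax
  rw [Timed.bind_cost, Arr.get_cost, Arr.get_val]
  split
  · simp only [Timed.pure_cost]
    omega
  · simp only [Timed.bind_cost, Arr.set_cost]
    rcases hb : (best P s).val with _ | τ
    · simp only [Timed.pure_cost]
      omega
    · have h2 := Heap.insert_cost_le later (P, τ) h ((card_le_potential σ).trans hM)
      simp only [Timed.bind_cost, Timed.pure_cost]
      omega

/-- The weight of a series covers popping it and treating its parents, the logarithms being bounded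
through the unit-weight potential `M`, which dominates the size of the queue. The final `3` pays for
finding the queue empty. -/
theorem search_cost_le {B M : ℕ} (hB : ∀ P s, (best P s).cost ≤ B) (k : ℕ) (σ : SearchState p)
    (hσ : σ.queue.Leftist) (hM : σ.potential 1 ≤ M) :
    (search G best k σ).cost ≤ σ.potential (fun P =>
      (2 * Nat.log 2 (M + 1) + 3) + (B + Nat.log 2 (M + 1) + 6) * (G.pa P).length) + 3 := by
  set w : Fin p → ℕ := fun P =>
      (2 * Nat.log 2 (M + 1) + 3) + (B + Nat.log 2 (M + 1) + 6) * (G.pa P).length with hw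
  induction k generalizing σ with
  | zero => simp [search]
  | succ k ih =>
    rw [search_succ]
    simp only [Timed.bind_cost, step_cost]
    rcases hp : (σ.queue.pop later).val with _ | ⟨u, Q⟩
    · have h0 := (Heap.pop_eq_none _ _).1 hp
      have h1 := Heap.pop_cost_le later hσ (n := 0) (by rw [h0]; simp)
      simp only [zero_add, Nat.log_one_right] at h1
      simp only [Timed.pure_cost]
      omega
    · have h1 := Heap.pop_cost_le later hσ ((card_le_potential σ).trans hM)
      have hpot := potential_of_pop (w := w) hp
      have hM' : (⟨Q, σ.seen, σ.val⟩ : SearchState p).potential 1 ≤ M := by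
        have := potential_of_pop (w := 1) hp
        omega
      obtain ⟨⟨h2, h3⟩, h4⟩ := forEach_cost
        (fun σ : SearchState p => σ.queue.Leftist ∧ σ.potential 1 ≤ M)
        (fun σ => σ.potential w) (B + Nat.log 2 (M + 1) + 5) (relax best u.2) (G.pa u.1)
        ⟨Q, σ.seen, σ.val⟩ ⟨hσ.of_pop hp, hM'⟩ (by
          rintro P - s ⟨hs1, hs2⟩
          exact ⟨⟨relax_leftist best hs1, (relax_potential_le best 1 _ _ _).trans hs2⟩,
            add_le_add (relax_cost_le best hB hs1 hs2) (relax_potential_le best w _ _ _)⟩)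
      have h5 := ih _ h2 h3
      have hwu : w u.1 = (2 * Nat.log 2 (M + 1) + 3) +
          (G.pa u.1).length * (B + Nat.log 2 (M + 1) + 5 + 1) := by
        simp only [hw]
        ring
      simp only [Timed.bind_cost]
      omega

/-- The factor `2` is due to the start vertex, whose series may be unseen and thus enter the queue a
second time. -/
theorem potential_init_le (w : Fin p → ℕ) (Q : Heap (Fin p × ℤ)) (v : Fin p × ℤ)
    (hQ : Q.elems = {v}) (seen : Arr (Fin p) Bool) (val : Arr (Fin p) (Option ℤ)) :
    (⟨Q, seen, val⟩ : SearchState p).potential w ≤ 2 * ∑ P, w P := by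
  simp only [SearchState.potential, hQ, Multiset.map_singleton, Multiset.sum_singleton]
  have h1 : (∑ P, if seen P then 0 else w P) ≤ ∑ P, w P :=
    Finset.sum_le_sum fun P _ => by split <;> simp
  have h2 : w v.1 ≤ ∑ P, w P := Finset.single_le_sum (fun _ _ => Nat.zero_le _)
    (Finset.mem_univ v.1)
  omega

theorem search_init_cost_le (hB : ∀ P s, (best P s).cost ≤ 3) (v : Fin p × ℤ)
    (seen : Arr (Fin p) Bool) (val : Arr (Fin p) (Option ℤ)) :
    (search G best (p + 2) ⟨(Heap.leaf.insert later v).val, seen, val⟩).cost ≤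
      (4 * Nat.log 2 (p + 3) + 18) * (p + G.numEdges) + 3 := by
  have hQ : (Heap.leaf.insert later v).val.elems = {v} := by simp [Heap.elems_insert]
  have hl : (Heap.leaf.insert later v).val.Leftist :=
    Heap.Leftist.insert (h := Heap.leaf) later v trivial
  have h1 := search_cost_le G best hB (p + 2) ⟨(Heap.leaf.insert later v).val, seen, val⟩ hl
    (potential_one_le _ v hQ seen val)
  have h2 := potential_init_le (fun P => (2 * Nat.log 2 (p + 2 + 1) + 3) +
    (3 + Nat.log 2 (p + 2 + 1) + 6) * (G.pa P).length) _ v hQ seen val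
  rw [sum_affine, sum_length_pa] at h2
  refine (h1.trans (add_le_add_left h2 3)).trans ?_
  rw [show p + 2 + 1 = p + 3 from rfl]
  nlinarith [Nat.zero_le (Nat.log 2 (p + 3) * G.numEdges), Nat.zero_le p]

theorem insert_leaf_cost_le (v : Fin p × ℤ) : (Heap.leaf.insert later v).cost ≤ 2 := by
  simpa using Heap.insert_cost_le later v (h := Heap.leaf) trivial (n := 0) (by simp)

theorem ancestorTimes_cost_le (prv : Table p) (Y : Fin p) (t : ℤ) :
    (ancestorTimes G prv Y t).cost ≤
      (4 * Nat.log 2 (p + 3) + 18) * (p + G.numEdges) + 2 * p + 9 := by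
  have h1 := insert_leaf_cost_le (Y, t)
  have h2 := search_init_cost_le G (fun P s => do
    let τ ← free prv P s
    pure (some τ)) (fun P s => by simp) (Y, t) ((Arr.const false).update Y true)
    ((Arr.const none).update Y (some t))
  unfold ancestorTimes
  simp only [Timed.bind_cost, newArr_cost, Arr.set_cost, newArr_val, Arr.set_val]
  omega

theorem accessTimes_cost_le (prv : Table p) (tNC : Arr (Fin p) (Option ℤ)) (v : Fin p × ℤ) :
    (accessTimes G prv tNC v).cost ≤
      (4 * Nat.log 2 (p + 3) + 18) * (p + G.numEdges) + 2 * p + 9 := by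
  have h1 := insert_leaf_cost_le v
  have h2 := search_init_cost_le G (accessBest prv tNC v) (accessBest_cost_le prv tNC v) v
    (Arr.const false) (Arr.const none)
  have h3 : (accessTimes G prv tNC v).cost = (Heap.leaf.insert later v).cost + ((p + 1) + ((p + 1) +
      (search G (accessBest prv tNC v) (p + 2) ⟨(Heap.leaf.insert later v).val, Arr.const false,
        Arr.const none⟩).cost)) := rfl
  omega

end SearchCost

/-! ### Amortized cost of the forward searches -/

section ExploreCost

variable {p : ℕ} (G : SCG p) {ok : Fin p → Timed Bool}

/-- The amount of work that a series causes in the forward searches. -/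
def exploreWeight (v : Fin p) : ℕ := 9 + 4 * (G.ch v).length

/-- The work that is left for the forward searches. -/
def unmarkedWeight (vis : Arr (Fin p) Bool) : ℕ := ∑ P, if vis P then 0 else exploreWeight G P

theorem unmarkedWeight_le (vis : Arr (Fin p) Bool) :
    unmarkedWeight G vis ≤ 9 * p + 4 * G.numEdges := by
  rw [← sum_length_ch G, ← sum_affine]
  exact Finset.sum_le_sum fun P _ => by split <;> simp [exploreWeight]

theorem enter_cost_le (hok : ∀ w, (ok w).cost ≤ 1) (σ : List (Fin p) × Arr (Fin p) Bool)
    (w : Fin p) : (enter ok σ w).cost ≤ 3 := by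
  have := hok w
  unfold enter
  simp only [Timed.bind_cost, Arr.get_cost]
  split
  · simp only [Timed.pure_cost]
    omega
  · simp only [Timed.bind_cost, Arr.set_cost, Timed.pure_cost]
    omega

theorem stackPotential_exploreWeight (stack : List (Fin p)) (vis : Arr (Fin p) Bool) :
    stackPotential (exploreWeight G) (stack, vis) =
      (stack.map (exploreWeight G)).sum + unmarkedWeight G vis := rfl

/-- Expanding a vertex costs `1` plus `4` per child. The remaining `8` of its weight `9 + 4 * (G.ch
v).length` stay as a credit on the returned list, to pay for setting the entrance times later. -/
theorem explore_cost_le (hok : ∀ w, (ok w).cost ≤ 1) (k : ℕ) (stack : List (Fin p))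
    (vis : Arr (Fin p) Bool) (acc : List (Fin p)) :
    (explore G ok k stack vis acc).cost + 8 * (explore G ok k stack vis acc).val.2.length +
      unmarkedWeight G (explore G ok k stack vis acc).val.1 ≤
      1 + 8 * acc.length + stackPotential (exploreWeight G) (stack, vis) := by
  induction k generalizing stack vis acc with
  | zero =>
    rw [stackPotential_exploreWeight]
    simp only [explore, Timed.pure_cost, Timed.pure_val]
    omega
  | succ k ih =>
    cases stack with
    | nil =>
      rw [stackPotential_exploreWeight]
      simp [explore]
    | cons v stack =>
      rw [explore_cons]
      simp only [Timed.bind_cost, Timed.bind_val, step_cost]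
      have h1 := forEach_cost_le 3 (enter ok) (G.ch v) (stack, vis)
        fun w _ σ => enter_cost_le hok σ w
      have h2 := ih (forEach (G.ch v) (stack, vis) (enter ok)).val.1
        (forEach (G.ch v) (stack, vis) (enter ok)).val.2 (v :: acc)
      have h3 := forEach_enter_potential ok (exploreWeight G) (G.ch v) (stack, vis)
      rw [Prod.mk.eta, h3, List.length_cons] at h2
      have h4 : stackPotential (exploreWeight G) (v :: stack, vis) =
          9 + 4 * (G.ch v).length + stackPotential (exploreWeight G) (stack, vis) := by
        simp only [stackPotential, List.map_cons, List.sum_cons, exploreWeight]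
        ring
      omega

theorem descendants_cost_le (hok : ∀ w, (ok w).cost ≤ 1) (C : Fin p) (vis : Arr (Fin p) Bool) :
    (descendants G ok C vis).cost + 8 * (descendants G ok C vis).val.2.length +
      unmarkedWeight G (descendants G ok C vis).val.1 ≤ 4 + unmarkedWeight G vis := by
  have h0 := hok C
  by_cases h : vis C = false ∧ (ok C).val = true
  · have h1 := explore_cost_le G hok (p + 1) [C] (vis.update C true) []
    have h2 := sum_unmarked_update (exploreWeight G) vis C h.1
    rw [descendants_val_of G h.1 h.2]
    have h3 : (descendants G ok C vis).cost = 1 + ((ok C).cost + (1 +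
        (explore G ok (p + 1) [C] (vis.update C true) []).cost)) := by
      unfold descendants
      simp [h.1, h.2]
    simp only [stackPotential, List.map_singleton, List.sum_singleton, List.length_nil] at h1
    simp only [unmarkedWeight] at h1 ⊢
    omega
  · rw [descendants_val_of_not G h]
    have h3 : (descendants G ok C vis).cost = 1 + (ok C).cost := by
      unfold descendants
      rcases h1 : vis C <;> rcases h2 : (ok C).val <;> simp_all
    simp only [List.length_nil]
    omega

theorem assign_cost_le (nxt : Table p) (s : ℤ) (ds : List (Fin p)) (T : Arr (Fin p) (Option ℤ)) :
    (assign nxt s ds T).cost ≤ ds.length * 4 := by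
  refine forEach_cost_le 3 _ ds T fun D _ T' => ?_
  rw [Timed.bind_cost, Arr.get_cost, Arr.get_val]
  rcases T' D with _ | v
  · simp
  · simp

/-- Marks persist from entry to entry, so all searches together are paid once from the unmarked
weight. Each entry adds at most two fixed costs of `4`. -/
theorem entranceStep_cost_le (nxt : Table p) (σ : EntranceState p) (e : Entry p) :
    (entranceStep G nxt σ e).cost +
      (unmarkedWeight G (entranceStep G nxt σ e).val.vis₁ +
        unmarkedWeight G (entranceStep G nxt σ e).val.vis₂) ≤
      8 + (unmarkedWeight G σ.vis₁ + unmarkedWeight G σ.vis₂) := by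
  have h2 := descendants_cost_le G (ok := fun _ => pure true) (by simp) e.C σ.vis₂
  rcases hs : e.skip with _ | x
  · have h3 := assign_cost_le nxt e.time
      (descendants G (fun _ => pure true) e.C σ.vis₂).val.2 σ.tNC
    rw [entranceStep_of_none hs]
    have h4 : (entranceStep G nxt σ e).cost =
        (descendants G (fun _ => pure true) e.C σ.vis₂).cost + ((assign nxt e.time
          (descendants G (fun _ => pure true) e.C σ.vis₂).val.2 σ.tNC).cost + 0) := by
      unfold entranceStep
      rw [hs]
      rfl
    simp only
    omega
  · have h1 := descendants_cost_le G (ok := fun w => pure (decide (w ≠ x))) (by simp) e.C σ.vis₁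
    have h3 := assign_cost_le nxt e.time
      (descendants G (fun w => pure (decide (w ≠ x))) e.C σ.vis₁).val.2 σ.tNC
    have h3' := assign_cost_le nxt (e.time + 1)
      (descendants G (fun _ => pure true) e.C σ.vis₂).val.2 (assign nxt e.time
      (descendants G (fun w => pure (decide (w ≠ x))) e.C σ.vis₁).val.2 σ.tNC).val
    rw [entranceStep_of_some hs]
    have h4 : (entranceStep G nxt σ e).cost =
        (descendants G (fun w => pure (decide (w ≠ x))) e.C σ.vis₁).cost + ((assign nxt e.time
      (descendants G (fun w => pure (decide (w ≠ x))) e.C σ.vis₁).val.2 σ.tNC).cost +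
        ((descendants G (fun _ => pure true) e.C σ.vis₂).cost + ((assign nxt (e.time + 1)
      (descendants G (fun _ => pure true) e.C σ.vis₂).val.2 (assign nxt e.time
      (descendants G (fun w => pure (decide (w ≠ x))) e.C σ.vis₁).val.2 σ.tNC).val).cost + 0))) := by
      unfold entranceStep
      rw [hs]
      rfl
    simp only
    omega

end ExploreCost

/-! ### Cost of the entrance times -/

section EntranceCost

variable {p : ℕ} (G : SCG p) (X : List (Fin p × ℤ)) (nxt prv : Table p)

theorem firstTimes_cost_le : (firstTimes X).cost ≤ p + 1 + X.length * 3 := by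
  unfold firstTimes
  simp only [Timed.bind_cost, newArr_cost]
  exact add_le_add_right (forEach_cost_le 2 _ X _ fun x _ A => by simp) _

theorem entryStep_cost_le (first anc : Arr (Fin p) (Option ℤ)) (L : List (Entry p)) (C : Fin p) :
    (entryStep G nxt first anc L C).cost ≤ 2 + 4 * (G.pa C).length := by
  have h1 := forEach_cost_le 1 (fun m x => do
    let r ← first.get x
    pure (optMin m r)) (G.pa C) none (fun x _ m => by simp)
  unfold entryStep
  simp only [Timed.bind_cost, Arr.get_cost, Arr.get_val]
  generalize (forEach (G.pa C) none fun m x => do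
    let r ← first.get x
    pure (optMin m r)).val = o
  rcases o with _ | tmin
  · simp only [Timed.pure_cost]
    omega
  · rcases anc C with _ | a
    · simp only [Timed.pure_cost]
      omega
    · simp only [Timed.bind_cost, free_cost]
      split
      · simp only [Timed.pure_cost]
        omega
      · have h2 := forEach_cost_le 1 (fun l x => do
          let r ← nxt.get (x, (free nxt C tmin).val)
          pure (if r.isSome then x :: l else l)) (G.pa C) [] (fun x _ m => by simp)
        simp only [Timed.bind_cost, Timed.pure_cost] at h2 ⊢
        omega

theorem entryStep_length_le (first anc : Arr (Fin p) (Option ℤ)) (L : List (Entry p))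
    (C : Fin p) : (entryStep G nxt first anc L C).val.length ≤ L.length + 1 := by
  unfold entryStep
  simp only [Timed.bind_val, Arr.get_val]
  generalize (forEach (G.pa C) none fun m x => do
    let r ← first.get x
    pure (optMin m r)).val = o
  rcases o with _ | tmin
  · simp
  · rcases anc C with _ | a
    · simp
    · simp only [Timed.bind_val]
      split
      · simp
      · simp

theorem entries_cost_le (first anc : Arr (Fin p) (Option ℤ)) :
    (entries G nxt first anc).cost ≤ 3 * p + 4 * G.numEdges := by
  rw [entries_eq]
  refine (forEach_cost_sum (fun C => 2 + 4 * (G.pa C).length) _ _ _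
    fun C L => entryStep_cost_le G nxt first anc L C).trans ?_
  rw [← sum_length_pa G, ← sum_affine, ← List.ofFn_eq_map, List.sum_ofFn]
  exact Finset.sum_le_sum fun C _ => by omega

theorem entries_length_le (first anc : Arr (Fin p) (Option ℤ)) :
    (entries G nxt first anc).val.length ≤ p := by
  rw [entries_eq]
  have h := forEach_prefix_inv (fun pre (L : List (Entry p)) => L.length ≤ pre.length)
    (entryStep G nxt first anc) (List.finRange p) [] le_rfl (by
      rintro pre C L - hI
      have := entryStep_length_le G nxt first anc L C
      simp only [List.length_append, List.length_singleton]
      omega)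
  simpa using h

theorem entranceTimes_cost_le (Y : Fin p) (t : ℤ) :
    (entranceTimes G X Y t nxt prv).cost ≤
      X.length * 3 + (7 * Nat.log 2 (p + 3) + 61) * (p + G.numEdges) + 13 := by
  have h1 := ancestorTimes_cost_le G prv Y t
  have h2 := firstTimes_cost_le X
  set anc := (ancestorTimes G prv Y t).val with hanc
  have h3 := entries_cost_le G nxt (firstTimes X).val anc
  have h4 := entries_length_le G nxt (firstTimes X).val anc
  set L := (entries G nxt (firstTimes X).val anc).val with hL
  have h5 := heapSort_cost_le Entry.before L
  have h6 := (heapSort_spec before_total before_trans L).1.length_eq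
  have h7 := (forEach_cost (fun _ : EntranceState p => True)
    (fun σ => unmarkedWeight G σ.vis₁ + unmarkedWeight G σ.vis₂) 8 (entranceStep G nxt)
    (heapSort Entry.before L).val ⟨Arr.const false, Arr.const false, Arr.const none⟩ trivial
    fun e _ σ _ => ⟨trivial, entranceStep_cost_le G nxt σ e⟩).2
  have h8 := unmarkedWeight_le G (Arr.const false)
  have h9 : (entranceTimes G X Y t nxt prv).cost = (ancestorTimes G prv Y t).cost +
      ((firstTimes X).cost + ((entries G nxt (firstTimes X).val anc).cost +
      ((heapSort Entry.before L).cost + ((p + 1) + ((p + 1) + ((p + 1) +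
      ((forEach (heapSort Entry.before L).val
        (⟨Arr.const false, Arr.const false, Arr.const none⟩ : EntranceState p)
        (entranceStep G nxt)).cost + 0))))))) := rfl
  have h10 : Nat.log 2 (L.length + 1) ≤ Nat.log 2 (p + 3) := Nat.log_mono_right (by omega)
  have h11 : L.length * (3 * Nat.log 2 (L.length + 1) + 6) ≤ p * (3 * Nat.log 2 (p + 3) + 6) :=
    Nat.mul_le_mul h4 (by omega)
  rw [h6] at h7
  have h12 : L.length * (8 + 1) ≤ p * 9 := Nat.mul_le_mul_right 9 h4
  have h13 : (entranceTimes G X Y t nxt prv).cost ≤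
      ((4 * Nat.log 2 (p + 3) + 18) * (p + G.numEdges) + 2 * p + 9) + (p + 1 + X.length * 3) +
      (3 * p + 4 * G.numEdges) + p * (3 * Nat.log 2 (p + 3) + 6) + 3 * (p + 1) +
      (p * 9 + 2 * (9 * p + 4 * G.numEdges)) := by
    simp only at h7
    omega
  refine h13.trans ?_
  nlinarith [Nat.zero_le (Nat.log 2 (p + 3) * G.numEdges)]

end EntranceCost

/-! ### The total cost and its form with real logarithms -/

section TotalCost

variable {p : ℕ} (G : SCG p) (X : List (Fin p × ℤ)) (Y : Fin p) (t : ℤ)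

theorem finalMarks_cost_le (tNC : Arr (Fin p) (Option ℤ)) :
    (finalMarks X t tNC).cost ≤ 4 * p + 1 + X.length * 2 := by
  have h1 := forEach_cost_le 2 (fun (inS : Arr (Fin p) Bool) S => do
    let e ← tNC.get S
    if leTimes e (some t) then inS.set S true else pure inS) (List.finRange p) (newArr p false).val
    (fun S _ M => by
      rw [Timed.bind_cost, Arr.get_cost]
      split
      · simp
      · simp)
  have h2 := forEach_cost_le 1 (fun (inS : Arr (Fin p) Bool) (x : Fin p × ℤ) =>
    if x.2 = t then inS.set x.1 true else pure inS) X (forEach (List.finRange p)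
      (newArr p false).val fun (inS : Arr (Fin p) Bool) S => do
    let e ← tNC.get S
    if leTimes e (some t) then inS.set S true else pure inS).val (fun x _ M => by
      split
      · simp
      · simp)
  unfold finalMarks
  rw [List.length_finRange] at h1
  simp only [Timed.bind_cost, newArr_cost] at h1 h2 ⊢
  omega

theorem directTest_cost_le (tNC : Arr (Fin p) (Option ℤ)) :
    (directTest G X Y t tNC).cost ≤ X.length * 4 + 14 * (p + G.numEdges) + 6 := by
  have h1 := finalMarks_cost_le X t tNC
  have h2 := descendants_cost_le G (ok := fun w => (finalMarks X t tNC).val.get w) (by simp) Y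
    (Arr.const false)
  have h3 := unmarkedWeight_le G (Arr.const false)
  have h4 := anyOf_cost_le 1 X (fun x => do
    let b ← (descendants G (fun w => (finalMarks X t tNC).val.get w) Y
      (Arr.const false)).val.1.get x.1
    pure (b && decide (x.2 = t))) (fun x _ => by simp)
  have h5 : (directTest G X Y t tNC).cost = (finalMarks X t tNC).cost + ((p + 1) +
      ((descendants G (fun w => (finalMarks X t tNC).val.get w) Y (Arr.const false)).cost +
        (anyOf X (fun x => do
    let b ← (descendants G (fun w => (finalMarks X t tNC).val.get w) Y
      (Arr.const false)).val.1.get x.1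
    pure (b && decide (x.2 = t)))).cost)) := rfl
  omega

theorem forkTest_cost_le (prv : Table p) (tNC : Arr (Fin p) (Option ℤ)) :
    (forkTest G X Y t prv tNC).cost ≤ (X.length + 1) *
      ((4 * Nat.log 2 (p + 3) + 24) * (p + G.numEdges) + 11) := by
  set c := (4 * Nat.log 2 (p + 3) + 18) * (p + G.numEdges) + 2 * p + 9 with hc
  have h1 := accessTimes_cost_le G prv tNC (Y, t)
  have h2 := forEach_cost_le c (fun l x => do
    let a ← accessTimes G prv tNC x
    pure (a :: l)) X [] (fun x _ l => by
      simpa using accessTimes_cost_le G prv tNC x)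
  have h3 := forEach_prefix_inv
    (fun pre (L : List (Arr (Fin p) (Option ℤ))) => L.length = pre.length)
    (fun l x => do
      let a ← accessTimes G prv tNC x
      pure (a :: l)) X [] rfl (by
        rintro pre x L - hI
        simp [hI])
  have h4 := anyOf_cost_le (p * 4) (forEach X [] fun l x => do
    let a ← accessTimes G prv tNC x
    pure (a :: l)).val (fun a => anyOf (List.finRange p) fun F => do
      let e ← tNC.get F
      let s₁ ← a.get F
      let s₂ ← (accessTimes G prv tNC (Y, t)).val.get F
      pure (leTimes e s₁ && leTimes e s₂)) (fun a _ => by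
        have := anyOf_cost_le 3 (List.finRange p) (fun F => do
          let e ← tNC.get F
          let s₁ ← a.get F
          let s₂ ← (accessTimes G prv tNC (Y, t)).val.get F
          pure (leTimes e s₁ && leTimes e s₂)) (fun F _ => by simp)
        rwa [List.length_finRange] at this)
  rw [h3] at h4
  have h5 : (forkTest G X Y t prv tNC).cost ≤ c + (X.length * (c + 1) + X.length * (p * 4 + 1)) := by
    unfold forkTest
    simp only [Timed.bind_cost] at *
    omega
  have h6 : c + (p * 4 + 2) ≤ (4 * Nat.log 2 (p + 3) + 24) * (p + G.numEdges) + 11 := by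
    rw [hc]
    nlinarith [Nat.zero_le (Nat.log 2 (p + 3)), Nat.zero_le G.numEdges]
  calc _ ≤ _ := h5
    _ ≤ (X.length + 1) * (c + (p * 4 + 2)) := by nlinarith [Nat.zero_le p]
    _ ≤ _ := Nat.mul_le_mul_left _ h6

theorem decideIdentifiable_cost_le_nat (hp : 1 ≤ p) (hX : 1 ≤ X.length) :
    (decideIdentifiable G X Y t).cost ≤ 200 * (X.length * (Nat.log 2 (X.length + 1) +
      (Nat.log 2 (p + 3) + 1) * (p + G.numEdges))) := by
  have h0 := decideIdentifiable_cost_le G X Y t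
  have h1 := nextTable_cost_le X
  have h2 := prevTable_cost_le X
  have h3 := entranceTimes_cost_le G X (nextTable X).val (prevTable X).val Y t
  set T := (entranceTimes G X Y t (nextTable X).val (prevTable X).val).val
  have h4 := directTest_cost_le G X Y t T
  have h5 := forkTest_cost_le G X Y t (prevTable X).val T
  obtain ⟨n, hn⟩ : ∃ n, n = X.length := ⟨_, rfl⟩
  obtain ⟨a, ha⟩ : ∃ a, a = Nat.log 2 (X.length + 1) := ⟨_, rfl⟩
  obtain ⟨b, hb⟩ : ∃ b, b = Nat.log 2 (p + 3) := ⟨_, rfl⟩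
  obtain ⟨S, hS⟩ : ∃ S, S = p + G.numEdges := ⟨_, rfl⟩
  rw [← ha, ← hn] at h1 h2
  rw [← hn, ← hb, ← hS] at h3 h5
  rw [← hn, ← hS] at h4
  rw [← ha, ← hb, ← hn, ← hS]
  rw [← hn] at hX
  have hS1 : 1 ≤ S := by omega
  have e1 : S ≤ n * S := Nat.le_mul_of_pos_left S hX
  have e2 : n ≤ n * S := Nat.le_mul_of_pos_right n hS1
  have e3 : b * S ≤ n * (b * S) := Nat.le_mul_of_pos_left _ hX
  have e4 : 1 ≤ n * S := Nat.mul_pos hX hS1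
  -- Everything is expanded into the monomials `n * a`, `n * (b * S)` and `n * S`, which dominate
  -- all others since `n` and `S` are at least `1`.
  have hexp : 200 * (n * (a + (b + 1) * S)) = 200 * (n * a) + 200 * (n * (b * S)) + 200 * (n * S) := by
    ring
  have h1' : n * (3 * a + 9) + 1 = 3 * (n * a) + 9 * n + 1 := by ring
  have h3' : n * 3 + (7 * b + 61) * S + 13 = 3 * n + 7 * (b * S) + 61 * S + 13 := by ring
  have h5' : (n + 1) * ((4 * b + 24) * S + 11) =
      4 * (n * (b * S)) + 24 * (n * S) + 11 * n + 4 * (b * S) + 24 * S + 11 := by ring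
  rw [h1'] at h1 h2
  rw [h3'] at h3
  rw [h5'] at h5
  rw [hexp]
  omega

/-- The factor `2` is a convenient bound for `1 / Real.log 2`. -/
theorem natLog_le_two_mul_log {m : ℕ} (hm : 1 ≤ m) : (Nat.log 2 m : ℝ) ≤ 2 * Real.log m := by
  have h1 : (2 : ℝ) ^ (Nat.log 2 m) ≤ m := by
    exact_mod_cast Nat.pow_log_le_self 2 (by omega)
  have h2 := Real.log_le_log (by positivity) h1
  rw [Real.log_pow] at h2
  have h3 := Real.log_two_gt_d9
  have h4 : (0 : ℝ) ≤ Nat.log 2 m := Nat.cast_nonneg _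
  nlinarith

theorem decideIdentifiable_cost_le_real (hX : X ≠ []) :
    ((decideIdentifiable G X Y t).cost : ℝ) ≤
      10000 * (1 + X.length * (Real.log X.length + (G.numEdges + p) * Real.log p)) := by
  have hp : 1 ≤ p := Y.pos
  have hn : 1 ≤ X.length := List.length_pos_iff.2 hX
  have h1 : ((decideIdentifiable G X Y t).cost : ℝ) ≤ 200 * (X.length *
      ((Nat.log 2 (X.length + 1) : ℝ) + ((Nat.log 2 (p + 3) : ℝ) + 1) * (p + G.numEdges))) := by
    exact_mod_cast decideIdentifiable_cost_le_nat G X Y t hp hn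
  have hE : (G.numEdges : ℝ) ≤ p * p := by
    have : G.numEdges ≤ p * p := by
      refine (Finset.card_filter_le _ _).trans ?_
      simp
    exact_mod_cast this
  have hE0 : (0 : ℝ) ≤ G.numEdges := Nat.cast_nonneg _
  have hpR : (1 : ℝ) ≤ p := by exact_mod_cast hp
  have hnR : (1 : ℝ) ≤ X.length := by exact_mod_cast hn
  have hlog2 : Real.log 2 < 0.7 := by have := Real.log_two_lt_d9; linarith
  have hlog2' : (0.69 : ℝ) < Real.log 2 := by have := Real.log_two_gt_d9; linarith
  have ha : (Nat.log 2 (X.length + 1) : ℝ) ≤ 2 + 2 * Real.log X.length := by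
    have h2 := natLog_le_two_mul_log (m := X.length + 1) (by omega)
    have h3 : Real.log ((X.length + 1 : ℕ) : ℝ) ≤ Real.log (2 * X.length) :=
      Real.log_le_log (by positivity) (by push_cast; linarith)
    rw [Real.log_mul (by norm_num) (by positivity)] at h3
    linarith
  have hb : (Nat.log 2 (p + 3) : ℝ) ≤ 3 + 2 * Real.log p := by
    have h2 := natLog_le_two_mul_log (m := p + 3) (by omega)
    have h3 : Real.log ((p + 3 : ℕ) : ℝ) ≤ Real.log (2 ^ 2 * p) :=
      Real.log_le_log (by positivity) (by push_cast; linarith)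
    rw [Real.log_mul (by norm_num) (by positivity), Real.log_pow] at h3
    push_cast at h2 h3
    linarith
  have hlogn : 0 ≤ Real.log X.length := Real.log_nonneg hnR
  have hlogp : 0 ≤ Real.log p := Real.log_nonneg hpR
  set n : ℝ := (X.length : ℝ) with hndef
  set S : ℝ := (p : ℝ) + G.numEdges with hS
  have hS1 : 1 ≤ S := by linarith
  have hsum : (G.numEdges : ℝ) + p = S := by rw [hS]; ring
  rw [hsum]
  have h2 : ((decideIdentifiable G X Y t).cost : ℝ) ≤
      200 * (n * (2 + 2 * Real.log n + (4 + 2 * Real.log p) * S)) := by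
    refine h1.trans ?_
    have : ((Nat.log 2 (p + 3) : ℝ) + 1) * S ≤ (4 + 2 * Real.log p) * S :=
      mul_le_mul_of_nonneg_right (by linarith) (by linarith)
    have : n * ((Nat.log 2 (X.length + 1) : ℝ) + ((Nat.log 2 (p + 3) : ℝ) + 1) * S) ≤
        n * (2 + 2 * Real.log n + (4 + 2 * Real.log p) * S) :=
      mul_le_mul_of_nonneg_left (by linarith) (by linarith)
    linarith
  refine h2.trans ?_
  -- For `p ≥ 2` the factor `Real.log p > 0.69` absorbs the constants. For `p = 1` it vanishes, but
  -- then `S ≤ 2` and only a cost of order `n + n * Real.log n` is left.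
  rcases hp.lt_or_eq with hp2 | hp1
  · have hlp : (0.69 : ℝ) < Real.log p := hlog2'.trans_le
      (Real.log_le_log (by norm_num) (by exact_mod_cast hp2))
    have h3 : 2 + (4 + 2 * Real.log p) * S ≤ 20 * (S * Real.log p) := by
      have h4 : S * 0.69 ≤ S * Real.log p := mul_le_mul_of_nonneg_left hlp.le (by linarith)
      nlinarith
    have h4 : n * (2 + 2 * Real.log n + (4 + 2 * Real.log p) * S) ≤
        n * (20 * (Real.log n + S * Real.log p)) :=
      mul_le_mul_of_nonneg_left (by linarith) (by linarith)
    have h5 : 0 ≤ n * (Real.log n + S * Real.log p) := by positivity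
    nlinarith
  · have hp1' : (p : ℝ) = 1 := by exact_mod_cast hp1.symm
    have hS2 : S ≤ 2 := by
      rw [hS, hp1']
      rw [hp1'] at hE
      linarith
    have hlp : Real.log (p : ℝ) = 0 := by rw [hp1', Real.log_one]
    rw [hlp]
    have h3 : n * (2 + 2 * Real.log n + (4 + 2 * 0) * S) ≤ n * (10 + 2 * Real.log n) :=
      mul_le_mul_of_nonneg_left (by linarith) (by linarith)
    -- The summand `1` of the bound is needed exactly here, for `n = 1`, where the logarithm
    -- vanishes too.
    have h4 : n ≤ 1 + 2 * (n * Real.log n) := by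
      rcases hn.lt_or_eq with hn2 | hn1
      · have hln : (0.69 : ℝ) < Real.log n := hlog2'.trans_le
          (Real.log_le_log (by norm_num) (by rw [hndef]; exact_mod_cast hn2))
        nlinarith
      · have : n = 1 := by rw [hndef]; exact_mod_cast hn1.symm
        rw [this]
        simp
    have h5 : 0 ≤ n * Real.log n := by positivity
    nlinarith

end TotalCost

end CommonAdjustment

theorem mainTheorem3 :
    (∀ (p : ℕ) (G : CommonAdjustment.SCG p) (X : List (Fin p × ℤ)) (Y : Fin p) (t : ℤ),
      X.Nodup → (Y, t) ∉ X → (∀ x ∈ X, x.2 ≤ t) →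
      (∀ x ∈ X, Y ∈ CommonAdjustment.Desc G.Edge x.1) →
      (CommonAdjustment.IsIdentifiable G.Edge {x | x ∈ X} {(Y, t)} ↔
        (CommonAdjustment.decideIdentifiable G X Y t).val = true)) ∧
    ∃ K : ℝ, ∀ (p : ℕ) (G : CommonAdjustment.SCG p) (X : List (Fin p × ℤ)) (Y : Fin p) (t : ℤ),
      X.Nodup → X ≠ [] →
      ((CommonAdjustment.decideIdentifiable G X Y t).cost : ℝ) ≤
        K * (1 + X.length * (Real.log X.length + (G.numEdges + p) * Real.log p)) :=
  ⟨fun _ G X Y t _ hY hXt hXY => CommonAdjustment.isIdentifiable_iff G X Y t hY hXt hXY,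
    10000, fun _ G X Y t _ hX => CommonAdjustment.decideIdentifiable_cost_le_real G X Y t hX⟩
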